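/- Let $X$ be a real Banach space, let $(G,|\cdot|)$ be an abelian group with a norm (so $|g|=0$ only for $g=0$, $|-g|=|g|$, $|g+h|\le|g|+|h|$) whose metric is complete, and let $k\ge 0$ be an integer. A convex $k$-polyhedron in $X$ is a nonempty bounded subset of a $k$-dimensional affine plane (its affine span) that is cut out of this plane by finitely many closed half-spaces. The group $\mathcal P_k=\mathcal P_k(X,G)$ of polyhedral $k$-chains consists of the finite formal sums $\sum_i g_i[P_i]$ with $g_i\in G$ and $P_i$ oriented convex $k$-polyhedra, modulo $(g_1+g_2)[P]=g_1[P]+g_2[P]$, $(-g)[P]=g[-P]$ (where $-P$ is $P$ with the opposite orientation), and $g[P_1\cup P_2]=g[P_1]+g[P_2]$ if $P_1$, $P_2$ and $P_1\cup P_2$ are convex $k$-polyhedra with compatible orientations and $P_1,P_2$ have disjoint relative interiors. The boundary $\partial:\mathcal P_{k+1}\to\mathcal P_k$ is the homomorphism that sends $g[P]$ to $\sum_F g[F]$, the sum over the facets $F$ of $P$ with the induced (outward vector first) orientation. For a continuous linear functional $f$ on $X$ and $r\in\mathbb R$ let $P_r$ denote the portion of the chain $P$ in $\{f<r\}$, and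 let $P\cap f^{-1}(r)=\partial(P_r)-(\partial P)_r$ be the slice. The mass $M$ is defined by induction on the dimension: $M\bigl(\sum_i g_i[P_i]\bigr)=\sum_i M(g_i[P_i])$ whenever the $P_i$ have pairwise disjoint relative interiors, where $M(g[x])=|g|$ for a point $x$, and $$M(g[P])=\sup_{f\in X^*,\ \|f\|=1}\int_{-\infty}^{\infty}M\bigl(g[P]\cap f^{-1}(r)\bigr)\,dr$$ in positive dimension. The flat norm of $P\in\mathcal P_k$ is $$F(P)=\inf_{Q\in\mathcal P_{k+1}}\bigl(M(Q)+M(\partial Q-P)\bigr).$$ Then $F$ is a norm on the group $\mathcal P_k(X,G)$: for all $P,Q\in\mathcal P_k(X,G)$ we have $F(P)<\infty$, $F(0)=0$, $F(-P)=F(P)$, $F(P+Q)\le F(P)+F(Q)$, and $F(P)=0$ implies $P=0$. -/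

import Mathlib

noncomputable section

open Set MeasureTheory
open scoped ENNReal

namespace FlatChain

variable {X : Type*} [NormedAddCommGroup X] [NormedSpace ℝ X]

/-- A convex polyhedron of dimension `k` in `X`: a nonempty bounded set that is cut out of its
affine span, a `k`-dimensional plane, by finitely many closed half-spaces. -/
structure IsPolyhedron (k : ℕ) (C : Set X) : Prop where
  nonempty : C.Nonempty
  bounded : Bornology.IsBounded C
  finiteDimensional : FiniteDimensional ℝ (vectorSpan ℝ C)
  finrank_eq : Module.finrank ℝ (vectorSpan ℝ C) = k
  halfSpaces : ∃ s : Finset (StrongDual ℝ X × ℝ),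
    C = {x | x ∈ affineSpan ℝ C ∧ ∀ p ∈ s, p.1 x ≤ p.2}

/-- An orientation of a `k`-dimensional subspace `V`, recorded as the set of its positively
oriented `k`-frames: these are the frames of `V` on which some alternating `k`-form that does not
vanish on `V` is positive. (For `k = 0` the two orientations are the set of the empty frame and
the empty set; they stand for the signs `+` and `-`.) -/
def IsOrientation {k : ℕ} (V : Submodule ℝ X) (o : Set (Fin k → X)) : Prop :=
  ∃ ω : X [⋀^Fin k]→ₗ[ℝ] ℝ, (∃ v, (∀ i, v i ∈ V) ∧ ω v ≠ 0) ∧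
    o = {v | (∀ i, v i ∈ V) ∧ 0 < ω v}

variable (X) in
/-- An oriented convex polyhedron of dimension `k` in `X`. -/
@[ext]
structure OrientedPolyhedron (k : ℕ) where
  carrier : Set X
  isPolyhedron : IsPolyhedron k carrier
  orientation : Set (Fin k → X)
  isOrientation : IsOrientation (vectorSpan ℝ carrier) orientation

/-! ### Convex geometry of polyhedra -/

namespace IsPolyhedron

variable {k : ℕ} {C D : Set X}

theorem convex (hC : IsPolyhedron k C) : Convex ℝ C := by
  obtain ⟨s, hs⟩ := hC.halfSpaces
  intro x hx y hy a b ha hb hab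
  rw [hs] at hx hy ⊢
  refine ⟨(affineSpan ℝ C).convex hx.1 hy.1 ha hb hab, fun p hp => ?_⟩
  have h1 := hx.2 p hp
  have h2 := hy.2 p hp
  simp only [map_add, map_smul, smul_eq_mul]
  calc a * p.1 x + b * p.1 y ≤ a * p.2 + b * p.2 := by gcongr
    _ = p.2 := by rw [← add_mul, hab, one_mul]

theorem isClosed (hC : IsPolyhedron k C) : IsClosed C := by
  obtain ⟨s, hs⟩ := hC.halfSpaces
  have := hC.finiteDimensional
  have : FiniteDimensional ℝ (affineSpan ℝ C).direction := by
    rw [direction_affineSpan]; infer_instance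
  have h1 : IsClosed (affineSpan ℝ C : Set X) := AffineSubspace.closed_of_finiteDimensional _
  rw [hs]
  refine h1.inter ?_
  have : {x : X | ∀ p ∈ s, p.1 x ≤ p.2} = ⋂ p ∈ s, {x | p.1 x ≤ p.2} := by ext; simp
  change IsClosed {x : X | ∀ p ∈ s, p.1 x ≤ p.2}
  rw [this]
  exact isClosed_biInter fun p _ => isClosed_le p.1.continuous continuous_const

/-- Polyhedra of the same dimension that lie in each other span the same plane. -/
theorem affineSpan_eq (hC : IsPolyhedron k C) (hD : IsPolyhedron k D) (h : D ⊆ C) :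
    affineSpan ℝ D = affineSpan ℝ C := by
  have := hC.finiteDimensional
  have hv : vectorSpan ℝ D = vectorSpan ℝ C :=
    Submodule.eq_of_le_of_finrank_eq (vectorSpan_mono ℝ h) (by rw [hC.finrank_eq, hD.finrank_eq])
  refine AffineSubspace.ext_of_direction_eq (by rw [direction_affineSpan, direction_affineSpan, hv])
    ?_
  obtain ⟨x, hx⟩ := hD.nonempty
  exact ⟨x, subset_affineSpan ℝ _ hx, subset_affineSpan ℝ _ (h hx)⟩

theorem vectorSpan_eq (hC : IsPolyhedron k C) (hD : IsPolyhedron k D) (h : D ⊆ C) :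
    vectorSpan ℝ D = vectorSpan ℝ C := by
  rw [← direction_affineSpan, ← direction_affineSpan, affineSpan_eq hC hD h]

theorem affineSpan_eq_of_subset_cut {C : Set X} (hC : Convex ℝ C) {h : StrongDual ℝ X} {c : ℝ}
    {a : X} (ha : a ∈ C) (hac : h a < c) :
    affineSpan ℝ {x ∈ C | h x ≤ c} = affineSpan ℝ C := by
  refine le_antisymm (affineSpan_mono ℝ (sep_subset _ _)) (affineSpan_le.2 fun p hp => ?_)
  have ha' : a ∈ affineSpan ℝ {x ∈ C | h x ≤ c} := subset_affineSpan ℝ _ ⟨ha, hac.le⟩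
  by_cases hpc : h p ≤ c
  · exact subset_affineSpan ℝ _ ⟨hp, hpc⟩
  push Not at hpc
  set t : ℝ := (c - h a) / (h p - h a) with ht
  have hpos : 0 < h p - h a := by linarith
  have ht0 : 0 < t := div_pos (by linarith) hpos
  have ht1 : t ≤ 1 := by rw [ht, div_le_one hpos]; linarith
  have hq : a + t • (p - a) ∈ affineSpan ℝ {x ∈ C | h x ≤ c} := by
    refine subset_affineSpan ℝ _ ⟨hC.add_smul_sub_mem ha hp ⟨ht0.le, ht1⟩, ?_⟩
    simp only [map_add, map_smul, map_sub, smul_eq_mul]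
    rw [ht, div_mul_cancel₀ _ hpos.ne']; linarith
  have := AffineMap.lineMap_mem (Q := affineSpan ℝ {x ∈ C | h x ≤ c}) (t⁻¹) ha' hq
  rw [AffineMap.lineMap_apply] at this
  simpa [smul_smul, inv_mul_cancel₀ ht0.ne'] using this

/-- The part of a polyhedron in a closed half-space that meets it properly. -/
theorem cut (hC : IsPolyhedron k C) {h : StrongDual ℝ X} {c : ℝ} {a : X} (ha : a ∈ C)
    (hac : h a < c) : IsPolyhedron k {x ∈ C | h x ≤ c} := by
  classical
  have hspan := affineSpan_eq_of_subset_cut hC.convex ha hac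
  have hv : vectorSpan ℝ {x ∈ C | h x ≤ c} = vectorSpan ℝ C := by
    rw [← direction_affineSpan, ← direction_affineSpan, hspan]
  refine ⟨⟨a, ha, hac.le⟩, hC.bounded.subset (sep_subset _ _), ?_, ?_, ?_⟩
  · rw [hv]; exact hC.finiteDimensional
  · rw [hv]; exact hC.finrank_eq
  · obtain ⟨s, hs⟩ := hC.halfSpaces
    refine ⟨insert (h, c) s, ?_⟩
    rw [hspan]
    ext x
    simp only [mem_ofPred_eq, Finset.mem_insert, forall_eq_or_imp]
    constructor
    · rintro ⟨hx, hxc⟩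
      rw [hs] at hx
      exact ⟨hx.1, hxc, hx.2⟩
    · rintro ⟨h1, h2, h3⟩
      refine ⟨?_, h2⟩
      rw [hs]; exact ⟨h1, h3⟩

/-- A subset cut out of a polyhedron by an equation is a polyhedron of its own dimension. -/
theorem section_of_finrank {n : ℕ} (hC : IsPolyhedron n C) {l : StrongDual ℝ X} {m : ℝ}
    (hne : {x ∈ C | l x = m}.Nonempty)
    (hk : Module.finrank ℝ (vectorSpan ℝ {x ∈ C | l x = m}) = k) :
    IsPolyhedron k {x ∈ C | l x = m} := by
  classical
  have := hC.finiteDimensional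
  have hsub : {x ∈ C | l x = m} ⊆ C := sep_subset _ _
  refine ⟨hne, hC.bounded.subset hsub,
    Submodule.finiteDimensional_of_le (vectorSpan_mono ℝ hsub), hk, ?_⟩
  obtain ⟨s, hs⟩ := hC.halfSpaces
  refine ⟨insert (l, m) (insert (-l, -m) s), ?_⟩
  ext x
  simp only [mem_ofPred_eq, Finset.mem_insert, forall_eq_or_imp, neg_apply,
    neg_le_neg_iff]
  constructor
  · rintro ⟨hx, hxm⟩
    refine ⟨subset_affineSpan ℝ _ ⟨hx, hxm⟩, hxm.le, hxm.ge, ?_⟩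
    rw [hs] at hx
    exact hx.2
  · rintro ⟨h1, h2, h3, h4⟩
    refine ⟨?_, le_antisymm h2 h3⟩
    rw [hs]
    exact ⟨affineSpan_mono ℝ hsub h1, h4⟩

/-- In a `(k+1)`-dimensional polyhedron on which `l` is not constant, a `k`-dimensional piece of a
level set of `l` has the kernel of `l` as its direction. -/
theorem vectorSpan_level (hC : IsPolyhedron (k + 1) C) (hD : IsPolyhedron k D) (hDC : D ⊆ C)
    {l : StrongDual ℝ X} {m : ℝ} (hl : ∀ x ∈ D, l x = m) {y : X} (hy : y ∈ C) (hym : l y ≠ m) :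
    vectorSpan ℝ D = vectorSpan ℝ C ⊓ LinearMap.ker (l : X →ₗ[ℝ] ℝ) := by
  have := hC.finiteDimensional
  obtain ⟨x, hx⟩ := hD.nonempty
  have hle : vectorSpan ℝ D ≤ vectorSpan ℝ C ⊓ LinearMap.ker (l : X →ₗ[ℝ] ℝ) := by
    refine le_inf (vectorSpan_mono ℝ hDC) ?_
    rw [vectorSpan_def, Submodule.span_le]
    rintro _ ⟨p, hp, q, hq, rfl⟩
    simp [hl p hp, hl q hq]
  refine Submodule.eq_of_le_of_finrank_le hle ?_
  rw [hD.finrank_eq]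
  have hlt : vectorSpan ℝ C ⊓ LinearMap.ker (l : X →ₗ[ℝ] ℝ) < vectorSpan ℝ C := by
    refine lt_of_le_of_ne inf_le_left fun he => ?_
    have h1 : y - x ∈ vectorSpan ℝ C := vsub_mem_vectorSpan ℝ hy (hDC hx)
    rw [← he] at h1
    have h2 : l (y - x) = 0 := h1.2
    rw [map_sub, hl x hx, sub_eq_zero] at h2
    exact hym h2
  have := Submodule.finrank_lt_finrank_of_lt hlt
  rw [hC.finrank_eq] at this
  omega

/-- A hyperplane that meets a `(k+1)`-dimensional polyhedron properly cuts out a `k`-dimensional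
polyhedron. -/
theorem hyperplane_section (hC : IsPolyhedron (k + 1) C) {h : StrongDual ℝ X} {c : ℝ} {a b : X}
    (ha : a ∈ C) (hac : h a < c) (hb : b ∈ C) (hbc : c < h b) :
    IsPolyhedron k {x ∈ C | h x = c} := by
  have hfd := hC.finiteDimensional
  set T := {x ∈ C | h x = c} with hT
  -- the point of `T` on the segment between `p` and `q`
  have key : ∀ p ∈ C, ∀ q ∈ C, h p < c → c ≤ h q →
      ∃ t : ℝ, 0 < t ∧ t ≤ 1 ∧ p + t • (q - p) ∈ T := by
    intro p hp q hq hpc hqc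
    have hpos : 0 < h q - h p := by linarith
    have ht0 : 0 < (c - h p) / (h q - h p) := div_pos (by linarith) hpos
    have ht1 : (c - h p) / (h q - h p) ≤ 1 := by rw [div_le_one hpos]; linarith
    refine ⟨_, ht0, ht1, hC.convex.add_smul_sub_mem hp hq ⟨ht0.le, ht1⟩, ?_⟩
    simp only [map_add, map_smul, map_sub, smul_eq_mul]
    rw [div_mul_cancel₀ _ hpos.ne']; linarith
  obtain ⟨t₀, ht₀, ht₀1, hz⟩ := key a ha b hb hac hbc.le
  set z := a + t₀ • (b - a) with hzdef
  refine section_of_finrank hC ⟨z, hz⟩ (le_antisymm ?_ ?_) <;> rw [← hT]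
  · have hle : vectorSpan ℝ T ≤ vectorSpan ℝ C := vectorSpan_mono ℝ (sep_subset _ _)
    have hlt : vectorSpan ℝ T < vectorSpan ℝ C := by
      refine lt_of_le_of_ne hle fun he => ?_
      have h1 : b - a ∈ vectorSpan ℝ T := he ▸ vsub_mem_vectorSpan ℝ hb ha
      have h2 : vectorSpan ℝ T ≤ LinearMap.ker (h : X →ₗ[ℝ] ℝ) := by
        rw [vectorSpan_def, Submodule.span_le]
        rintro _ ⟨p, hp, q, hq, rfl⟩
        simp [hp.2, hq.2]
      have h3 : h (b - a) = 0 := h2 h1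
      rw [map_sub] at h3; linarith
    have := Submodule.finrank_lt_finrank_of_lt hlt
    rw [hC.finrank_eq] at this
    omega
  · have hle : vectorSpan ℝ C ≤ vectorSpan ℝ T ⊔ ℝ ∙ (a - z) := by
      set W := vectorSpan ℝ T ⊔ ℝ ∙ (a - z) with hW
      have haz : a - z ∈ W := Submodule.mem_sup_right (Submodule.mem_span_singleton_self _)
      have hTz : ∀ q ∈ T, q - z ∈ W := fun q hq =>
        Submodule.mem_sup_left (vsub_mem_vectorSpan ℝ hq hz)
      have hbz : b - z ∈ W := by
        have : b - z = (1 - t₀⁻¹) • (a - z) := by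
          have e : b = a + t₀⁻¹ • (z - a) := by
            rw [hzdef, add_sub_cancel_left, smul_smul, inv_mul_cancel₀ ht₀.ne', one_smul]; abel
          conv_lhs => rw [e]
          module
        rw [this]; exact W.smul_mem _ haz
      have hall : ∀ p ∈ C, p - z ∈ W := by
        intro p hp
        rcases lt_or_ge (h p) c with hpc | hpc
        · obtain ⟨t, ht, ht1, hq⟩ := key p hp b hb hpc hbc.le
          have ht' : t ≠ 1 := by
            rintro rfl
            have : h b = c := by simpa using hq.2
            linarith
          have h1 := hTz _ hq
          have h2 : p - z = (1 - t)⁻¹ • ((p + t • (b - p) - z) - t • (b - z)) := by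
            have : (p + t • (b - p) - z) - t • (b - z) = (1 - t) • (p - z) := by module
            rw [this, smul_smul, inv_mul_cancel₀ (sub_ne_zero.2 ht'.symm), one_smul]
          rw [h2]
          exact W.smul_mem _ (W.sub_mem h1 (W.smul_mem _ hbz))
        · obtain ⟨t, ht, ht1, hq⟩ := key a ha p hp hac hpc
          have h1 := hTz _ hq
          have h2 : p - z = t⁻¹ • ((a + t • (p - a) - z) - (1 - t) • (a - z)) := by
            have : (a + t • (p - a) - z) - (1 - t) • (a - z) = t • (p - z) := by module
            rw [this, smul_smul, inv_mul_cancel₀ ht.ne', one_smul]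
          rw [h2]
          exact W.smul_mem _ (W.sub_mem h1 (W.smul_mem _ haz))
      rw [vectorSpan_def, Submodule.span_le]
      rintro _ ⟨p, hp, q, hq, rfl⟩
      have : p -ᵥ q = (p - z) - (q - z) := by simp
      change p -ᵥ q ∈ W
      rw [this]
      exact W.sub_mem (hall p hp) (hall q hq)
    have hfT : FiniteDimensional ℝ (vectorSpan ℝ T) :=
      Submodule.finiteDimensional_of_le (vectorSpan_mono ℝ (sep_subset _ _))
    have h1 := Submodule.finrank_mono hle
    have h2 := Submodule.finrank_add_le_finrank_add_finrank (vectorSpan ℝ T) (ℝ ∙ (a - z))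
    have h3 : Module.finrank ℝ (ℝ ∙ (a - z)) ≤ 1 := by
      simpa using finrank_span_le_card (R := ℝ) ({a - z} : Set X)
    rw [hC.finrank_eq] at h1
    omega

end IsPolyhedron


/-- `F` is a facet of the `(k+1)`-dimensional polyhedron `C`: a `k`-dimensional exposed face. -/
def IsFacet (k : ℕ) (C F : Set X) : Prop := IsExposed ℝ C F ∧ IsPolyhedron k F

namespace IsFacet

variable {k : ℕ} {C F E : Set X}

theorem subset (hF : IsFacet k C F) : F ⊆ C := hF.1.subset

theorem exists_level (hC : IsPolyhedron (k + 1) C) (hF : IsFacet k C F) :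
    ∃ (l : StrongDual ℝ X) (m : ℝ), F = {x ∈ C | l x = m} ∧ (∀ x ∈ C, l x ≤ m) ∧
      ∃ y ∈ C, l y < m := by
  obtain ⟨l, hl⟩ := hF.1 hF.2.nonempty
  obtain ⟨x₀, hx₀⟩ := hF.2.nonempty
  have hx₀' := hx₀
  rw [hl] at hx₀'
  have hFl : F = {x ∈ C | l x = l x₀} := by
    rw [hl]
    ext x
    simp only [mem_ofPred_eq]
    constructor
    · rintro ⟨h1, h2⟩
      exact ⟨h1, le_antisymm (hx₀'.2 x h1) (h2 x₀ hx₀'.1)⟩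
    · rintro ⟨h1, h2⟩
      exact ⟨h1, fun y hy => h2 ▸ hx₀'.2 y hy⟩
  refine ⟨l, l x₀, hFl, hx₀'.2, ?_⟩
  by_contra! hcon
  have : F = C := by
    rw [hFl]
    ext x
    simp only [mem_ofPred_eq, and_iff_left_iff_imp]
    exact fun hx => le_antisymm (hx₀'.2 x hx) (hcon x hx)
  have h1 := hF.2.finrank_eq
  rw [this, hC.finrank_eq] at h1
  omega

theorem of_level {n : ℕ} (hC : IsPolyhedron n C) {l : StrongDual ℝ X} {m : ℝ}
    (hm : ∀ x ∈ C, l x ≤ m) (hne : {x ∈ C | l x = m}.Nonempty)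
    (hk : Module.finrank ℝ (vectorSpan ℝ {x ∈ C | l x = m}) = k) :
    IsFacet k C {x ∈ C | l x = m} := by
  refine ⟨fun _ => ⟨l, ?_⟩, hC.section_of_finrank hne hk⟩
  obtain ⟨z, hz, hzm⟩ := hne
  ext x
  simp only [mem_ofPred_eq]
  constructor
  · rintro ⟨h1, h2⟩
    exact ⟨h1, fun y hy => h2 ▸ hm y hy⟩
  · rintro ⟨h1, h2⟩
    exact ⟨h1, le_antisymm (hm x h1) (hzm ▸ h2 z hz)⟩

/-- A facet that lies in a level set not containing the whole polyhedron is that level set. -/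
theorem eq_level (hC : IsPolyhedron (k + 1) C) (hF : IsFacet k C F) {p : StrongDual ℝ X} {q : ℝ}
    (hFp : ∀ x ∈ F, p x = q) {y : X} (hy : y ∈ C) (hyq : p y ≠ q) : F = {x ∈ C | p x = q} := by
  obtain ⟨l, m, hl, -, z, hz, hzm⟩ := hF.exists_level hC
  refine Subset.antisymm (fun x hx => ⟨hF.subset hx, hFp x hx⟩) ?_
  rintro x ⟨hx, hxq⟩
  obtain ⟨x₀, hx₀⟩ := hF.2.nonempty
  have h1 := hC.vectorSpan_level hF.2 hF.subset hFp hy hyq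
  have h2 := hC.vectorSpan_level hF.2 hF.subset (fun x hx => (hl ▸ hx : x ∈ {x ∈ C | l x = m}).2)
    hz hzm.ne
  have h3 : x - x₀ ∈ vectorSpan ℝ F := by
    rw [h1]
    refine ⟨vsub_mem_vectorSpan ℝ hx (hF.subset hx₀), ?_⟩
    simp [hxq, hFp x₀ hx₀]
  rw [h2] at h3
  have h4 : l (x - x₀) = 0 := h3.2
  have h5 : l x₀ = m := (hl ▸ hx₀ : x₀ ∈ {x ∈ C | l x = m}).2
  rw [map_sub, h5, sub_eq_zero] at h4
  rw [hl]
  exact ⟨hx, h4⟩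

theorem finite (hC : IsPolyhedron (k + 1) C) : {F | IsFacet k C F}.Finite := by
  classical
  obtain ⟨s, hs⟩ := hC.halfSpaces
  refine (s.finite_toSet.image fun p => {x ∈ C | p.1 x = p.2}).subset ?_
  intro F hF
  have hF : IsFacet k C F := hF
  suffices ∃ p ∈ s, (∀ x ∈ F, p.1 x = p.2) ∧ ∃ y ∈ C, p.1 y ≠ p.2 by
    obtain ⟨p, hp, h1, y, hy, hyp⟩ := this
    exact ⟨p, hp, (hF.eq_level hC h1 hy hyp).symm⟩
  by_contra! hcon
  obtain ⟨l, m, hl, hm, z, hz, hzm⟩ := hF.exists_level hC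
  have hle : ∀ x ∈ C, ∀ p ∈ s, p.1 x ≤ p.2 := fun x hx p hp => by
    rw [hs] at hx; exact hx.2 p hp
  -- a point of `F` where all constraints that are not active on `F` are strict
  have hpt : ∀ t ⊆ s, ∃ x ∈ F, ∀ p ∈ t, (∃ x ∈ F, p.1 x ≠ p.2) → p.1 x < p.2 := by
    intro t
    induction t using Finset.induction_on with
    | empty => exact fun _ => ⟨hF.2.nonempty.some, hF.2.nonempty.some_mem, by simp⟩
    | insert p t hpt ih =>
      intro hts
      obtain ⟨x, hx, hxt⟩ := ih fun q hq => hts (Finset.mem_insert_of_mem hq)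
      by_cases hact : ∃ x ∈ F, p.1 x ≠ p.2
      · obtain ⟨w, hw, hwp⟩ := hact
        refine ⟨(1 / 2 : ℝ) • x + (1 / 2 : ℝ) • w,
          hF.2.convex hx hw (by norm_num) (by norm_num) (by norm_num), fun q hq hqa => ?_⟩
        simp only [map_add, map_smul, smul_eq_mul]
        have h1 := hle x (hF.subset hx) q (hts hq)
        have h2 := hle w (hF.subset hw) q (hts hq)
        rcases Finset.mem_insert.1 hq with rfl | hq
        · have := lt_of_le_of_ne h2 hwp
          linarith
        · have := hxt q hq hqa
          linarith
      · refine ⟨x, hx, fun q hq hqa => ?_⟩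
        rcases Finset.mem_insert.1 hq with rfl | hq
        · exact absurd hqa hact
        · exact hxt q hq hqa
  obtain ⟨x, hx, hxs⟩ := hpt s subset_rfl
  have hxC := hF.subset hx
  -- moving from `x` away from `z` stays in `C` for a short time
  have hev : ∀ᶠ ε in nhdsWithin (0 : ℝ) (Ioi 0), ∀ p ∈ s, p.1 (x + ε • (x - z)) ≤ p.2 := by
    rw [Filter.eventually_all_finset]
    intro p hp
    by_cases hact : ∃ x ∈ F, p.1 x ≠ p.2
    · have h1 := hxs p hp hact
      have hcont : Continuous fun ε : ℝ => p.1 (x + ε • (x - z)) := by fun_prop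
      have h2 : ∀ᶠ ε in nhds (0 : ℝ), p.1 (x + ε • (x - z)) < p.2 :=
        hcont.continuousAt.eventually_lt continuousAt_const (by simpa using h1)
      exact (h2.filter_mono nhdsWithin_le_nhds).mono fun _ h => h.le
    · push Not at hact
      have h1 := hcon p hp hact z hz
      refine Filter.Eventually.of_forall fun ε => ?_
      simp [hact x hx, h1]
  obtain ⟨ε, hε, hεpos⟩ := (hev.and self_mem_nhdsWithin).exists
  have hmem : x + ε • (x - z) ∈ C := by
    rw [hs]
    refine ⟨?_, hε⟩
    have h1 := AffineMap.lineMap_mem (Q := affineSpan ℝ C) (1 + ε) (subset_affineSpan ℝ _ hz)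
      (subset_affineSpan ℝ _ hxC)
    have h2 : AffineMap.lineMap z x (1 + ε) = x + ε • (x - z) := by
      rw [AffineMap.lineMap_apply]
      simp only [vsub_eq_sub, vadd_eq_add]
      module
    rwa [h2] at h1
  have h1 := hm _ hmem
  have h2 : l x = m := (hl ▸ hx : x ∈ {x ∈ C | l x = m}).2
  simp only [map_add, map_smul, map_sub, smul_eq_mul, h2] at h1
  have : 0 < ε * (m - l z) := mul_pos hεpos (by linarith)
  linarith

end IsFacet

/-- Two polyhedra with disjoint relative interiors whose union is a polyhedron of the same
dimension are the two parts into which a hyperplane cuts this union. -/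
theorem exists_cut {k : ℕ} {C C₁ C₂ : Set X} (hC : IsPolyhedron k C) (h₁ : IsPolyhedron k C₁)
    (h₂ : IsPolyhedron k C₂) (hU : C = C₁ ∪ C₂)
    (hd : Disjoint (intrinsicInterior ℝ C₁) (intrinsicInterior ℝ C₂)) :
    ∃ (h : StrongDual ℝ X) (c : ℝ), C₁ = {x ∈ C | h x ≤ c} ∧ C₂ = {x ∈ C | c ≤ h x} ∧
      (∃ a ∈ C, h a < c) ∧ ∃ b ∈ C, c < h b := by
  have hfd := hC.finiteDimensional
  set V := vectorSpan ℝ C with hV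
  obtain ⟨x₀, hx₀⟩ := hC.nonempty
  let φ : V →ᵃ[ℝ] X := ⟨fun v => (v : X) + x₀, V.subtype, fun p v => by simp [add_assoc]⟩
  have hφ : ∀ v : V, φ v = (v : X) + x₀ := fun _ => rfl
  have hφc : Continuous φ := by
    change Continuous fun v : V => (v : X) + x₀
    fun_prop
  have hlift : ∀ x ∈ C, ∃ v : V, φ v = x := fun x hx =>
    ⟨⟨x - x₀, vsub_mem_vectorSpan ℝ hx hx₀⟩, by simp [hφ]⟩
  -- the relative interior, seen in `V`
  have hint : ∀ D : Set X, IsPolyhedron k D → D ⊆ C → (interior (φ ⁻¹' D)).Nonempty ∧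
      ∀ v ∈ interior (φ ⁻¹' D), φ v ∈ intrinsicInterior ℝ D := by
    intro D hD hDC
    have hDV : vectorSpan ℝ D = V := hC.vectorSpan_eq hD hDC
    have himg : φ '' (φ ⁻¹' D) = D := by
      rw [image_preimage_eq_iff]
      intro x hx
      exact hlift x (hDC hx)
    have hconv : Convex ℝ (φ ⁻¹' D) := hD.convex.affine_preimage φ
    constructor
    · rw [hconv.interior_nonempty_iff_affineSpan_eq_top]
      have h1 : (vectorSpan ℝ (φ ⁻¹' D)).map V.subtype = V := by
        have := AffineMap.map_vectorSpan φ (s := φ ⁻¹' D)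
        rw [himg, hDV] at this
        exact this
      have h2 : vectorSpan ℝ (φ ⁻¹' D) = ⊤ := by
        refine Submodule.map_injective_of_injective V.injective_subtype ?_
        rw [h1, Submodule.map_top, Submodule.range_subtype]
      obtain ⟨d, hdD⟩ := hD.nonempty
      obtain ⟨v, hv⟩ := hlift d (hDC hdD)
      refine (AffineSubspace.affineSpan_eq_top_iff_vectorSpan_eq_top_of_nonempty ℝ V V
        (s := φ ⁻¹' D) ⟨v, by simpa [hv] using hdD⟩).2 h2
    · intro v hv
      rw [mem_intrinsicInterior]
      have hvD : φ v ∈ D := (interior_subset hv : v ∈ φ ⁻¹' D)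
      refine ⟨⟨φ v, subset_affineSpan ℝ _ hvD⟩, ?_, rfl⟩
      have hmem : ∀ y : affineSpan ℝ D, (y : X) - x₀ ∈ V := fun y => by
        rw [hV, ← direction_affineSpan]
        exact AffineSubspace.vsub_mem_direction
          (affineSpan_mono ℝ hDC y.2) (subset_affineSpan ℝ _ hx₀)
      let ψ : affineSpan ℝ D → V := fun y => ⟨(y : X) - x₀, hmem y⟩
      have hψ : Continuous ψ := by
        refine Continuous.subtype_mk ?_ _
        exact continuous_subtype_val.sub continuous_const
      rw [mem_interior]
      refine ⟨ψ ⁻¹' interior (φ ⁻¹' D), ?_, isOpen_interior.preimage hψ, ?_⟩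
      · intro y hy
        have : φ (ψ y) ∈ D := (interior_subset (mem_preimage.1 hy) : ψ y ∈ φ ⁻¹' D)
        simpa [hφ, ψ] using this
      · have : ψ ⟨φ v, subset_affineSpan ℝ _ hvD⟩ = v := by
          ext; simp [ψ, hφ]
        simpa [this] using hv
  have hs1 : C₁ ⊆ C := hU ▸ subset_union_left
  have hs2 : C₂ ⊆ C := hU ▸ subset_union_right
  obtain ⟨⟨v₁, hv₁⟩, hi₁⟩ := hint C₁ h₁ hs1
  obtain ⟨⟨v₂, hv₂⟩, hi₂⟩ := hint C₂ h₂ hs2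
  have hc₁ : Convex ℝ (φ ⁻¹' C₁) := h₁.convex.affine_preimage φ
  have hc₂ : Convex ℝ (φ ⁻¹' C₂) := h₂.convex.affine_preimage φ
  obtain ⟨f, u, hf₁, hf₂⟩ := geometric_hahn_banach_open_open hc₁.interior isOpen_interior
    hc₂.interior isOpen_interior
    (disjoint_left.2 fun v hv hv' => disjoint_left.1 hd (hi₁ v hv) (hi₂ v hv'))
  obtain ⟨h, hh, -⟩ := exists_extension_norm_eq V f
  have hφh : ∀ v : V, h (φ v) = f v + h x₀ := fun v => by rw [hφ, map_add, hh]
  have hle₁ : ∀ x ∈ C₁, h x ≤ u + h x₀ := by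
    intro x hx
    obtain ⟨v, rfl⟩ := hlift x (hs1 hx)
    rw [hφh]
    have : v ∈ closure (interior (φ ⁻¹' C₁)) := by
      rw [hc₁.closure_interior_eq_closure_of_nonempty_interior ⟨v₁, hv₁⟩]
      exact subset_closure hx
    have h3 : closure (interior (φ ⁻¹' C₁)) ⊆ {v | f v ≤ u} :=
      closure_minimal (fun v hv => (hf₁ v hv).le) (isClosed_le f.continuous continuous_const)
    have h4 : f v ≤ u := h3 this
    linarith
  have hle₂ : ∀ x ∈ C₂, u + h x₀ ≤ h x := by
    intro x hx
    obtain ⟨v, rfl⟩ := hlift x (hs2 hx)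
    rw [hφh]
    have : v ∈ closure (interior (φ ⁻¹' C₂)) := by
      rw [hc₂.closure_interior_eq_closure_of_nonempty_interior ⟨v₂, hv₂⟩]
      exact subset_closure hx
    have h3 : closure (interior (φ ⁻¹' C₂)) ⊆ {v | u ≤ f v} :=
      closure_minimal (fun v hv => (hf₂ v hv).le) (isClosed_le continuous_const f.continuous)
    have h4 : u ≤ f v := h3 this
    linarith
  have ha : φ v₁ ∈ C₁ := (interior_subset hv₁ : v₁ ∈ φ ⁻¹' C₁)
  have hb : φ v₂ ∈ C₂ := (interior_subset hv₂ : v₂ ∈ φ ⁻¹' C₂)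
  have hau : h (φ v₁) < u + h x₀ := by rw [hφh]; linarith [hf₁ v₁ hv₁]
  have hbu : u + h x₀ < h (φ v₂) := by rw [hφh]; linarith [hf₂ v₂ hv₂]
  -- points of the cutting hyperplane are limits from both sides
  have hlim : ∀ D : Set X, IsPolyhedron k D → ∀ x a : X,
      (∀ t ∈ Ioo (0 : ℝ) 1, x + t • (a - x) ∈ D) → x ∈ D := by
    intro D hD x a hxa
    have hcont : Continuous fun t : ℝ => x + t • (a - x) := by fun_prop
    have ht : Filter.Tendsto (fun t : ℝ => x + t • (a - x)) (nhdsWithin 0 (Ioi 0)) (nhds x) := by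
      have := (hcont.tendsto 0).mono_left (nhdsWithin_le_nhds (s := Ioi (0 : ℝ)))
      simpa using this
    refine hD.isClosed.mem_of_tendsto ht ?_
    filter_upwards [Ioo_mem_nhdsGT (zero_lt_one (α := ℝ))] with t ht using hxa t ht
  refine ⟨h, u + h x₀, ?_, ?_, ⟨_, hs1 ha, hau⟩, ⟨_, hs2 hb, hbu⟩⟩
  · refine Subset.antisymm (fun x hx => ⟨hs1 hx, hle₁ x hx⟩) ?_
    rintro x ⟨hx, hxu⟩
    refine hlim C₁ h₁ x (φ v₁) fun t ht => ?_
    have hmem := hC.convex.add_smul_sub_mem hx (hs1 ha) ⟨ht.1.le, ht.2.le⟩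
    rw [hU] at hmem
    refine hmem.resolve_right fun hm => ?_
    have := hle₂ _ hm
    simp only [map_add, map_smul, map_sub, smul_eq_mul] at this
    nlinarith [ht.1, ht.2]
  · refine Subset.antisymm (fun x hx => ⟨hs2 hx, hle₂ x hx⟩) ?_
    rintro x ⟨hx, hxu⟩
    refine hlim C₂ h₂ x (φ v₂) fun t ht => ?_
    have hmem := hC.convex.add_smul_sub_mem hx (hs2 hb) ⟨ht.1.le, ht.2.le⟩
    rw [hU] at hmem
    refine hmem.resolve_left fun hm => ?_
    have := hle₁ _ hm
    simp only [map_add, map_smul, map_sub, smul_eq_mul] at this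
    nlinarith [ht.1, ht.2]

/-! ### Orientations -/

theorem form_ne_zero {k : ℕ} {V : Submodule ℝ X} [FiniteDimensional ℝ V]
    (hV : Module.finrank ℝ V = k) {ω : X [⋀^Fin k]→ₗ[ℝ] ℝ}
    (hω : ∃ v, (∀ i, v i ∈ V) ∧ ω v ≠ 0) {w : Fin k → X} (hw : ∀ i, w i ∈ V)
    (hli : LinearIndependent ℝ w) : ω w ≠ 0 := by
  obtain ⟨v, hv, hv0⟩ := hω
  rcases Nat.eq_zero_or_pos k with rfl | hk
  · rwa [Subsingleton.elim w v]
  have : Nonempty (Fin k) := ⟨⟨0, hk⟩⟩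
  let w' : Fin k → V := fun i => ⟨w i, hw i⟩
  have hli' : LinearIndependent ℝ w' := LinearIndependent.of_comp V.subtype hli
  let e := basisOfLinearIndependentOfCardEqFinrank hli' (by simp [hV])
  have he : ⇑e = w' := coe_basisOfLinearIndependentOfCardEqFinrank _ _
  have h1 : ω.compLinearMap V.subtype ≠ 0 := by
    intro h0
    have := congrArg (fun η : V [⋀^Fin k]→ₗ[ℝ] ℝ => η fun i => ⟨v i, hv i⟩) h0
    exact hv0 (by simpa using this)
  have h2 := ((ω.compLinearMap V.subtype).map_basis_ne_zero_iff e).2 h1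
  rw [he] at h2
  exact h2

theorem form_eq_zero {k : ℕ} {W : Submodule ℝ X} [FiniteDimensional ℝ W]
    (hW : Module.finrank ℝ W = k) (ω : X [⋀^Fin (k + 1)]→ₗ[ℝ] ℝ) {w : Fin (k + 1) → X}
    (hw : ∀ i, w i ∈ W) : ω w = 0 := by
  refine ω.map_linearDependent w fun hli => ?_
  have hli' : LinearIndependent ℝ (fun i => (⟨w i, hw i⟩ : W)) :=
    LinearIndependent.of_comp W.subtype hli
  have := hli'.fintype_card_le_finrank
  simp [hW] at this

theorem exists_frame {k : ℕ} {V : Submodule ℝ X} [FiniteDimensional ℝ V]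
    (hV : Module.finrank ℝ V = k) : ∃ v : Fin k → X, (∀ i, v i ∈ V) ∧ LinearIndependent ℝ v := by
  let e := Module.finBasisOfFinrankEq ℝ V hV
  exact ⟨fun i => e i, fun i => (e i).2, e.linearIndependent.map' V.subtype (by simp)⟩

/-- Two different orientations of a subspace are opposite. -/
theorem IsOrientation.exists_opposite {k : ℕ} {V : Submodule ℝ X} [FiniteDimensional ℝ V]
    (hV : Module.finrank ℝ V = k) {o o' : Set (Fin k → X)} (ho : IsOrientation V o)
    (ho' : IsOrientation V o') (hne : o ≠ o') :
    ∃ ω : X [⋀^Fin k]→ₗ[ℝ] ℝ, (∃ v, (∀ i, v i ∈ V) ∧ ω v ≠ 0) ∧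
      o = {v | (∀ i, v i ∈ V) ∧ 0 < ω v} ∧ o' = {v | (∀ i, v i ∈ V) ∧ 0 < (-ω) v} := by
  obtain ⟨ω, hω, rfl⟩ := ho
  obtain ⟨ω', hω', rfl⟩ := ho'
  refine ⟨ω, hω, rfl, ?_⟩
  obtain ⟨e, heV, he⟩ := exists_frame hV
  have h1 := form_ne_zero hV hω heV he
  have h2 := form_ne_zero hV hω' heV he
  -- the two forms are proportional on `V`
  have hprop : ∀ v, (∀ i, v i ∈ V) → ω e * ω' v = ω' e * ω v := by
    intro v hv
    by_contra hcon
    have h3 : ∃ v, (∀ i, v i ∈ V) ∧ (ω e • ω' - ω' e • ω) v ≠ 0 :=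
      ⟨v, hv, by simpa [sub_eq_zero] using hcon⟩
    refine form_ne_zero hV h3 heV he ?_
    simp [mul_comm]
  rcases lt_or_gt_of_ne (mul_ne_zero h1 h2) with hneg | hpos
  · ext v
    simp only [mem_ofPred_eq, AlternatingMap.neg_apply]
    refine and_congr_right fun hv => ?_
    have h3 := hprop v hv
    have h4 : ω e * ω e * ω' v = (ω e * ω' e) * ω v := by rw [mul_assoc, h3]; ring
    have h5 : 0 < ω e * ω e := mul_self_pos.2 h1
    constructor <;> intro h <;> nlinarith
  · exfalso
    refine hne ?_
    ext v
    simp only [mem_ofPred_eq]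
    refine and_congr_right fun hv => ?_
    have h3 := hprop v hv
    have h4 : ω e * ω e * ω' v = (ω e * ω' e) * ω v := by rw [mul_assoc, h3]; ring
    have h5 : 0 < ω e * ω e := mul_self_pos.2 h1
    constructor <;> intro h <;> nlinarith

theorem IsOrientation.ne_of_neg {k : ℕ} {V : Submodule ℝ X} {ω : X [⋀^Fin k]→ₗ[ℝ] ℝ}
    (hω : ∃ v, (∀ i, v i ∈ V) ∧ ω v ≠ 0) :
    {v | (∀ i, v i ∈ V) ∧ 0 < ω v} ≠ {v | (∀ i, v i ∈ V) ∧ 0 < (-ω) v} := by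
  intro h
  obtain ⟨v, hv, hv0⟩ := hω
  have := Set.ext_iff.1 h v
  simp only [mem_ofPred_eq, hv, AlternatingMap.neg_apply, implies_true, true_and, Left.neg_pos_iff] at this
  rcases lt_or_gt_of_ne hv0 with h1 | h1
  · exact absurd (this.2 h1) (by linarith)
  · exact absurd (this.1 h1) (by linarith)

/-- The orientation that a facet `F` of `C` inherits from an orientation `o` of `C`: a frame of `F`
is positive if putting a vector that points out of `C` across `F` in front of it gives a positive
frame of `C`. The differences `x - y` with `x` in `F` and `y` in `C` outside `F` are such vectors,
and all of them give the same orientation. -/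
def inducedOrientation {k : ℕ} (o : Set (Fin (k + 1) → X)) (C F : Set X) : Set (Fin k → X) :=
  {v | (∀ i, v i ∈ vectorSpan ℝ F) ∧ ∃ x ∈ F, ∃ y ∈ C \ F, Matrix.vecCons (x - y) v ∈ o}

section induced

variable {k : ℕ} {C F : Set X}

theorem inducedOrientation_eq (hC : IsPolyhedron (k + 1) C) (hF : IsFacet k C F)
    (ω : X [⋀^Fin (k + 1)]→ₗ[ℝ] ℝ) {x₀ y₀ : X} (hx₀ : x₀ ∈ F) (hy₀ : y₀ ∈ C \ F) :
    inducedOrientation {v | (∀ i, v i ∈ vectorSpan ℝ C) ∧ 0 < ω v} C F =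
      {v | (∀ i, v i ∈ vectorSpan ℝ F) ∧ 0 < ω.curryLeft (x₀ - y₀) v} := by
  have := hF.2.finiteDimensional
  obtain ⟨l, m, hl, hm, z, hz, hzm⟩ := hF.exists_level hC
  have hlev : ∀ x ∈ F, l x = m := fun x hx => (hl ▸ hx : x ∈ {x ∈ C | l x = m}).2
  have hlt : ∀ y ∈ C \ F, l y < m := fun y hy =>
    lt_of_le_of_ne (hm y hy.1) fun h => hy.2 (by rw [hl]; exact ⟨hy.1, h⟩)
  have hspan := hC.vectorSpan_level hF.2 hF.subset hlev hz hzm.ne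
  have key : ∀ x ∈ F, ∀ y ∈ C \ F, ∀ v : Fin k → X, (∀ i, v i ∈ vectorSpan ℝ F) →
      ∃ a : ℝ, 0 < a ∧ ω (Matrix.vecCons (x - y) v) = a * ω.curryLeft (x₀ - y₀) v := by
    intro x hx y hy v hv
    have h0 : 0 < l (x₀ - y₀) := by rw [map_sub, hlev x₀ hx₀]; linarith [hlt y₀ hy₀]
    have h1 : 0 < l (x - y) := by rw [map_sub, hlev x hx]; linarith [hlt y hy]
    refine ⟨l (x - y) / l (x₀ - y₀), div_pos h1 h0, ?_⟩
    set a := l (x - y) / l (x₀ - y₀) with ha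
    have hw : (x - y) - a • (x₀ - y₀) ∈ vectorSpan ℝ F := by
      rw [hspan]
      refine ⟨Submodule.sub_mem _ (vsub_mem_vectorSpan ℝ (hF.subset hx) hy.1)
        (Submodule.smul_mem _ _ (vsub_mem_vectorSpan ℝ (hF.subset hx₀) hy₀.1)), ?_⟩
      change l ((x - y) - a • (x₀ - y₀)) = 0
      rw [map_sub, map_smul, smul_eq_mul, ha, div_mul_cancel₀ _ h0.ne', sub_self]
    have h2 : ω.curryLeft ((x - y) - a • (x₀ - y₀)) v = 0 := by
      rw [AlternatingMap.curryLeft_apply_apply]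
      refine form_eq_zero hF.2.finrank_eq ω fun i => ?_
      refine Fin.cases ?_ (fun j => ?_) i
      · simpa using hw
      · simpa using hv j
    have h3 : ω (Matrix.vecCons (x - y) v) = ω.curryLeft (x - y) v := rfl
    rw [map_sub, map_smul, AlternatingMap.sub_apply, AlternatingMap.smul_apply, smul_eq_mul,
      sub_eq_zero] at h2
    rw [h3, h2]
  ext v
  simp only [inducedOrientation, mem_ofPred_eq]
  refine and_congr_right fun hv => ?_
  constructor
  · rintro ⟨x, hx, y, hy, -, hpos⟩
    obtain ⟨a, ha, hae⟩ := key x hx y hy v hv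
    rw [hae] at hpos
    exact pos_of_mul_pos_right hpos ha.le
  · intro hpos
    refine ⟨x₀, hx₀, y₀, hy₀, fun i => ?_, hpos⟩
    refine Fin.cases ?_ (fun j => ?_) i
    · simpa using vsub_mem_vectorSpan ℝ (hF.subset hx₀) hy₀.1
    · simpa using vectorSpan_mono ℝ hF.subset (hv j)

theorem curryLeft_ne_zero (hC : IsPolyhedron (k + 1) C) (hF : IsFacet k C F)
    {ω : X [⋀^Fin (k + 1)]→ₗ[ℝ] ℝ} (hω : ∃ v, (∀ i, v i ∈ vectorSpan ℝ C) ∧ ω v ≠ 0)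
    {x₀ y₀ : X} (hx₀ : x₀ ∈ F) (hy₀ : y₀ ∈ C \ F) :
    ∃ v, (∀ i, v i ∈ vectorSpan ℝ F) ∧ ω.curryLeft (x₀ - y₀) v ≠ 0 := by
  have := hF.2.finiteDimensional
  have := hC.finiteDimensional
  obtain ⟨l, m, hl, hm, z, hz, hzm⟩ := hF.exists_level hC
  have hlev : ∀ x ∈ F, l x = m := fun x hx => (hl ▸ hx : x ∈ {x ∈ C | l x = m}).2
  have hlt : l y₀ < m :=
    lt_of_le_of_ne (hm y₀ hy₀.1) fun h => hy₀.2 (by rw [hl]; exact ⟨hy₀.1, h⟩)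
  obtain ⟨v, hv, hli⟩ := exists_frame hF.2.finrank_eq
  refine ⟨v, hv, ?_⟩
  rw [AlternatingMap.curryLeft_apply_apply]
  refine form_ne_zero hC.finrank_eq hω (fun i => ?_) ?_
  · refine Fin.cases ?_ (fun j => ?_) i
    · simpa using vsub_mem_vectorSpan ℝ (hF.subset hx₀) hy₀.1
    · simpa using vectorSpan_mono ℝ hF.subset (hv j)
  · refine linearIndependent_finCons.2 ⟨hli, fun hmem => ?_⟩
    have h1 : Submodule.span ℝ (range v) ≤ LinearMap.ker (l : X →ₗ[ℝ] ℝ) := by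
      rw [Submodule.span_le]
      rintro _ ⟨i, rfl⟩
      have h2 := hv i
      rw [hC.vectorSpan_level hF.2 hF.subset hlev hz hzm.ne] at h2
      exact h2.2
    have h3 : l (x₀ - y₀) = 0 := h1 hmem
    rw [map_sub, hlev x₀ hx₀] at h3
    linarith

theorem IsFacet.exists_mem_diff (hC : IsPolyhedron (k + 1) C) (hF : IsFacet k C F) :
    ∃ x₀ ∈ F, ∃ y₀, y₀ ∈ C \ F := by
  obtain ⟨l, m, hl, hm, z, hz, hzm⟩ := hF.exists_level hC
  obtain ⟨x₀, hx₀⟩ := hF.2.nonempty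
  exact ⟨x₀, hx₀, z, hz, fun h => hzm.ne (hl ▸ h : z ∈ {x ∈ C | l x = m}).2⟩

theorem isOrientation_induced (hC : IsPolyhedron (k + 1) C) (hF : IsFacet k C F)
    {o : Set (Fin (k + 1) → X)} (ho : IsOrientation (vectorSpan ℝ C) o) :
    IsOrientation (vectorSpan ℝ F) (inducedOrientation o C F) := by
  obtain ⟨ω, hω, rfl⟩ := ho
  obtain ⟨x₀, hx₀, y₀, hy₀⟩ := hF.exists_mem_diff hC
  exact ⟨ω.curryLeft (x₀ - y₀), curryLeft_ne_zero hC hF hω hx₀ hy₀,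
    inducedOrientation_eq hC hF ω hx₀ hy₀⟩

end induced

namespace OrientedPolyhedron

variable {k : ℕ}

/-- Two polyhedra that differ by their orientation only. Since a `k`-dimensional space has exactly
two orientations, `P'` is then the polyhedron `P` with the opposite orientation. -/
def IsOpposite (P P' : OrientedPolyhedron X k) : Prop :=
  P.carrier = P'.carrier ∧ P.orientation ≠ P'.orientation

/-- `P` is the union of `P₁` and `P₂`, which carry the orientation of `P` and are disjoint as open
polyhedra. -/
structure IsSubdivision (P P₁ P₂ : OrientedPolyhedron X k) : Prop where
  carrier_eq : P.carrier = P₁.carrier ∪ P₂.carrier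
  disjoint : Disjoint (intrinsicInterior ℝ P₁.carrier) (intrinsicInterior ℝ P₂.carrier)
  orientation_left : P₁.orientation = P.orientation
  orientation_right : P₂.orientation = P.orientation

/-- The facets of an oriented polyhedron, with the induced orientation. -/
def facets (P : OrientedPolyhedron X (k + 1)) : Set (OrientedPolyhedron X k) :=
  {F | IsFacet k P.carrier F.carrier ∧
    F.orientation = inducedOrientation P.orientation P.carrier F.carrier}

theorem carrier_injOn_facets (P : OrientedPolyhedron X (k + 1)) :
    InjOn carrier P.facets := fun F hF F' hF' h =>
  OrientedPolyhedron.ext h (by rw [hF.2, hF'.2, h])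

theorem carrier_image_facets (P : OrientedPolyhedron X (k + 1)) :
    carrier '' P.facets = {F | IsFacet k P.carrier F} := by
  ext F
  constructor
  · rintro ⟨F, hF, rfl⟩
    exact hF.1
  · intro hF
    exact ⟨⟨F, hF.2, inducedOrientation P.orientation P.carrier F,
      isOrientation_induced P.isPolyhedron hF P.isOrientation⟩, ⟨hF, rfl⟩, rfl⟩

theorem facets_finite (P : OrientedPolyhedron X (k + 1)) : P.facets.Finite := by
  refine Set.Finite.of_finite_image ?_ P.carrier_injOn_facets
  rw [carrier_image_facets]
  exact IsFacet.finite P.isPolyhedron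

/-- The part of `P` in the half-space `f < r` (with its closure), if there is any. -/
def below (P : OrientedPolyhedron X k) (f : StrongDual ℝ X) (r : ℝ)
    (h : ∃ a ∈ P.carrier, f a < r) : OrientedPolyhedron X k where
  carrier := {x ∈ P.carrier | f x ≤ r}
  isPolyhedron := P.isPolyhedron.cut h.choose_spec.1 h.choose_spec.2
  orientation := P.orientation
  isOrientation := by
    have := P.isPolyhedron.vectorSpan_eq
      (P.isPolyhedron.cut h.choose_spec.1 h.choose_spec.2) (sep_subset _ _)
    rw [this]
    exact P.isOrientation

end OrientedPolyhedron

/-! ### Polyhedral chains -/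

section chains

variable {G : Type*} [NormedAddCommGroup G] {k : ℕ}

open OrientedPolyhedron

variable (X G k) in
/-- The relations `(-g)[P] = g[-P]` and `g[P₁ ∪ P₂] = g[P₁] + g[P₂]` between formal sums. The
relation `(g₁ + g₂)[P] = g₁[P] + g₂[P]` holds for finitely supported functions already. -/
def relations : AddSubgroup (OrientedPolyhedron X k →₀ G) :=
  AddSubgroup.closure
    ({z | ∃ (P P' : OrientedPolyhedron X k) (g : G), P.IsOpposite P' ∧
        z = Finsupp.single P (-g) - Finsupp.single P' g} ∪
      {z | ∃ (P P₁ P₂ : OrientedPolyhedron X k) (g : G), P.IsSubdivision P₁ P₂ ∧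
        z = Finsupp.single P g - (Finsupp.single P₁ g + Finsupp.single P₂ g)})

variable (X G k) in
/-- The group of polyhedral `k`-chains in `X` with coefficients in `G`. -/
abbrev PolyChain : Type _ := (OrientedPolyhedron X k →₀ G) ⧸ relations X G k

/-- The chain represented by a formal sum. -/
def toChain : (OrientedPolyhedron X k →₀ G) →+ PolyChain X G k :=
  QuotientAddGroup.mk' (relations X G k)

/-- The simple chain `g[P]`, as a homomorphism in `g`. -/
def simple (P : OrientedPolyhedron X k) : G →+ PolyChain X G k :=
  toChain.comp (Finsupp.singleAddHom P)

theorem simple_opposite {P P' : OrientedPolyhedron X k} (h : P.IsOpposite P') (g : G) :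
    simple P g + simple P' g = 0 := by
  have h1 : toChain (Finsupp.single P (-g) - Finsupp.single P' g) = (0 : PolyChain X G k) :=
    (QuotientAddGroup.eq_zero_iff _).2
      (AddSubgroup.subset_closure (Or.inl ⟨P, P', g, h, rfl⟩))
  rw [map_sub] at h1
  have h2 : simple P (-g) - simple P' g = 0 := h1
  rw [map_neg] at h2
  rw [← neg_eq_zero, ← h2]
  abel

theorem simple_subdivision {P P₁ P₂ : OrientedPolyhedron X k} (h : P.IsSubdivision P₁ P₂) (g : G) :
    simple P g = simple P₁ g + simple P₂ g := by
  have h1 : toChain (Finsupp.single P g - (Finsupp.single P₁ g + Finsupp.single P₂ g)) =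
      (0 : PolyChain X G k) :=
    (QuotientAddGroup.eq_zero_iff _).2
      (AddSubgroup.subset_closure (Or.inr ⟨P, P₁, P₂, g, h, rfl⟩))
  rw [map_sub, map_add, sub_eq_zero] at h1
  exact h1

/-- Homomorphisms on chains, defined on simple chains. -/
def liftChain {A : Type*} [AddCommGroup A] (φ : OrientedPolyhedron X k → G →+ A)
    (hopp : ∀ P P', P.IsOpposite P' → ∀ g, φ P g + φ P' g = 0)
    (hsub : ∀ P P₁ P₂, P.IsSubdivision P₁ P₂ → ∀ g, φ P g = φ P₁ g + φ P₂ g) :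
    PolyChain X G k →+ A :=
  QuotientAddGroup.lift (relations X G k) (Finsupp.liftAddHom φ) <| by
    refine (AddSubgroup.closure_le (Finsupp.liftAddHom φ).ker).2 ?_
    rintro z (⟨P, P', g, h, rfl⟩ | ⟨P, P₁, P₂, g, h, rfl⟩)
    · change Finsupp.liftAddHom φ _ = 0
      rw [map_sub, Finsupp.liftAddHom_apply_single, Finsupp.liftAddHom_apply_single, map_neg,
        ← neg_eq_zero, ← hopp P P' h g]
      abel
    · change Finsupp.liftAddHom φ _ = 0
      rw [map_sub, map_add, Finsupp.liftAddHom_apply_single, Finsupp.liftAddHom_apply_single,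
        Finsupp.liftAddHom_apply_single, hsub P P₁ P₂ h g, sub_self]

/-! ### The boundary operator -/

/-- The boundary of `g[P]`: the sum of `g[F]` over the facets `F` of `P` with the induced
orientation. -/
def simpleBoundary (P : OrientedPolyhedron X (k + 1)) : G →+ PolyChain X G k :=
  ∑ F ∈ P.facets_finite.toFinset, simple F

open Classical in
/-- The simple chain `g[P]` in terms of the set and the orientation of `P`. -/
def simpleOf (C : Set X) (o : Set (Fin k → X)) : G →+ PolyChain X G k :=
  if h : ∃ P : OrientedPolyhedron X k, P.carrier = C ∧ P.orientation = o then simple h.choose else 0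

theorem simpleOf_eq (P : OrientedPolyhedron X k) :
    (simpleOf P.carrier P.orientation : G →+ PolyChain X G k) = simple P := by
  have h : ∃ Q : OrientedPolyhedron X k, Q.carrier = P.carrier ∧ Q.orientation = P.orientation :=
    ⟨P, rfl, rfl⟩
  rw [simpleOf, dif_pos h]
  congr 1
  exact OrientedPolyhedron.ext h.choose_spec.1 h.choose_spec.2

theorem simpleBoundary_eq (P : OrientedPolyhedron X (k + 1)) :
    (simpleBoundary P : G →+ PolyChain X G k) =
      ∑ C ∈ (IsFacet.finite P.isPolyhedron).toFinset,
        simpleOf C (inducedOrientation P.orientation P.carrier C) := by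
  classical
  have h : (IsFacet.finite P.isPolyhedron).toFinset = P.facets_finite.toFinset.image carrier := by
    ext C
    have := Set.ext_iff.1 P.carrier_image_facets C
    simpa using this.symm
  rw [h, Finset.sum_image (fun F hF F' hF' hh => P.carrier_injOn_facets
    (by simpa using hF) (by simpa using hF') hh), simpleBoundary]
  refine Finset.sum_congr rfl fun F hF => ?_
  have hF : F ∈ P.facets := by simpa using hF
  rw [← hF.2, simpleOf_eq]

theorem simpleBoundary_opposite (P P' : OrientedPolyhedron X (k + 1)) (h : P.IsOpposite P')
    (g : G) : (simpleBoundary P g + simpleBoundary P' g : PolyChain X G k) = 0 := by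
  obtain ⟨C, hC, o, ho⟩ := P
  obtain ⟨C', hC', o', ho'⟩ := P'
  obtain ⟨rfl, hne⟩ := h
  rw [simpleBoundary_eq, simpleBoundary_eq]
  simp only [AddMonoidHom.finsetSum_apply]
  rw [← Finset.sum_add_distrib]
  refine Finset.sum_eq_zero fun F hF => ?_
  have hF : IsFacet k C F := by simpa using hF
  have := hC.finiteDimensional
  obtain ⟨ω, hω, hoω, hoω'⟩ := ho.exists_opposite hC.finrank_eq ho' hne
  obtain ⟨x₀, hx₀, y₀, hy₀⟩ := hF.exists_mem_diff hC
  have h1 := inducedOrientation_eq hC hF ω hx₀ hy₀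
  have h2 := inducedOrientation_eq hC hF (-ω) hx₀ hy₀
  have hI := isOrientation_induced hC hF ho
  have hI' := isOrientation_induced hC hF ho'
  have h3 := simpleOf_eq (G := G) (⟨F, hF.2, _, hI⟩ : OrientedPolyhedron X k)
  have h4 := simpleOf_eq (G := G) (⟨F, hF.2, _, hI'⟩ : OrientedPolyhedron X k)
  change (simpleOf F (inducedOrientation o C F)) g + (simpleOf F (inducedOrientation o' C F)) g = 0
  rw [h3, h4]
  apply simple_opposite
  refine ⟨rfl, ?_⟩
  change inducedOrientation o C F ≠ inducedOrientation o' C F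
  rw [hoω, hoω', h1, h2]
  have h5 := IsOrientation.ne_of_neg (curryLeft_ne_zero hC hF hω hx₀ hy₀)
  exact h5

theorem intrinsicInterior_mono_of_affineSpan_eq {C D : Set X} (h : D ⊆ C)
    (hs : affineSpan ℝ D = affineSpan ℝ C) : intrinsicInterior ℝ D ⊆ intrinsicInterior ℝ C := by
  intro x hx
  rw [mem_intrinsicInterior] at hx ⊢
  obtain ⟨y, hy, rfl⟩ := hx
  let θ : affineSpan ℝ C → affineSpan ℝ D := fun z => ⟨z, by rw [hs]; exact z.2⟩
  have hθ : Continuous θ := Continuous.subtype_mk continuous_subtype_val _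
  refine ⟨⟨y, by rw [← hs]; exact y.2⟩, ?_, rfl⟩
  rw [mem_interior]
  refine ⟨θ ⁻¹' interior (Subtype.val ⁻¹' D), fun z hz => ?_, isOpen_interior.preimage hθ, hy⟩
  have : θ z ∈ ((↑) ⁻¹' D : Set (affineSpan ℝ D)) := interior_subset hz
  exact h this

theorem exists_extend_mem {D : Set X} {x a : X} (hx : x ∈ intrinsicInterior ℝ D) (ha : a ∈ D) :
    ∃ ε : ℝ, 0 < ε ∧ x + ε • (x - a) ∈ D := by
  rw [mem_intrinsicInterior] at hx
  obtain ⟨y, hy, rfl⟩ := hx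
  have hmem : ∀ t : ℝ, (y : X) + t • ((y : X) - a) ∈ affineSpan ℝ D := by
    intro t
    have h1 := AffineMap.lineMap_mem (Q := affineSpan ℝ D) (1 + t) (subset_affineSpan ℝ _ ha) y.2
    have h2 : AffineMap.lineMap a (y : X) (1 + t) = (y : X) + t • ((y : X) - a) := by
      rw [AffineMap.lineMap_apply]
      simp only [vsub_eq_sub, vadd_eq_add]
      module
    rwa [h2] at h1
  let τ : ℝ → affineSpan ℝ D := fun t => ⟨(y : X) + t • ((y : X) - a), hmem t⟩
  have hτ : Continuous τ := Continuous.subtype_mk (by fun_prop) _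
  have hτ0 : τ 0 = y := by ext; simp [τ]
  have hev : ∀ᶠ t in nhdsWithin (0 : ℝ) (Ioi 0), τ t ∈ interior (Subtype.val ⁻¹' D) :=
    nhdsWithin_le_nhds (hτ.continuousAt.eventually_mem (isOpen_interior.mem_nhds (by rwa [hτ0])))
  obtain ⟨t, ht, ht0⟩ := (hev.and self_mem_nhdsWithin).exists
  exact ⟨t, ht0, (interior_subset ht : τ t ∈ Subtype.val ⁻¹' D)⟩

theorem disjoint_intrinsicInterior_cut {E : Set X} {h : StrongDual ℝ X} {c : ℝ} {a : X}
    (ha : a ∈ E) (hac : h a < c) :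
    Disjoint (intrinsicInterior ℝ {x ∈ E | h x ≤ c}) (intrinsicInterior ℝ {x ∈ E | c ≤ h x}) := by
  rw [disjoint_left]
  intro x hx hx'
  obtain ⟨ε, hε, h1⟩ := exists_extend_mem hx (a := a) ⟨ha, hac.le⟩
  have h2 := (intrinsicInterior_subset hx').2
  have h3 := h1.2
  simp only [map_add, map_smul, map_sub, smul_eq_mul] at h3
  nlinarith

/-- The facets of the part of a polyhedron on one side of a hyperplane. -/
theorem isFacet_cut_iff {C : Set X} (hC : IsPolyhedron (k + 1) C) {h : StrongDual ℝ X} {c : ℝ}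
    {a b : X} (ha : a ∈ C) (hac : h a < c) (hb : b ∈ C) (hbc : c < h b) (F : Set X) :
    IsFacet k {x ∈ C | h x ≤ c} F ↔ F = {x ∈ C | h x = c} ∨
      ∃ E, IsFacet k C E ∧ (∃ x ∈ E, h x < c) ∧ F = {x ∈ E | h x ≤ c} := by
  have hC₁ := hC.cut ha hac
  have hT := hC.hyperplane_section ha hac hb hbc
  have hTeq : {x ∈ {x ∈ C | h x ≤ c} | h x = c} = {x ∈ C | h x = c} := by
    ext x
    simp only [mem_ofPred_eq]
    exact ⟨fun hx => ⟨hx.1.1, hx.2⟩, fun hx => ⟨⟨hx.1, hx.2.le⟩, hx.2⟩⟩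
  constructor
  · intro hF
    by_cases hFc : ∃ x ∈ F, h x < c
    · right
      obtain ⟨x, hx, hxc⟩ := hFc
      obtain ⟨l, m, hl, hm, -⟩ := hF.exists_level hC₁
      have hxl : x ∈ {x ∈ {x ∈ C | h x ≤ c} | l x = m} := hl ▸ hx
      have hm' : ∀ y ∈ C, l y ≤ m := by
        intro y hy
        by_contra! hym
        rcases le_or_gt (h y) c with hyc | hyc
        · exact absurd (hm y ⟨hy, hyc⟩) (by linarith)
        have hpos : 0 < h y - h x := by linarith
        set t := (c - h x) / (h y - h x) with ht
        have ht0 : 0 < t := div_pos (by linarith) hpos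
        have ht1 : t ≤ 1 := by rw [ht, div_le_one hpos]; linarith
        have h1 := hm (x + t • (y - x))
          ⟨hC.convex.add_smul_sub_mem hxl.1.1 hy ⟨ht0.le, ht1⟩, by
            simp only [map_add, map_smul, map_sub, smul_eq_mul]
            rw [ht, div_mul_cancel₀ _ hpos.ne']; linarith⟩
        simp only [map_add, map_smul, map_sub, smul_eq_mul, hxl.2] at h1
        nlinarith
      have hFE : F = {x ∈ {x ∈ C | l x = m} | h x ≤ c} := by
        rw [hl]
        ext y
        simp only [mem_ofPred_eq]
        tauto
      have hconv : Convex ℝ {x ∈ C | l x = m} := by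
        intro p hp q hq s t hs ht hst
        refine ⟨hC.convex hp.1 hq.1 hs ht hst, ?_⟩
        simp only [map_add, map_smul, smul_eq_mul, hp.2, hq.2]
        rw [← add_mul, hst, one_mul]
      refine ⟨{x ∈ C | l x = m}, IsFacet.of_level hC hm' ⟨x, hxl.1.1, hxl.2⟩ ?_,
        ⟨x, ⟨hxl.1.1, hxl.2⟩, hxc⟩, hFE⟩
      have h2 := IsPolyhedron.affineSpan_eq_of_subset_cut hconv (h := h) (c := c)
        (a := x) ⟨hxl.1.1, hxl.2⟩ hxc
      rw [← direction_affineSpan, ← h2, ← hFE, direction_affineSpan, hF.2.finrank_eq]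
    · left
      push Not at hFc
      have hFT : ∀ x ∈ F, h x = c := fun x hx => le_antisymm (hF.subset hx).2 (hFc x hx)
      rw [← hTeq]
      exact hF.eq_level hC₁ hFT (y := a) ⟨ha, hac.le⟩ hac.ne
  · rintro (rfl | ⟨E, hE, ⟨x, hx, hxc⟩, rfl⟩)
    · rw [← hTeq] at hT ⊢
      exact IsFacet.of_level hC₁ (fun x hx => hx.2) hT.nonempty hT.finrank_eq
    · refine ⟨fun _ => ?_, hE.2.cut hx hxc⟩
      obtain ⟨l, m, hl, hm, -⟩ := hE.exists_level hC
      refine ⟨l, ?_⟩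
      have hxm : x ∈ {x ∈ C | l x = m} := hl ▸ hx
      rw [hl]
      ext y
      simp only [mem_ofPred_eq]
      constructor
      · rintro ⟨⟨hy, hym⟩, hyc⟩
        exact ⟨⟨hy, hyc⟩, fun z hz => hym ▸ hm z hz.1⟩
      · rintro ⟨⟨hy, hyc⟩, hmax⟩
        refine ⟨⟨hy, le_antisymm (hm y hy) ?_⟩, hyc⟩
        have := hmax x ⟨hxm.1, hxc.le⟩
        rwa [hxm.2] at this

open Classical in
/-- The boundary of the part of a polyhedron on one side of a hyperplane. -/
theorem simpleBoundary_cut (P P₁ : OrientedPolyhedron X (k + 1)) {h : StrongDual ℝ X} {c : ℝ}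
    {a b : X} (ha : a ∈ P.carrier) (hac : h a < c) (hb : b ∈ P.carrier) (hbc : c < h b)
    (h₁ : P₁.carrier = {x ∈ P.carrier | h x ≤ c}) (ho : P₁.orientation = P.orientation) :
    (simpleBoundary P₁ : G →+ PolyChain X G k) =
      simpleOf {x ∈ P.carrier | h x = c}
        (inducedOrientation P₁.orientation P₁.carrier {x ∈ P.carrier | h x = c}) +
      ∑ E ∈ (IsFacet.finite P.isPolyhedron).toFinset,
        if ∃ x ∈ E, h x < c then simpleOf {x ∈ E | h x ≤ c}
          (inducedOrientation P.orientation P.carrier E) else 0 := by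
  obtain ⟨C, hC, o, hoC⟩ := P
  obtain ⟨C₁, hC₁, o₁, hoC₁⟩ := P₁
  simp only at ha hb h₁ ho ⊢
  subst h₁ ho
  rw [simpleBoundary_eq]
  simp only
  have hfin : (IsFacet.finite hC₁).toFinset = insert {x ∈ C | h x = c}
      (((IsFacet.finite hC).toFinset.filter fun E => ∃ x ∈ E, h x < c).image
        fun E => {x ∈ E | h x ≤ c}) := by
    ext F
    have := isFacet_cut_iff hC ha hac hb hbc F
    simp only [Set.Finite.mem_toFinset, mem_ofPred_eq, Finset.mem_insert, Finset.mem_image,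
      Finset.mem_filter]
    rw [this]
    refine or_congr_right ⟨?_, ?_⟩
    · rintro ⟨E, h1, h2, rfl⟩
      exact ⟨E, ⟨h1, h2⟩, rfl⟩
    · rintro ⟨E, ⟨h1, h2⟩, rfl⟩
      exact ⟨E, h1, h2, rfl⟩
  rw [hfin, Finset.sum_insert, Finset.sum_image, Finset.sum_filter]
  · congr 1
    refine Finset.sum_congr rfl fun E hE₀ => ?_
    have hE : IsFacet k C E := by simpa using hE₀
    clear hE₀
    split_ifs with hEc
    · congr 1
      obtain ⟨x, hx, hxc⟩ := hEc
      have hF : IsFacet k {x ∈ C | h x ≤ c} {x ∈ E | h x ≤ c} :=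
        (isFacet_cut_iff hC ha hac hb hbc _).2 (Or.inr ⟨E, hE, ⟨x, hx, hxc⟩, rfl⟩)
      obtain ⟨ω, hω, rfl⟩ := hoC
      have hV : vectorSpan ℝ {x ∈ C | h x ≤ c} = vectorSpan ℝ C :=
        hC.vectorSpan_eq hC₁ (sep_subset _ _)
      have hW : vectorSpan ℝ {x ∈ E | h x ≤ c} = vectorSpan ℝ E :=
        hE.2.vectorSpan_eq hF.2 (sep_subset _ _)
      obtain ⟨x₀, hx₀, y₀, hy₀⟩ := hF.exists_mem_diff hC₁
      have h1 := inducedOrientation_eq hC₁ hF ω hx₀ hy₀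
      rw [hV, hW] at h1
      rw [h1, inducedOrientation_eq hC hE ω (x₀ := x₀) (y₀ := y₀) hx₀.1
        ⟨hy₀.1.1, fun hyE => hy₀.2 ⟨hyE, hy₀.1.2⟩⟩]
    · rfl
  · intro E hE E' hE' heq
    simp only [Finset.coe_filter, Set.Finite.mem_toFinset, mem_ofPred_eq] at hE hE'
    obtain ⟨hE, x, hx, hxc⟩ := hE
    obtain ⟨hE', -⟩ := hE'
    have heq : {x ∈ E | h x ≤ c} = {x ∈ E' | h x ≤ c} := heq
    -- the smaller facet lies in `E'`, so `E'` spans the plane of `E`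
    obtain ⟨l, m, hl, hm, z, hz, hzm⟩ := hE'.exists_level hC
    have hsub : {x ∈ E | h x ≤ c} ⊆ E' := heq ▸ sep_subset _ _
    have hlev : ∀ y ∈ E, l y = m := by
      intro y hy
      have h1 := IsPolyhedron.affineSpan_eq_of_subset_cut hE.2.convex hx hxc
      have h2 : y ∈ affineSpan ℝ {x ∈ E | h x ≤ c} := by
        rw [h1]; exact subset_affineSpan ℝ _ hy
      have hxE' : l x = m := (hl ▸ hsub ⟨hx, hxc.le⟩ : x ∈ {x ∈ C | l x = m}).2
      have h3 : y - x ∈ vectorSpan ℝ {x ∈ E | h x ≤ c} := by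
        rw [← direction_affineSpan]
        exact AffineSubspace.vsub_mem_direction h2 (subset_affineSpan ℝ _ ⟨hx, hxc.le⟩)
      have h4 : vectorSpan ℝ {x ∈ E | h x ≤ c} ≤ LinearMap.ker (l : X →ₗ[ℝ] ℝ) := by
        refine (vectorSpan_mono ℝ hsub).trans ?_
        rw [hC.vectorSpan_level hE'.2 hE'.subset
          (fun x hx => (hl ▸ hx : x ∈ {x ∈ C | l x = m}).2) hz hzm.ne]
        exact inf_le_right
      have h5 : l (y - x) = 0 := h4 h3
      rw [map_sub, hxE', sub_eq_zero] at h5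
      exact h5
    rw [hl]
    exact hE.eq_level hC hlev hz hzm.ne
  · intro hmem
    simp only [Finset.mem_image, Finset.mem_filter, Set.Finite.mem_toFinset, mem_ofPred_eq] at hmem
    obtain ⟨E, ⟨hE, x, hx, hxc⟩, heq⟩ := hmem
    have : x ∈ {x ∈ C | h x = c} := heq ▸ ⟨hx, hxc.le⟩
    exact hxc.ne this.2

theorem simpleBoundary_subdivision (P P₁ P₂ : OrientedPolyhedron X (k + 1))
    (hP : P.IsSubdivision P₁ P₂) (g : G) :
    (simpleBoundary P g : PolyChain X G k) = simpleBoundary P₁ g + simpleBoundary P₂ g := by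
  classical
  obtain ⟨h, c, h₁, h₂, ⟨a, ha, hac⟩, b, hb, hbc⟩ := exists_cut P.isPolyhedron P₁.isPolyhedron
    P₂.isPolyhedron hP.carrier_eq hP.disjoint
  have hC := P.isPolyhedron
  have e₁ := simpleBoundary_cut (G := G) P P₁ ha hac hb hbc h₁ hP.orientation_left
  have e₂ := simpleBoundary_cut (G := G) P P₂ (h := -h) (c := -c) (a := b) (b := a) hb (by simpa)
    ha (by simpa) (by simpa using h₂) hP.orientation_right
  simp only [neg_apply, neg_inj, neg_le_neg_iff, neg_lt_neg_iff] at e₂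
  set T := {x ∈ P.carrier | h x = c} with hTdef
  -- the two copies of the cutting section cancel
  have hcancel : (simpleOf T (inducedOrientation P₁.orientation P₁.carrier T) g +
      simpleOf T (inducedOrientation P₂.orientation P₂.carrier T) g : PolyChain X G k) = 0 := by
    have hT₁ : IsFacet k P₁.carrier T := by
      rw [h₁]; exact (isFacet_cut_iff hC ha hac hb hbc T).2 (Or.inl rfl)
    have hT₂ : IsFacet k P₂.carrier T := by
      have := (isFacet_cut_iff hC (h := -h) (c := -c) (a := b) (b := a) hb (by simpa)
        ha (by simpa) T).2 (Or.inl (by simp [hTdef]))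
      rw [h₂]
      simpa using this
    have hI₁ := isOrientation_induced P₁.isPolyhedron hT₁ P₁.isOrientation
    have hI₂ := isOrientation_induced P₂.isPolyhedron hT₂ P₂.isOrientation
    have s₁ := simpleOf_eq (G := G) (⟨T, hT₁.2, _, hI₁⟩ : OrientedPolyhedron X k)
    have s₂ := simpleOf_eq (G := G) (⟨T, hT₂.2, _, hI₂⟩ : OrientedPolyhedron X k)
    simp only at s₁ s₂
    rw [s₁, s₂]
    apply simple_opposite
    refine ⟨rfl, ?_⟩
    simp only
    obtain ⟨ω, hω, hωo⟩ := P.isOrientation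
    have hV₁ : vectorSpan ℝ P₁.carrier = vectorSpan ℝ P.carrier :=
      hC.vectorSpan_eq P₁.isPolyhedron (hP.carrier_eq ▸ subset_union_left)
    have hV₂ : vectorSpan ℝ P₂.carrier = vectorSpan ℝ P.carrier :=
      hC.vectorSpan_eq P₂.isPolyhedron (hP.carrier_eq ▸ subset_union_right)
    have hpos : 0 < h b - h a := by linarith
    set t := (c - h a) / (h b - h a) with ht
    have ht0 : 0 < t := div_pos (by linarith) hpos
    have ht1 : t < 1 := by rw [ht, div_lt_one hpos]; linarith
    set z := a + t • (b - a) with hz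
    have hzT : z ∈ T := by
      refine ⟨hC.convex.add_smul_sub_mem ha hb ⟨ht0.le, ht1.le⟩, ?_⟩
      rw [hz]
      simp only [map_add, map_smul, map_sub, smul_eq_mul]
      rw [ht, div_mul_cancel₀ _ hpos.ne']; linarith
    have haT : a ∈ P₁.carrier \ T := ⟨by rw [h₁]; exact ⟨ha, hac.le⟩, fun h => hac.ne h.2⟩
    have hbT : b ∈ P₂.carrier \ T := ⟨by rw [h₂]; exact ⟨hb, hbc.le⟩, fun h => hbc.ne' h.2⟩
    have i₁ := inducedOrientation_eq P₁.isPolyhedron hT₁ ω hzT haT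
    have i₂ := inducedOrientation_eq P₂.isPolyhedron hT₂ ω hzT hbT
    rw [hV₁, ← hωo] at i₁
    rw [hV₂, ← hωo] at i₂
    rw [hP.orientation_left, hP.orientation_right, i₁, i₂]
    have hne := IsOrientation.ne_of_neg
      (curryLeft_ne_zero P₁.isPolyhedron hT₁ (ω := ω) (hV₁ ▸ hω) hzT haT)
    have hzb : z - b = (-((1 - t) / t)) • (z - a) := by
      have h3 : z - a = t • (b - a) := by rw [hz]; abel
      rw [h3, smul_smul, neg_mul, div_mul_cancel₀ _ ht0.ne', hz]
      module
    have hpos' : 0 < (1 - t) / t := div_pos (by linarith) ht0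
    refine fun heq => hne (heq.trans ?_)
    ext v
    simp only [mem_ofPred_eq]
    refine and_congr_right fun _ => ?_
    rw [hzb, map_smul, AlternatingMap.smul_apply, AlternatingMap.neg_apply, smul_eq_mul, neg_mul,
      ← mul_neg]
    exact mul_pos_iff_of_pos_left hpos'
  rw [e₁, e₂, simpleBoundary_eq]
  simp only [AddMonoidHom.add_apply, AddMonoidHom.finsetSum_apply]
  rw [add_add_add_comm, hcancel, zero_add, ← Finset.sum_add_distrib]
  refine Finset.sum_congr rfl fun E hE => ?_
  have hE : IsFacet k P.carrier E := by simpa using hE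
  have hI := isOrientation_induced hC hE P.isOrientation
  -- a facet is cut, or lies on one side
  by_cases hl : ∃ x ∈ E, h x < c <;> by_cases hr : ∃ x ∈ E, c < h x
  · rw [if_pos hl, if_pos hr]
    obtain ⟨x, hx, hxc⟩ := hl
    obtain ⟨y, hy, hyc⟩ := hr
    have p₁ : IsPolyhedron k {x ∈ E | h x ≤ c} := hE.2.cut hx hxc
    have p₂ : IsPolyhedron k {x ∈ E | c ≤ h x} := by
      simpa using hE.2.cut (h := -h) (c := -c) hy (by simpa)
    have v₁ := hE.2.vectorSpan_eq p₁ (sep_subset _ _)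
    have v₂ := hE.2.vectorSpan_eq p₂ (sep_subset _ _)
    have s₀ := simpleOf_eq (G := G) (⟨E, hE.2, _, hI⟩ : OrientedPolyhedron X k)
    have s₁ := simpleOf_eq (G := G)
      (⟨{x ∈ E | h x ≤ c}, p₁, _, v₁ ▸ hI⟩ : OrientedPolyhedron X k)
    have s₂ := simpleOf_eq (G := G)
      (⟨{x ∈ E | c ≤ h x}, p₂, _, v₂ ▸ hI⟩ : OrientedPolyhedron X k)
    simp only at s₀ s₁ s₂
    rw [s₀, s₁, s₂]
    apply simple_subdivision
    refine ⟨?_, ?_, rfl, rfl⟩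
    · ext x
      simp only [mem_union, mem_ofPred_eq, ← and_or_left]
      exact ⟨fun hx => ⟨hx, le_total _ _⟩, fun hx => hx.1⟩
    · exact disjoint_intrinsicInterior_cut hx hxc
  · rw [if_pos hl, if_neg hr]
    push Not at hr
    have : {x ∈ E | h x ≤ c} = E := sep_eq_self_iff_mem_true.2 hr
    rw [this]; simp
  · rw [if_neg hl, if_pos hr]
    push Not at hl
    have : {x ∈ E | c ≤ h x} = E := sep_eq_self_iff_mem_true.2 hl
    rw [this]; simp
  · exfalso
    push Not at hl hr
    have hET := hE.eq_level hC (fun x hx => le_antisymm (hr x hx) (hl x hx)) ha hac.ne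
    obtain ⟨l, m, hlE, hm, -⟩ := hE.exists_level hC
    have hpos : 0 < h b - h a := by linarith
    set t := (c - h a) / (h b - h a) with ht
    have ht0 : 0 < t := div_pos (by linarith) hpos
    have ht1 : t < 1 := by rw [ht, div_lt_one hpos]; linarith
    have hzE : a + t • (b - a) ∈ E := by
      rw [hET]
      refine ⟨hC.convex.add_smul_sub_mem ha hb ⟨ht0.le, ht1.le⟩, ?_⟩
      simp only [map_add, map_smul, map_sub, smul_eq_mul]
      rw [ht, div_mul_cancel₀ _ hpos.ne']; linarith
    rw [hlE] at hzE
    have h3 := hzE.2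
    simp only [map_add, map_smul, map_sub, smul_eq_mul] at h3
    have h4 := hm a ha
    have h5 := hm b hb
    have h6 : l a = m := by nlinarith
    have haE : a ∈ E := by rw [hlE]; exact ⟨ha, h6⟩
    exact absurd (hl a haE) (by linarith)

/-- The boundary operator on polyhedral chains. -/
def boundary : PolyChain X G (k + 1) →+ PolyChain X G k :=
  liftChain simpleBoundary simpleBoundary_opposite simpleBoundary_subdivision

/-! ### Restriction to half-spaces and slices -/

open Classical in
/-- The part of `g[P]` in the half-space `f < r`. -/
def simpleRestrict (f : StrongDual ℝ X) (r : ℝ) (P : OrientedPolyhedron X k) :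
    G →+ PolyChain X G k :=
  if h : ∃ a ∈ P.carrier, f a < r then simple (P.below f r h) else 0

theorem simpleRestrict_opposite (f : StrongDual ℝ X) (r : ℝ) (P P' : OrientedPolyhedron X k)
    (h : P.IsOpposite P') (g : G) : simpleRestrict f r P g + simpleRestrict f r P' g = 0 := by
  obtain ⟨C, hC, o, ho⟩ := P
  obtain ⟨C', hC', o', ho'⟩ := P'
  obtain ⟨rfl, hne⟩ := h
  by_cases hr : ∃ a ∈ C, f a < r
  · rw [simpleRestrict, simpleRestrict, dif_pos hr, dif_pos hr]
    apply simple_opposite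
    exact ⟨rfl, hne⟩
  · rw [simpleRestrict, simpleRestrict, dif_neg hr, dif_neg hr]
    simp

theorem simpleRestrict_subdivision (f : StrongDual ℝ X) (r : ℝ) (P P₁ P₂ : OrientedPolyhedron X k)
    (h : P.IsSubdivision P₁ P₂) (g : G) :
    simpleRestrict f r P g = simpleRestrict f r P₁ g + simpleRestrict f r P₂ g := by
  have hmem : ∀ x, x ∈ P.carrier ↔ x ∈ P₁.carrier ∨ x ∈ P₂.carrier := fun x => by
    rw [h.carrier_eq, mem_union]
  -- if one part lies in `r ≤ f`, the other one contains everything in `f ≤ r`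
  have key : ∀ Q Q' : OrientedPolyhedron X k, (∀ x, x ∈ P.carrier ↔ x ∈ Q.carrier ∨ x ∈ Q'.carrier) →
      Q.orientation = P.orientation → (∃ a ∈ Q.carrier, f a < r) →
      (¬∃ a ∈ Q'.carrier, f a < r) → simpleRestrict f r P g = simpleRestrict f r Q g := by
    intro Q Q' hQ ho hr hr'
    push Not at hr'
    have hrP : ∃ a ∈ P.carrier, f a < r := by
      obtain ⟨a, ha, har⟩ := hr
      exact ⟨a, (hQ a).2 (Or.inl ha), har⟩
    rw [simpleRestrict, simpleRestrict, dif_pos hrP, dif_pos hr]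
    congr 2
    refine OrientedPolyhedron.ext (Subset.antisymm ?_ ?_) ho.symm
    · rintro x ⟨hx, hxr⟩
      refine ⟨?_, hxr⟩
      obtain ⟨a, ha, har⟩ := hr
      have hcont : Continuous fun t : ℝ => x + t • (a - x) := by fun_prop
      have ht : Filter.Tendsto (fun t : ℝ => x + t • (a - x)) (nhdsWithin 0 (Ioi 0)) (nhds x) := by
        have := (hcont.tendsto 0).mono_left (nhdsWithin_le_nhds (s := Ioi (0 : ℝ)))
        simpa using this
      refine Q.isPolyhedron.isClosed.mem_of_tendsto ht ?_
      filter_upwards [Ioo_mem_nhdsGT (zero_lt_one (α := ℝ))] with t ht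
      have hm := P.isPolyhedron.convex.add_smul_sub_mem hx ((hQ a).2 (Or.inl ha))
        ⟨ht.1.le, ht.2.le⟩
      refine ((hQ _).1 hm).resolve_right fun hm' => ?_
      have := hr' _ hm'
      simp only [map_add, map_smul, map_sub, smul_eq_mul] at this
      nlinarith [ht.1, ht.2]
    · rintro x ⟨hx, hxr⟩
      exact ⟨(hQ x).2 (Or.inl hx), hxr⟩
  by_cases h₁ : ∃ a ∈ P₁.carrier, f a < r <;> by_cases h₂ : ∃ a ∈ P₂.carrier, f a < r
  · have hP : ∃ a ∈ P.carrier, f a < r := by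
      obtain ⟨a, ha, har⟩ := h₁
      exact ⟨a, (hmem a).2 (Or.inl ha), har⟩
    rw [simpleRestrict, simpleRestrict, simpleRestrict, dif_pos hP, dif_pos h₁, dif_pos h₂]
    apply simple_subdivision
    refine ⟨?_, ?_, h.orientation_left, h.orientation_right⟩
    · ext x
      simp only [below, mem_ofPred_eq, mem_union, hmem]
      tauto
    · refine h.disjoint.mono ?_ ?_
      · exact intrinsicInterior_mono_of_affineSpan_eq (sep_subset _ _)
          (P₁.isPolyhedron.affineSpan_eq (P₁.below f r h₁).isPolyhedron (sep_subset _ _))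
      · exact intrinsicInterior_mono_of_affineSpan_eq (sep_subset _ _)
          (P₂.isPolyhedron.affineSpan_eq (P₂.below f r h₂).isPolyhedron (sep_subset _ _))
  · rw [key P₁ P₂ hmem h.orientation_left h₁ h₂]
    conv_rhs => rw [simpleRestrict, simpleRestrict, dif_neg h₂]
    rw [simpleRestrict]; simp
  · rw [key P₂ P₁ (fun x => (hmem x).trans or_comm) h.orientation_right h₂ h₁]
    conv_rhs => rw [simpleRestrict, simpleRestrict, dif_neg h₁]
    rw [simpleRestrict]; simp
  · have hP : ¬∃ a ∈ P.carrier, f a < r := by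
      rintro ⟨a, ha, har⟩
      rcases (hmem a).1 ha with ha | ha
      · exact h₁ ⟨a, ha, har⟩
      · exact h₂ ⟨a, ha, har⟩
    rw [simpleRestrict, simpleRestrict, simpleRestrict, dif_neg hP, dif_neg h₁, dif_neg h₂]
    simp

/-- The portion of a chain in the half-space `f < r`. -/
def restrict (f : StrongDual ℝ X) (r : ℝ) : PolyChain X G k →+ PolyChain X G k :=
  liftChain (simpleRestrict f r) (simpleRestrict_opposite f r) (simpleRestrict_subdivision f r)

/-- The slice `P ∩ f⁻¹(r) = ∂(P_r) - (∂P)_r`. -/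
def slice (f : StrongDual ℝ X) (r : ℝ) (P : PolyChain X G (k + 1)) : PolyChain X G k :=
  boundary (restrict f r P) - restrict f r (boundary P)

/-! ### Mass and flat norm -/

/-- A formal sum whose polyhedra are pairwise disjoint as open polyhedra. -/
def IsDisjointSum (c : OrientedPolyhedron X k →₀ G) : Prop :=
  (c.support : Set (OrientedPolyhedron X k)).Pairwise fun P Q =>
    Disjoint (intrinsicInterior ℝ P.carrier) (intrinsicInterior ℝ Q.carrier)

/-- The mass of a chain. It is the sum of the masses of the simple summands in a representation
with disjoint polyhedra; this does not depend on the representation, so it is taken as the infimum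
over all of them. The mass of a simple `0`-chain `g[x]` is `|g|`, and the mass of a simple chain
of positive dimension is the supremum of the integrals of the masses of its slices by the linear
functionals of norm one. -/
def mass : (k : ℕ) → PolyChain X G k → ℝ≥0∞
  | 0, P => ⨅ (c : OrientedPolyhedron X 0 →₀ G) (_ : IsDisjointSum c ∧ toChain c = P),
      c.sum fun _ g => ‖g‖ₑ
  | k + 1, P => ⨅ (c : OrientedPolyhedron X (k + 1) →₀ G) (_ : IsDisjointSum c ∧ toChain c = P),
      c.sum fun S g => ⨆ (f : StrongDual ℝ X) (_ : ‖f‖ = 1),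
        ∫⁻ r : ℝ, mass k (slice f r (simple S g))

/-- The flat norm. -/
def flatNorm (P : PolyChain X G k) : ℝ≥0∞ :=
  ⨅ Q : PolyChain X G (k + 1), mass (k + 1) Q + mass k (boundary Q - P)

end chains

end FlatChain

end

/-!
The area of a `k`-dimensional set is the largest volume of its images in `ℝᵏ` under linear maps with
coordinates of norm one. Such a map assigns to a formal sum a degree over each point of `ℝᵏ`, namely
the signed sum of the coefficients of the polyhedra that meet the fibre. Almost everywhere the
degree depends only on the chain, and its `L¹` norm is at most the sum of the areas, weighted by the
norms of the coefficients. Hence subdividing a polyhedron cannot pay: the mass of `g[S]` is `|g|`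
times the area of `S`, and the mass of a chain is the infimum of the weights of all formal sums that
represent it, disjoint or not. This makes the mass, and with it the flat norm, subadditive.

The degree of a boundary vanishes almost everywhere, because a generic fibre enters and leaves a
polyhedron exactly once. So the `L¹` norm of the degree is also a lower bound for the flat norm,
and `g[S]` has flat norm zero only if `g = 0`. To reduce a chain of flat norm zero to this case,
write it as a disjoint sum and fix a point of one polyhedron that lies in none of the others. By
the Hahn–Banach theorem the other polyhedra can be cut away one at a time by half-spaces that
contain the point, and slicing shows that almost all of these restrictions still have flat norm
zero.
-/

noncomputable section

open Set MeasureTheory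
open scoped ENNReal

namespace FlatChain

/-! ### Volumes of linear images -/

section LinearImage

open Module

variable {V E : Type*} [AddCommGroup V] [Module ℝ V]

theorem vectorSpan_le_ker_of_forall_eq [AddCommGroup E] [Module ℝ E] {D : Set V} {f : V →ₗ[ℝ] E}
    {c : E} (hD : ∀ x ∈ D, f x = c) : vectorSpan ℝ D ≤ LinearMap.ker f := by
  rw [vectorSpan_def, Submodule.span_le]
  rintro _ ⟨x, hx, y, hy, rfl⟩
  simp [hD x hx, hD y hy]

theorem exists_forall_eq_or_exists_mem_vectorSpan [AddCommGroup E] [Module ℝ E] (f : V →ₗ[ℝ] E)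
    (D : Set V) : (∃ c, ∀ x ∈ D, f x = c) ∨ ∃ u ∈ vectorSpan ℝ D, f u ≠ 0 := by
  refine or_iff_not_imp_right.2 fun h => ?_
  push Not at h
  obtain rfl | ⟨a, ha⟩ := D.eq_empty_or_nonempty
  · simp
  · refine ⟨f a, fun x hx => sub_eq_zero.1 ?_⟩
    rw [← map_sub]
    exact h _ (vsub_mem_vectorSpan ℝ hx ha)

theorem finrank_inf_ker_add_one {W : Submodule ℝ V} [FiniteDimensional ℝ W] {f : V →ₗ[ℝ] ℝ}
    {u : V} (hu : u ∈ W) (hfu : f u ≠ 0) :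
    finrank ℝ ↥(W ⊓ LinearMap.ker f) + 1 = finrank ℝ W := by
  have hne : f.domRestrict W ≠ 0 := fun h => hfu (LinearMap.congr_fun h ⟨u, hu⟩)
  rw [← Dual.finrank_ker_add_one_of_ne_zero hne, LinearMap.ker_domRestrict,
    ← Submodule.map_comap_subtype]
  exact congrArg (· + 1) (Submodule.finrank_map_subtype_eq W _)

theorem finrank_vectorSpan_lt_of_forall_eq {C D : Set V} [FiniteDimensional ℝ (vectorSpan ℝ C)]
    (hDC : D ⊆ C) {f : V →ₗ[ℝ] ℝ} {c : ℝ} (hD : ∀ x ∈ D, f x = c) {u : V}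
    (hu : u ∈ vectorSpan ℝ C) (hfu : f u ≠ 0) :
    finrank ℝ (vectorSpan ℝ D) < finrank ℝ (vectorSpan ℝ C) := by
  rw [← finrank_inf_ker_add_one hu hfu, Nat.lt_succ_iff]
  have := Submodule.finiteDimensional_inf_left (vectorSpan ℝ C) (LinearMap.ker f)
  exact Submodule.finrank_mono
    (le_inf (vectorSpan_mono ℝ hDC) (vectorSpan_le_ker_of_forall_eq hD))

theorem map_vectorSpan_eq_vectorSpan_image [AddCommGroup E] [Module ℝ E] (L : V →ₗ[ℝ] E)
    (D : Set V) : (vectorSpan ℝ D).map L = vectorSpan ℝ (L '' D) :=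
  L.toAffineMap.map_vectorSpan

theorem measure_image_pos_of_convex [NormedAddCommGroup E] [NormedSpace ℝ E]
    [FiniteDimensional ℝ E] [MeasurableSpace E] (μ : Measure E) [μ.IsOpenPosMeasure]
    {L : V →ₗ[ℝ] E} {D : Set V} (hconv : Convex ℝ D) (hne : D.Nonempty)
    (hD : (vectorSpan ℝ D).map L = ⊤) : 0 < μ (L '' D) := by
  have hint : (interior (L '' D)).Nonempty := by
    rwa [(hconv.linear_image L).interior_nonempty_iff_affineSpan_eq_top,
      AffineSubspace.affineSpan_eq_top_iff_vectorSpan_eq_top_of_nonempty ℝ _ _ (hne.image _),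
      ← map_vectorSpan_eq_vectorSpan_image]
  exact (isOpen_interior.measure_pos μ hint).trans_le (measure_mono interior_subset)

variable [NormedAddCommGroup E] [NormedSpace ℝ E] [FiniteDimensional ℝ E] [MeasurableSpace E]
  [BorelSpace E] (μ : Measure E) [μ.IsAddHaarMeasure]

theorem addHaar_image_eq_zero_of_map_vectorSpan_ne_top {L : V →ₗ[ℝ] E} {D : Set V}
    (hD : (vectorSpan ℝ D).map L ≠ ⊤) : μ (L '' D) = 0 := by
  refine measure_mono_null (subset_affineSpan ℝ _)
    (Measure.addHaar_affineSubspace μ (affineSpan ℝ (L '' D)) fun htop => hD ?_)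
  rw [map_vectorSpan_eq_vectorSpan_image, ← direction_affineSpan, htop,
    AffineSubspace.direction_top]

theorem addHaar_image_eq_zero_of_finrank_vectorSpan_lt {D : Set V}
    [FiniteDimensional ℝ (vectorSpan ℝ D)] (hD : finrank ℝ (vectorSpan ℝ D) < finrank ℝ E)
    (L : V →ₗ[ℝ] E) : μ (L '' D) = 0 := by
  refine addHaar_image_eq_zero_of_map_vectorSpan_ne_top μ fun htop => hD.not_ge ?_
  rw [← finrank_top ℝ E, ← htop]
  exact Submodule.finrank_map_le L (vectorSpan ℝ D)

theorem exists_addHaar_image_eq_mul {W : Submodule ℝ V}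
    (hW : finrank ℝ W = finrank ℝ E) {L : V →ₗ[ℝ] E} (hL : InjOn L W) (L' : V →ₗ[ℝ] E) :
    ∃ κ : ℝ≥0∞, ∀ T : Set V, vectorSpan ℝ T ≤ W → μ (L' '' T) = κ * μ (L '' T) := by
  let e : W ≃ₗ[ℝ] E := LinearEquiv.ofInjectiveOfFinrankEq (L.domRestrict W)
    (injOn_iff_injective.1 hL) hW
  let A : E →ₗ[ℝ] E := L' ∘ₗ W.subtype ∘ₗ e.symm.toLinearMap
  have hA : ∀ w ∈ W, A (L w) = L' w := fun w hw => by
    have : e ⟨w, hw⟩ = L w := rfl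
    simp [A, ← this]
  refine ⟨ENNReal.ofReal |LinearMap.det A|, fun T hT => ?_⟩
  obtain rfl | ⟨x₀, hx₀⟩ := T.eq_empty_or_nonempty
  · simp
  have himage : L' '' T = (fun y => (L' x₀ - A (L x₀)) + y) '' (A '' (L '' T)) := by
    rw [image_image, image_image]
    refine image_congr fun x hx => ?_
    have := hA (x - x₀) (hT (vsub_mem_vectorSpan ℝ hx hx₀))
    rw [map_sub, map_sub, map_sub] at this
    rw [sub_add_eq_add_sub, add_sub_assoc, this, add_sub_cancel]
  rw [himage, image_add_left, measure_preimage_add, Measure.addHaar_image_linearMap]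

end LinearImage

/-! ### Finite-dimensional convex sets -/

section FiniteDimensional

variable {X : Type*} [NormedAddCommGroup X] [NormedSpace ℝ X]

theorem exists_affineIsometry_image_preimage_eq {C : Set X} (hC : C.Nonempty) :
    ∃ φ : vectorSpan ℝ C →ᵃⁱ[ℝ] X, φ '' (φ ⁻¹' C) = C := by
  obtain ⟨x₀, hx₀⟩ := hC
  refine ⟨(AffineIsometryEquiv.vaddConst ℝ x₀).toAffineIsometry.comp
    (vectorSpan ℝ C).subtypeₗᵢ.toAffineIsometry, image_preimage_eq_iff.2 fun x hx => ?_⟩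
  exact ⟨⟨x - x₀, vsub_mem_vectorSpan ℝ hx hx₀⟩, by simp⟩

theorem isCompact_of_finiteDimensional_vectorSpan {C : Set X}
    [FiniteDimensional ℝ (vectorSpan ℝ C)] (hclosed : IsClosed C)
    (hbounded : Bornology.IsBounded C) : IsCompact C := by
  obtain rfl | hne := C.eq_empty_or_nonempty
  · exact isCompact_empty
  obtain ⟨φ, hφ⟩ := exists_affineIsometry_image_preimage_eq hne
  have := FiniteDimensional.proper ℝ (vectorSpan ℝ C)
  rw [← hφ]
  exact (Metric.isCompact_of_isClosed_isBounded (hclosed.preimage φ.continuous)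
    (φ.antilipschitz.isBounded_preimage hbounded)).image φ.continuous

theorem intrinsicInterior_nonempty_of_convex {C : Set X} [FiniteDimensional ℝ (vectorSpan ℝ C)]
    (hconv : Convex ℝ C) (hne : C.Nonempty) : (intrinsicInterior ℝ C).Nonempty := by
  obtain ⟨φ, hφ⟩ := exists_affineIsometry_image_preimage_eq hne
  rw [← hφ, AffineIsometry.intrinsicInterior_image]
  exact (Nonempty.intrinsicInterior (hconv.affine_preimage φ.toAffineMap)
    (image_nonempty.1 (hφ.symm ▸ hne))).image φ

end FiniteDimensional

/-! ### Coordinate maps and area -/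

section Area

variable {X : Type*} [NormedAddCommGroup X] [NormedSpace ℝ X] {k n : ℕ} {C S T : Set X}

/-- The map to `ℝᵏ` whose coordinates are the given functionals. -/
def coords (f : Fin k → StrongDual ℝ X) : X →L[ℝ] (Fin k → ℝ) := ContinuousLinearMap.pi f

@[simp]
theorem coords_apply (f : Fin k → StrongDual ℝ X) (x : X) (i : Fin k) : coords f x i = f i x := rfl

theorem exists_coords_injOn {W : Submodule ℝ X} [FiniteDimensional ℝ W]
    (hW : Module.finrank ℝ W = k) :
    ∃ e : Fin k → StrongDual ℝ X, (∀ i, ‖e i‖ = 1) ∧ InjOn (coords e) W := by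
  let b := Module.finBasisOfFinrankEq ℝ W hW
  choose g hg using fun i =>
    (exists_extension_norm_eq W (b.coord i).toContinuousLinearMap).imp fun _ => And.left
  have hg_ne : ∀ i, ‖g i‖ ≠ 0 := fun i hgi => by
    have := hg i (b i)
    rw [norm_eq_zero.1 hgi] at this
    simp at this
  refine ⟨fun i => ‖g i‖⁻¹ • g i, fun i => ?_, fun v hv w hw hvw => ?_⟩
  · rw [norm_smul, norm_inv, norm_norm, inv_mul_cancel₀ (hg_ne i)]
  · have hcoord : ∀ i, b.repr ⟨v, hv⟩ i = b.repr ⟨w, hw⟩ i := fun i => by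
      have hi := congrFun hvw i
      simp only [coords_apply, smul_apply, smul_eq_mul] at hi
      simpa using (hg i ⟨v, hv⟩).symm.trans
        ((mul_left_cancel₀ (inv_ne_zero (hg_ne i)) hi).trans (hg i ⟨w, hw⟩))
    exact congrArg Subtype.val (b.ext_elem hcoord)

theorem injOn_coords_of_injOn_vectorSpan {f : Fin n → StrongDual ℝ X}
    (hf : InjOn (coords f) (vectorSpan ℝ C)) : InjOn (coords f) C := fun x hx y hy hxy =>
  sub_eq_zero.1 <| hf (vsub_mem_vectorSpan ℝ hx hy) (Submodule.zero_mem _)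
    (by rw [vsub_eq_sub, map_sub, hxy, sub_self, map_zero])

theorem map_coords_eq_top_of_injOn {W : Submodule ℝ X} [FiniteDimensional ℝ W]
    (hW : Module.finrank ℝ W = k) {e : Fin k → StrongDual ℝ X} (he : InjOn (coords e) W) :
    W.map (coords e : X →ₗ[ℝ] (Fin k → ℝ)) = ⊤ := by
  rw [← LinearMap.range_domRestrict, LinearMap.range_eq_top]
  exact (LinearMap.injective_iff_surjective_of_finrank_eq_finrank (by simp [hW])).1
    (injOn_iff_injective.1 he)

variable (k) in
/-- The area of a `k`-dimensional set: the largest volume of an image in `ℝᵏ` under a linear map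
whose coordinates have norm one. It is a closed form of the mass of a polyhedron with coefficient of
norm one. -/
def area (S : Set X) : ℝ≥0∞ :=
  ⨆ (f : Fin k → StrongDual ℝ X) (_ : ∀ i, ‖f i‖ = 1), volume (coords f '' S)

theorem volume_image_coords_le_area {f : Fin k → StrongDual ℝ X} (hf : ∀ i, ‖f i‖ = 1)
    (S : Set X) : volume (coords f '' S) ≤ area k S :=
  le_iSup₂ (f := fun (f : Fin k → StrongDual ℝ X) (_ : ∀ i, ‖f i‖ = 1) =>
    volume (coords f '' S)) f hf

theorem area_mono (h : S ⊆ T) : area k S ≤ area k T :=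
  iSup₂_mono fun _ _ => measure_mono (image_mono h)

@[simp]
theorem area_empty : area k (∅ : Set X) = 0 := by simp [area]

theorem area_zero (hS : S.Nonempty) : area 0 S = 1 := by
  have hvolume : ∀ f : Fin 0 → StrongDual ℝ X, volume (coords f '' S) = 1 := fun f => by
    rw [Subsingleton.eq_univ_of_nonempty (hS.image (coords f))]
    simp [volume_pi]
  refine le_antisymm (iSup₂_le fun f _ => (hvolume f).le) ?_
  rw [← hvolume Fin.elim0]
  exact volume_image_coords_le_area (fun i => i.elim0) S

theorem area_ne_top (hS : Bornology.IsBounded S) : area k S ≠ ⊤ := by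
  obtain ⟨R, hR, hSR⟩ := hS.subset_closedBall_lt 0 0
  refine ne_top_of_le_ne_top (b := volume (Metric.closedBall (0 : Fin k → ℝ) R))
    (isCompact_closedBall _ _).measure_lt_top.ne (iSup₂_le fun f hf => measure_mono ?_)
  rintro _ ⟨x, hx, rfl⟩
  rw [mem_closedBall_zero_iff, pi_norm_le_iff_of_nonneg hR.le]
  intro i
  calc ‖coords f x i‖ ≤ ‖f i‖ * ‖x‖ := (f i).le_opNorm x
    _ = ‖x‖ := by rw [hf i, one_mul]
    _ ≤ R := mem_closedBall_zero_iff.1 (hSR hx)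

theorem exists_volume_image_coords_eq_mul {W : Submodule ℝ X}
    (hW : Module.finrank ℝ W = k) {e : Fin k → StrongDual ℝ X} (he : InjOn (coords e) W) :
    ∃ κ : (Fin k → StrongDual ℝ X) → ℝ≥0∞, ∀ T : Set X, vectorSpan ℝ T ≤ W →
      ∀ f, volume (coords f '' T) = κ f * volume (coords e '' T) := by
  choose κ hκ using fun f : Fin k → StrongDual ℝ X =>
    exists_addHaar_image_eq_mul (volume : Measure (Fin k → ℝ)) (by simpa using hW)
      (L := (coords e : X →ₗ[ℝ] (Fin k → ℝ))) he (coords f : X →ₗ[ℝ] (Fin k → ℝ))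
  exact ⟨κ, fun T hT f => hκ f T hT⟩

theorem area_eq_iSup_mul {e : Fin k → StrongDual ℝ X} {κ : (Fin k → StrongDual ℝ X) → ℝ≥0∞}
    (hκ : ∀ f, volume (coords f '' T) = κ f * volume (coords e '' T)) :
    area k T = (⨆ (f : Fin k → StrongDual ℝ X) (_ : ∀ i, ‖f i‖ = 1), κ f) *
      volume (coords e '' T) := by
  simp only [ENNReal.iSup_mul]
  exact iSup_congr fun f => iSup_congr fun _ => hκ f

/-! ### Fubini's theorem for the area -/

theorem preimage_mk_image_coords_cons (f : StrongDual ℝ X) (f' : Fin n → StrongDual ℝ X)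
    (C : Set X) (r : ℝ) :
    Prod.mk r ⁻¹' ((MeasurableEquiv.piFinSuccAbove (fun _ : Fin (n + 1) => ℝ) 0).symm ⁻¹'
      (coords (Fin.cons f f' : Fin (n + 1) → StrongDual ℝ X) '' C)) =
        coords f' '' {x ∈ C | f x = r} := by
  ext y
  have hcons : (MeasurableEquiv.piFinSuccAbove (fun _ : Fin (n + 1) => ℝ) 0).symm (r, y) =
      (Fin.cons r y : Fin (n + 1) → ℝ) := Fin.insertNth_zero' r y
  rw [mem_preimage, mem_preimage, hcons]
  refine exists_congr fun x => Iff.trans (and_congr_right fun _ => ?_) and_assoc.symm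
  rw [funext_iff, Fin.forall_fin_succ, funext_iff]
  rfl

theorem measurable_volume_image_coords_section {f : StrongDual ℝ X}
    {f' : Fin n → StrongDual ℝ X}
    (hC : MeasurableSet (coords (Fin.cons f f' : Fin (n + 1) → StrongDual ℝ X) '' C)) :
    Measurable fun r : ℝ => volume (coords f' '' {x ∈ C | f x = r}) := by
  simp only [← preimage_mk_image_coords_cons]
  exact measurable_measure_prodMk_left ((MeasurableEquiv.measurable _) hC)

theorem volume_image_coords_cons {f : StrongDual ℝ X} {f' : Fin n → StrongDual ℝ X}
    (hC : MeasurableSet (coords (Fin.cons f f' : Fin (n + 1) → StrongDual ℝ X) '' C)) :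
    volume (coords (Fin.cons f f' : Fin (n + 1) → StrongDual ℝ X) '' C) =
      ∫⁻ r : ℝ, volume (coords f' '' {x ∈ C | f x = r}) := by
  simp_rw [← preimage_mk_image_coords_cons]
  rw [← ((volume_preserving_piFinSuccAbove (fun _ : Fin (n + 1) => ℝ) 0).symm
    _).measure_preimage hC.nullMeasurableSet, Measure.volume_eq_prod]
  exact Measure.prod_apply ((MeasurableEquiv.measurable _) hC)

theorem ae_section_eq_empty {f : StrongDual ℝ X} {c : ℝ} (hC : ∀ x ∈ C, f x = c) :
    ∀ᵐ r : ℝ, {x ∈ C | f x = r} = ∅ := by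
  filter_upwards [compl_mem_ae_iff.2 (measure_singleton c)] with r hr
  exact eq_empty_of_forall_notMem fun x hx => hr (hx.2 ▸ hC x hx.1)

end Area

namespace IsPolyhedron

variable {X : Type*} [NormedAddCommGroup X] [NormedSpace ℝ X] {k n : ℕ} {C D : Set X}

theorem isCompact (hC : IsPolyhedron k C) : IsCompact C :=
  have := hC.finiteDimensional
  isCompact_of_finiteDimensional_vectorSpan hC.isClosed hC.bounded

theorem measurableSet_image_coords (hC : IsPolyhedron k C) (f : Fin n → StrongDual ℝ X) :
    MeasurableSet (coords f '' C) :=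
  (hC.isCompact.image (coords f).continuous).isClosed.measurableSet

theorem volume_image_coords_pos (hC : IsPolyhedron k C) {e : Fin k → StrongDual ℝ X}
    (he : InjOn (coords e) (vectorSpan ℝ C)) : 0 < volume (coords e '' C) :=
  have := hC.finiteDimensional
  measure_image_pos_of_convex volume hC.convex hC.nonempty
    (map_coords_eq_top_of_injOn hC.finrank_eq he)

theorem volume_image_coords_eq_zero_of_not_injOn (hC : IsPolyhedron k C)
    {f : Fin k → StrongDual ℝ X} (hf : ¬InjOn (coords f) (vectorSpan ℝ C)) :
    volume (coords f '' C) = 0 := by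
  have := hC.finiteDimensional
  refine addHaar_image_eq_zero_of_map_vectorSpan_ne_top volume
    (L := (coords f : X →ₗ[ℝ] (Fin k → ℝ))) fun htop => hf (injOn_iff_injective.2 ?_)
  rw [← LinearMap.range_domRestrict, LinearMap.range_eq_top] at htop
  exact (LinearMap.injective_iff_surjective_of_finrank_eq_finrank (by simp [hC.finrank_eq])).2 htop

theorem volume_image_coords_eq_zero_of_subset (hC : IsPolyhedron k C) (hDC : D ⊆ C)
    (hD : Module.finrank ℝ (vectorSpan ℝ D) < n) (f : Fin n → StrongDual ℝ X) :
    volume (coords f '' D) = 0 := by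
  have := hC.finiteDimensional
  have := Submodule.finiteDimensional_of_le (vectorSpan_mono ℝ hDC)
  exact addHaar_image_eq_zero_of_finrank_vectorSpan_lt volume (by simpa using hD)
    (coords f : X →ₗ[ℝ] (Fin n → ℝ))

theorem cut_ge (hC : IsPolyhedron k C) {h : StrongDual ℝ X} {c : ℝ} {b : X} (hb : b ∈ C)
    (hbc : c < h b) : IsPolyhedron k {x ∈ C | c ≤ h x} := by
  simpa using hC.cut (h := -h) (c := -c) hb (by simpa)

theorem volume_image_coords_cut_inter (hC : IsPolyhedron k C) {h : StrongDual ℝ X} {c : ℝ}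
    {a b : X} (ha : a ∈ C) (hac : h a < c) (hb : b ∈ C) (hbc : c < h b)
    (f : Fin k → StrongDual ℝ X) :
    volume (coords f '' ({x ∈ C | h x ≤ c} ∩ {x ∈ C | c ≤ h x})) = 0 := by
  have := hC.finiteDimensional
  have hsub : {x ∈ C | h x ≤ c} ∩ {x ∈ C | c ≤ h x} ⊆ C := inter_subset_left.trans (sep_subset _ _)
  refine hC.volume_image_coords_eq_zero_of_subset hsub ?_ f
  rw [← hC.finrank_eq]
  refine finrank_vectorSpan_lt_of_forall_eq (f := (h : X →ₗ[ℝ] ℝ)) hsub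
    (fun x hx => le_antisymm hx.1.2 hx.2.2) (vsub_mem_vectorSpan ℝ hb ha) ?_
  simpa [sub_eq_zero] using (hac.trans hbc).ne'

theorem area_cut (hC : IsPolyhedron k C) {h : StrongDual ℝ X} {c : ℝ} {a b : X}
    (ha : a ∈ C) (hac : h a < c) (hb : b ∈ C) (hbc : c < h b) :
    area k {x ∈ C | h x ≤ c} + area k {x ∈ C | c ≤ h x} = area k C := by
  have := hC.finiteDimensional
  obtain ⟨e, -, he⟩ := exists_coords_injOn hC.finrank_eq
  obtain ⟨κ, hκ⟩ := exists_volume_image_coords_eq_mul hC.finrank_eq he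
  have harea : ∀ T ⊆ C, area k T = _ * volume (coords e '' T) := fun T hT =>
    area_eq_iSup_mul (hκ T (vectorSpan_mono ℝ hT))
  have hunion : {x ∈ C | h x ≤ c} ∪ {x ∈ C | c ≤ h x} = C := by
    ext x
    simp only [mem_union, mem_ofPred_eq, ← and_or_left, le_total, and_true]
  have hnull := hC.volume_image_coords_cut_inter ha hac hb hbc e
  rw [(injOn_coords_of_injOn_vectorSpan he).image_inter (sep_subset _ _) (sep_subset _ _)] at hnull
  have hadd := measure_union_add_inter (μ := volume) (coords e '' {x ∈ C | h x ≤ c})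
    ((hC.cut_ge hb hbc).measurableSet_image_coords e)
  rw [hnull, add_zero, ← image_union, hunion] at hadd
  rw [harea _ (sep_subset _ _), harea _ (sep_subset _ _), harea C subset_rfl, ← mul_add, hadd]

theorem exists_area_section_eq_mul (hC : IsPolyhedron (k + 1) C) {f : StrongDual ℝ X} {u : X}
    (hu : u ∈ vectorSpan ℝ C) (hfu : f u ≠ 0) :
    ∃ (e : Fin k → StrongDual ℝ X) (κ : (Fin k → StrongDual ℝ X) → ℝ≥0∞),
      (∀ f' r, volume (coords f' '' {x ∈ C | f x = r}) =
        κ f' * volume (coords e '' {x ∈ C | f x = r})) ∧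
      ∀ r, area k {x ∈ C | f x = r} =
        (⨆ (f' : Fin k → StrongDual ℝ X) (_ : ∀ i, ‖f' i‖ = 1), κ f') *
          volume (coords e '' {x ∈ C | f x = r}) := by
  have := hC.finiteDimensional
  have hdim : Module.finrank ℝ ↥(vectorSpan ℝ C ⊓ LinearMap.ker (f : X →ₗ[ℝ] ℝ)) = k :=
    Nat.succ_injective ((finrank_inf_ker_add_one (f := (f : X →ₗ[ℝ] ℝ)) hu hfu).trans hC.finrank_eq)
  obtain ⟨e, -, he⟩ := exists_coords_injOn hdim
  obtain ⟨κ, hκ⟩ := exists_volume_image_coords_eq_mul hdim he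
  have hspan : ∀ r, vectorSpan ℝ {x ∈ C | f x = r} ≤
      vectorSpan ℝ C ⊓ LinearMap.ker (f : X →ₗ[ℝ] ℝ) := fun r =>
    le_inf (vectorSpan_mono ℝ (sep_subset _ _)) (vectorSpan_le_ker_of_forall_eq fun x hx => hx.2)
  exact ⟨e, κ, fun f' r => hκ _ (hspan r) f', fun r => area_eq_iSup_mul (hκ _ (hspan r))⟩

theorem aemeasurable_area_section (hC : IsPolyhedron (k + 1) C) (f : StrongDual ℝ X) :
    AEMeasurable fun r : ℝ => area k {x ∈ C | f x = r} := by
  obtain ⟨c, hc⟩ | ⟨u, hu, hfu⟩ :=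
    exists_forall_eq_or_exists_mem_vectorSpan (f : X →ₗ[ℝ] ℝ) C
  · refine (aemeasurable_const (b := 0)).congr ?_
    filter_upwards [ae_section_eq_empty hc] with r hr
    rw [hr, area_empty]
  · obtain ⟨e, κ, -, harea⟩ := hC.exists_area_section_eq_mul hu hfu
    simp_rw [harea]
    exact ((measurable_volume_image_coords_section
      (hC.measurableSet_image_coords _)).const_mul _).aemeasurable

theorem lintegral_area_section (hC : IsPolyhedron (k + 1) C) (f : StrongDual ℝ X) :
    ∫⁻ r : ℝ, area k {x ∈ C | f x = r} =
      ⨆ (f' : Fin k → StrongDual ℝ X) (_ : ∀ i, ‖f' i‖ = 1),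
        volume (coords (Fin.cons f f' : Fin (k + 1) → StrongDual ℝ X) '' C) := by
  have hcons : ∀ f' : Fin k → StrongDual ℝ X,
      volume (coords (Fin.cons f f' : Fin (k + 1) → StrongDual ℝ X) '' C) =
        ∫⁻ r : ℝ, volume (coords f' '' {x ∈ C | f x = r}) := fun f' =>
    volume_image_coords_cons (hC.measurableSet_image_coords _)
  simp_rw [hcons]
  obtain ⟨c, hc⟩ | ⟨u, hu, hfu⟩ :=
    exists_forall_eq_or_exists_mem_vectorSpan (f : X →ₗ[ℝ] ℝ) C
  · have hempty := ae_section_eq_empty hc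
    have hzero : ∀ φ : Set X → ℝ≥0∞, φ ∅ = 0 → ∫⁻ r : ℝ, φ {x ∈ C | f x = r} = 0 := fun φ hφ =>
      lintegral_eq_zero_of_ae_eq_zero (hempty.mono fun r hr => (congrArg φ hr).trans hφ)
    rw [hzero _ area_empty]
    refine (ENNReal.iSup_eq_zero.2 fun f' => ENNReal.iSup_eq_zero.2 fun _ => ?_).symm
    exact hzero (fun D => volume (coords f' '' D)) (by simp)
  · obtain ⟨e, κ, hκ, harea⟩ := hC.exists_area_section_eq_mul hu hfu
    have hmeas : Measurable fun r : ℝ => volume (coords e '' {x ∈ C | f x = r}) :=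
      measurable_volume_image_coords_section (hC.measurableSet_image_coords _)
    simp_rw [harea, lintegral_const_mul _ hmeas, ENNReal.iSup_mul]
    refine iSup_congr fun f' => iSup_congr fun _ => ?_
    rw [← lintegral_const_mul _ hmeas]
    exact lintegral_congr fun r => (hκ f' r).symm

theorem area_succ (hC : IsPolyhedron (k + 1) C) :
    area (k + 1) C = ⨆ (f : StrongDual ℝ X) (_ : ‖f‖ = 1), ∫⁻ r : ℝ, area k {x ∈ C | f x = r} := by
  simp_rw [hC.lintegral_area_section]
  refine le_antisymm (iSup₂_le fun f hf => ?_) (iSup₂_le fun f hf => iSup₂_le fun f' hf' => ?_)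
  · refine le_iSup₂_of_le (f 0) (hf 0) (le_iSup₂_of_le (Fin.tail f) (fun i => hf _) ?_)
    rw [Fin.cons_self_tail]
  · exact volume_image_coords_le_area (Fin.cases (by simpa using hf) (by simpa using hf')) C

end IsPolyhedron

/-! ### The degree of a formal sum over a point -/

section Degree

variable {X G : Type*} [NormedAddCommGroup X] [NormedSpace ℝ X] [NormedAddCommGroup G] {k : ℕ}

open OrientedPolyhedron

/-- The determinant of a coordinate map, as an alternating form. Its sign on frames compares
orientations. -/
def coordForm (f : Fin k → StrongDual ℝ X) : X [⋀^Fin k]→ₗ[ℝ] ℝ :=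
  Matrix.detRowAlternating.compLinearMap (coords f : X →ₗ[ℝ] (Fin k → ℝ))

theorem exists_form_eq_mul {V : Submodule ℝ X} [FiniteDimensional ℝ V]
    (hV : Module.finrank ℝ V = k) {ω : X [⋀^Fin k]→ₗ[ℝ] ℝ}
    (hω : ∃ v, (∀ i, v i ∈ V) ∧ ω v ≠ 0) (η : X [⋀^Fin k]→ₗ[ℝ] ℝ) :
    ∃ κ : ℝ, ∀ v, (∀ i, v i ∈ V) → η v = κ * ω v := by
  obtain ⟨e, heV, he⟩ := exists_frame hV
  have hωe : ω e ≠ 0 := form_ne_zero hV hω heV he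
  refine ⟨η e / ω e, fun v hv => ?_⟩
  by_contra hne
  refine form_ne_zero (ω := η - (η e / ω e) • ω) hV ⟨v, hv, ?_⟩ heV he ?_
  · simpa [sub_eq_zero] using hne
  · simp [hωe]

open Classical in
/-- The sign with which a coordinate map preserves an orientation `o` of a subspace `V`; it is zero
if the map is not injective on `V`. The frames tested need not belong to `o`, since the negative
orientation of a point contains none. -/
def orientSign (f : Fin k → StrongDual ℝ X) (V : Submodule ℝ X) (o : Set (Fin k → X)) : ℤ :=
  if ∃ v, (∀ i, v i ∈ V) ∧ coordForm f v ≠ 0 ∧ (0 < coordForm f v ↔ v ∈ o) then 1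
  else if ∃ v, (∀ i, v i ∈ V) ∧ coordForm f v ≠ 0 then -1 else 0

theorem orientSign_eq_sign {f : Fin k → StrongDual ℝ X} {V : Submodule ℝ X}
    {ω : X [⋀^Fin k]→ₗ[ℝ] ℝ} (hω : ∃ v, (∀ i, v i ∈ V) ∧ ω v ≠ 0) {κ : ℝ}
    (hκ : ∀ v, (∀ i, v i ∈ V) → coordForm f v = κ * ω v) :
    orientSign f V {v | (∀ i, v i ∈ V) ∧ 0 < ω v} = SignType.sign κ := by
  obtain ⟨v₀, hv₀, hωv₀⟩ := hω
  rcases lt_trichotomy κ 0 with hneg | rfl | hpos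
  · rw [orientSign, if_neg, if_pos, sign_neg hneg, SignType.coe_neg_one]
    · exact ⟨v₀, hv₀, by rw [hκ v₀ hv₀]; exact mul_ne_zero hneg.ne hωv₀⟩
    · rintro ⟨v, hv, hne, hiff⟩
      simp only [hκ v hv, mem_ofPred_eq, hv, implies_true, true_and] at hne hiff
      rcases (right_ne_zero_of_mul hne).lt_or_gt with h | h
      · exact h.not_gt (hiff.1 (mul_pos_of_neg_of_neg hneg h))
      · exact (mul_neg_of_neg_of_pos hneg h).not_gt (hiff.2 h)
  · rw [orientSign, if_neg, if_neg, sign_zero, SignType.coe_zero]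
    · rintro ⟨v, hv, hne⟩
      exact hne (by rw [hκ v hv, zero_mul])
    · rintro ⟨v, hv, hne, -⟩
      exact hne (by rw [hκ v hv, zero_mul])
  · rw [orientSign, if_pos, sign_pos hpos, SignType.coe_one]
    refine ⟨v₀, hv₀, ?_, ?_⟩ <;> rw [hκ v₀ hv₀]
    · exact mul_ne_zero hpos.ne' hωv₀
    · simp only [mem_ofPred_eq, hv₀, implies_true, true_and, mul_pos_iff_of_pos_left hpos]

theorem orientSign_opposite (f : Fin k → StrongDual ℝ X) {V : Submodule ℝ X}
    [FiniteDimensional ℝ V] (hV : Module.finrank ℝ V = k) {o o' : Set (Fin k → X)}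
    (ho : IsOrientation V o) (ho' : IsOrientation V o') (hne : o ≠ o') :
    orientSign f V o' = -orientSign f V o := by
  obtain ⟨ω, hω, rfl, rfl⟩ := ho.exists_opposite hV ho' hne
  obtain ⟨κ, hκ⟩ := exists_form_eq_mul hV hω (coordForm f)
  rw [orientSign_eq_sign hω hκ,
    orientSign_eq_sign (κ := -κ) (by simpa using hω) (by simpa using hκ), Left.sign_neg,
    SignType.coe_neg]

theorem enorm_orientSign_smul_le (f : Fin k → StrongDual ℝ X) (V : Submodule ℝ X)
    (o : Set (Fin k → X)) (g : G) : ‖orientSign f V o • g‖ₑ ≤ ‖g‖ₑ := by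
  unfold orientSign
  split_ifs <;> simp

open Classical in
/-- The sum of the coefficients, with signs, of the polyhedra whose image under a coordinate map
contains the point `y`. Up to a null set of points it depends only on the chain that a formal sum
represents, which makes it the invariant that detects nonzero chains. -/
def degreeAt (f : Fin k → StrongDual ℝ X) (y : Fin k → ℝ) : (OrientedPolyhedron X k →₀ G) →+ G :=
  Finsupp.liftAddHom fun S => if y ∈ coords f '' S.carrier then
    zsmulAddGroupHom (orientSign f (vectorSpan ℝ S.carrier) S.orientation) else 0

open Classical in
theorem degreeAt_single (f : Fin k → StrongDual ℝ X) (y : Fin k → ℝ) (S : OrientedPolyhedron X k)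
    (g : G) : degreeAt f y (Finsupp.single S g) = if y ∈ coords f '' S.carrier then
      orientSign f (vectorSpan ℝ S.carrier) S.orientation • g else 0 := by
  rw [degreeAt, Finsupp.liftAddHom_apply_single]
  split_ifs <;> rfl

theorem degreeAt_single_of_notMem {f : Fin k → StrongDual ℝ X} {y : Fin k → ℝ}
    {S : OrientedPolyhedron X k} (hy : y ∉ coords f '' S.carrier) (g : G) :
    degreeAt f y (Finsupp.single S g) = 0 := by
  rw [degreeAt_single, if_neg hy]

theorem degreeAt_opposite (f : Fin k → StrongDual ℝ X) (y : Fin k → ℝ)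
    {P P' : OrientedPolyhedron X k} (h : P.IsOpposite P') (g : G) :
    degreeAt f y (Finsupp.single P' g) = -degreeAt f y (Finsupp.single P g) := by
  have := P.isPolyhedron.finiteDimensional
  rw [degreeAt_single, degreeAt_single, ← h.1, orientSign_opposite f P.isPolyhedron.finrank_eq
    P.isOrientation (h.1 ▸ P'.isOrientation) h.2]
  split_ifs <;> simp

theorem degreeAt_subdivision (f : Fin k → StrongDual ℝ X) {P P₁ P₂ : OrientedPolyhedron X k}
    (h : P.IsSubdivision P₁ P₂) (g : G) : ∀ᵐ y, degreeAt f y (Finsupp.single P g) =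
      degreeAt f y (Finsupp.single P₁ g) + degreeAt f y (Finsupp.single P₂ g) := by
  have hP := P.isPolyhedron
  have hsub₁ : P₁.carrier ⊆ P.carrier := h.carrier_eq ▸ subset_union_left
  have hsub₂ : P₂.carrier ⊆ P.carrier := h.carrier_eq ▸ subset_union_right
  by_cases hinj : InjOn (coords f) (vectorSpan ℝ P.carrier)
  · obtain ⟨l, c, hl₁, hl₂, ⟨a, ha, hac⟩, b, hb, hbc⟩ := exists_cut hP P₁.isPolyhedron
      P₂.isPolyhedron h.carrier_eq h.disjoint
    have hnull := hP.volume_image_coords_cut_inter ha hac hb hbc f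
    rw [← hl₁, ← hl₂,
      (injOn_coords_of_injOn_vectorSpan hinj).image_inter hsub₁ hsub₂] at hnull
    filter_upwards [measure_eq_zero_iff_ae_notMem.1 hnull] with y hy
    rw [degreeAt_single, degreeAt_single, degreeAt_single, h.orientation_left,
      h.orientation_right, hP.vectorSpan_eq P₁.isPolyhedron hsub₁,
      hP.vectorSpan_eq P₂.isPolyhedron hsub₂, h.carrier_eq, image_union]
    by_cases hy₁ : y ∈ coords f '' P₁.carrier <;> by_cases hy₂ : y ∈ coords f '' P₂.carrier
    · exact absurd ⟨hy₁, hy₂⟩ hy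
    all_goals simp only [mem_union, hy₁, hy₂, or_true, true_or, or_self, if_true, if_false,
      add_zero, zero_add]
  · have hnull := hP.volume_image_coords_eq_zero_of_not_injOn hinj
    filter_upwards [measure_eq_zero_iff_ae_notMem.1 hnull] with y hy
    rw [degreeAt_single_of_notMem hy, degreeAt_single_of_notMem fun h => hy (image_mono hsub₁ h),
      degreeAt_single_of_notMem fun h => hy (image_mono hsub₂ h), add_zero]

theorem ae_degreeAt_eq_zero_of_mem_relations (f : Fin k → StrongDual ℝ X)
    {z : OrientedPolyhedron X k →₀ G} (hz : z ∈ relations X G k) : ∀ᵐ y, degreeAt f y z = 0 := by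
  induction hz using AddSubgroup.closure_induction with
  | mem z hz =>
    obtain ⟨P, P', g, h, rfl⟩ | ⟨P, P₁, P₂, g, h, rfl⟩ := hz
    · exact .of_forall fun y => by
        rw [map_sub, Finsupp.single_neg, map_neg, degreeAt_opposite f y h, sub_self]
    · filter_upwards [degreeAt_subdivision f h g] with y hy
      rw [map_sub, map_add, hy, sub_self]
  | zero => simp
  | add c d _ _ hc hd =>
    filter_upwards [hc, hd] with y hcy hdy
    rw [map_add, hcy, hdy, add_zero]
  | neg c _ hc =>
    filter_upwards [hc] with y hcy
    rw [map_neg, hcy, neg_zero]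

theorem ae_degreeAt_eq_of_toChain_eq (f : Fin k → StrongDual ℝ X)
    {c d : OrientedPolyhedron X k →₀ G} (h : (toChain c : PolyChain X G k) = toChain d) :
    ∀ᵐ y, degreeAt f y c = degreeAt f y d := by
  have hmem : c - d ∈ relations X G k := by
    rw [← QuotientAddGroup.eq_zero_iff]
    exact (map_sub toChain c d).trans (sub_eq_zero.2 h)
  filter_upwards [ae_degreeAt_eq_zero_of_mem_relations f hmem] with y hy
  rwa [map_sub, sub_eq_zero] at hy

/-- The sum of the areas of the polyhedra in a formal sum, weighted by the norms of their
coefficients: an upper bound for the mass of the chain it represents. -/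
def weight (c : OrientedPolyhedron X k →₀ G) : ℝ≥0∞ := c.sum fun S g => ‖g‖ₑ * area k S.carrier

open Classical in
theorem enorm_degreeAt_le (f : Fin k → StrongDual ℝ X) (y : Fin k → ℝ)
    (c : OrientedPolyhedron X k →₀ G) : ‖degreeAt f y c‖ₑ ≤
      ∑ S ∈ c.support, (coords f '' S.carrier).indicator (fun _ => ‖c S‖ₑ) y := by
  have hsum : degreeAt f y c = ∑ S ∈ c.support, degreeAt f y (Finsupp.single S (c S)) := by
    conv_lhs => rw [← Finsupp.sum_single c, Finsupp.sum, map_sum]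
  rw [hsum]
  refine (enorm_sum_le _ _).trans (Finset.sum_le_sum fun S _ => ?_)
  rw [degreeAt_single, indicator_apply]
  split_ifs
  · exact enorm_orientSign_smul_le _ _ _ _
  · simp

theorem lintegral_enorm_degreeAt_le {f : Fin k → StrongDual ℝ X} (hf : ∀ i, ‖f i‖ = 1)
    (c : OrientedPolyhedron X k →₀ G) : ∫⁻ y, ‖degreeAt f y c‖ₑ ≤ weight c := by
  have hmeas (S : OrientedPolyhedron X k) := S.isPolyhedron.measurableSet_image_coords f
  calc ∫⁻ y, ‖degreeAt f y c‖ₑ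
      ≤ ∫⁻ y, ∑ S ∈ c.support, (coords f '' S.carrier).indicator (fun _ => ‖c S‖ₑ) y :=
        lintegral_mono fun y => enorm_degreeAt_le f y c
    _ = ∑ S ∈ c.support, ‖c S‖ₑ * volume (coords f '' S.carrier) := by
        rw [lintegral_finsetSum _ fun S _ => measurable_const.indicator (hmeas S)]
        exact Finset.sum_congr rfl fun S _ => lintegral_indicator_const (hmeas S) _
    _ ≤ weight c :=
        Finset.sum_le_sum fun S _ => mul_le_mul' le_rfl (volume_image_coords_le_area hf _)

end Degree

/-! ### The degree of a boundary -/

section PointsOut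

variable {X : Type*} [NormedAddCommGroup X] [NormedSpace ℝ X] {k : ℕ} {C F F' : Set X} {u : X}

/-- The vector `u` points out of `C` across `F`: it crosses some supporting hyperplane of `C` that
contains `F`. This is the form in which the orientation of facets is compared along a fibre. -/
def PointsOut (C F : Set X) (u : X) : Prop :=
  ∃ (l : StrongDual ℝ X) (m : ℝ), (∀ x ∈ C, l x ≤ m) ∧ (∀ x ∈ F, l x = m) ∧ 0 < l u

theorem PointsOut.mem_of_add_smul_mem (h : PointsOut C F u) {b : X} (hb : b ∈ C) {t : ℝ}
    (ht : t ≤ 0) (hF : b + t • u ∈ F) : b ∈ F := by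
  obtain ⟨l, m, hC, hlF, hlu⟩ := h
  have heq := hlF _ hF
  rw [map_add, map_smul, smul_eq_mul] at heq
  obtain rfl : t = 0 := by nlinarith [hC b hb]
  simpa using hF

namespace IsFacet

theorem exists_sub_smul_mem (hC : IsPolyhedron (k + 1) C) (hF : IsFacet k C F) {x y : X}
    (hx : x ∈ F) (hy : y ∈ C \ F) (hu : u ∈ vectorSpan ℝ C) :
    ∃ a : ℝ, u - a • (x - y) ∈ vectorSpan ℝ F := by
  obtain ⟨l, m, rfl, hm, -⟩ := hF.exists_level hC
  have hlt : l y < m := (hm y hy.1).lt_of_ne fun h => hy.2 ⟨hy.1, h⟩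
  have hlxy : l (x - y) ≠ 0 := by rw [map_sub, hx.2]; exact (sub_pos.2 hlt).ne'
  have hxy : x - y ∈ vectorSpan ℝ C := vsub_mem_vectorSpan ℝ hx.1 hy.1
  refine ⟨l u / l (x - y), ?_⟩
  rw [hC.vectorSpan_level hF.2 hF.subset (fun _ hz => hz.2) hy.1 hlt.ne]
  refine ⟨sub_mem hu (Submodule.smul_mem _ _ hxy), ?_⟩
  change l (u - (l u / l (x - y)) • (x - y)) = 0
  rw [map_sub l u, map_smul, smul_eq_mul, div_mul_cancel₀ _ hlxy, sub_self]

theorem pointsOut_iff (hC : IsPolyhedron (k + 1) C) (hF : IsFacet k C F) {x y : X} (hx : x ∈ F)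
    (hy : y ∈ C \ F) {a : ℝ} (hu : u - a • (x - y) ∈ vectorSpan ℝ F) :
    PointsOut C F u ↔ 0 < a := by
  have hlu {l : StrongDual ℝ X} {m : ℝ} (hl : ∀ z ∈ F, l z = m) : l u = a * l (x - y) := by
    have hmem := vectorSpan_le_ker_of_forall_eq (f := (l : X →ₗ[ℝ] ℝ)) hl hu
    simpa [sub_eq_zero] using hmem
  constructor
  · rintro ⟨l, m, hlC, hlF, hpos⟩
    refine pos_of_mul_pos_left (hlu hlF ▸ hpos) ?_
    rw [map_sub, hlF x hx]
    exact sub_nonneg.2 (hlC y hy.1)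
  · intro ha
    obtain ⟨l, m, rfl, hlC, -⟩ := hF.exists_level hC
    refine ⟨l, m, hlC, fun z hz => hz.2, ?_⟩
    rw [hlu fun z hz => hz.2, map_sub, hx.2]
    exact mul_pos ha (sub_pos.2 ((hlC y hy.1).lt_of_ne fun h => hy.2 ⟨hy.1, h⟩))

theorem volume_image_coords_inter_eq_zero (hC : IsPolyhedron (k + 1) C) (hF : IsFacet k C F)
    (hF' : IsFacet k C F') (hne : F ≠ F') (f : Fin k → StrongDual ℝ X) :
    volume (coords f '' (F ∩ F')) = 0 := by
  obtain hempty | ⟨x', hx'⟩ := (F ∩ F').eq_empty_or_nonempty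
  · simp [hempty]
  obtain ⟨l, m, hF'l, -, z, hz, hzm⟩ := hF'.exists_level hC
  obtain ⟨x, hx, hxm⟩ : ∃ x ∈ F, l x ≠ m := by
    by_contra! h
    exact hne ((hF.eq_level hC h hz hzm.ne).trans hF'l.symm)
  rw [hF'l] at hx' ⊢
  have := hF.2.finiteDimensional
  refine hF.2.volume_image_coords_eq_zero_of_subset inter_subset_left ?_ f
  rw [← hF.2.finrank_eq]
  refine finrank_vectorSpan_lt_of_forall_eq inter_subset_left (f := (l : X →ₗ[ℝ] ℝ))
    (fun y hy => hy.2.2) (vsub_mem_vectorSpan ℝ hx hx'.1) ?_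
  change l (x - x') ≠ 0
  rwa [map_sub, hx'.2.2, sub_ne_zero]

end IsFacet

theorem exists_pos_add_smul_mem {s : Finset (StrongDual ℝ X × ℝ)}
    (hs : C = {x | x ∈ affineSpan ℝ C ∧ ∀ p ∈ s, p.1 x ≤ p.2}) {b : X} (hb : b ∈ C)
    (hu : u ∈ vectorSpan ℝ C) (h : ∀ p ∈ s, p.1 b = p.2 → p.1 u ≤ 0) :
    ∃ ε : ℝ, 0 < ε ∧ b + ε • u ∈ C := by
  have hle : ∀ p ∈ s, p.1 b ≤ p.2 := (hs.subset hb).2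
  have hsmall : ∀ᶠ ε in nhdsWithin (0 : ℝ) (Ioi 0), ∀ p ∈ s, p.1 (b + ε • u) ≤ p.2 := by
    refine (Filter.eventually_all_finset s).2 fun p hp => ?_
    obtain hlt | heq := (hle p hp).lt_or_eq
    · have hcont : Continuous fun ε : ℝ => p.1 (b + ε • u) := by fun_prop
      have hnear : ∀ᶠ ε in nhds (0 : ℝ), p.1 (b + ε • u) < p.2 :=
        hcont.continuousAt.eventually_lt continuousAt_const (by simpa using hlt)
      exact (hnear.filter_mono nhdsWithin_le_nhds).mono fun _ => le_of_lt
    · filter_upwards [self_mem_nhdsWithin] with ε (hε : 0 < ε)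
      rw [map_add, map_smul, smul_eq_mul, heq]
      exact add_le_of_nonpos_right (mul_nonpos_of_nonneg_of_nonpos hε.le (h p hp heq))
  obtain ⟨ε, hε, hpos⟩ := (hsmall.and self_mem_nhdsWithin).exists
  refine ⟨ε, hpos, hs.superset ⟨?_, hε⟩⟩
  rw [add_comm]
  refine AffineSubspace.vadd_mem_of_mem_direction ?_ (subset_affineSpan ℝ _ hb)
  rw [direction_affineSpan]
  exact Submodule.smul_mem _ _ hu

namespace IsPolyhedron

theorem ae_exists_facet_pointsOut (hC : IsPolyhedron (k + 1) C) (f : Fin k → StrongDual ℝ X)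
    (hu : u ∈ vectorSpan ℝ C) :
    ∀ᵐ y, ∀ b ∈ C, coords f b = y → (∀ ε : ℝ, 0 < ε → b + ε • u ∉ C) →
      ∃ F, IsFacet k C F ∧ PointsOut C F u ∧ b ∈ F := by
  have := hC.finiteDimensional
  obtain ⟨s, hs⟩ := hC.halfSpaces
  have hgeneric : ∀ᵐ y, ∀ p ∈ (s : Set (StrongDual ℝ X × ℝ)),
      Module.finrank ℝ (vectorSpan ℝ {x ∈ C | p.1 x = p.2}) < k →
      y ∉ coords f '' {x ∈ C | p.1 x = p.2} := by
    refine (ae_ball_iff s.countable_toSet).2 fun p _ => Filter.eventually_imp_distrib_left.2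
      fun hlt => measure_eq_zero_iff_ae_notMem.1 ?_
    exact hC.volume_image_coords_eq_zero_of_subset (sep_subset _ _) hlt f
  filter_upwards [hgeneric] with y hy b hb hby hlast
  obtain ⟨p, hp, hpb, hpu⟩ : ∃ p ∈ s, p.1 b = p.2 ∧ 0 < p.1 u := by
    by_contra! h
    obtain ⟨ε, hε, hmem⟩ := exists_pos_add_smul_mem hs hb hu h
    exact hlast ε hε hmem
  have hpC : ∀ x ∈ C, p.1 x ≤ p.2 := fun x hx => (hs.subset hx).2 p hp
  refine ⟨{x ∈ C | p.1 x = p.2}, IsFacet.of_level hC hpC ⟨b, hb, hpb⟩ (le_antisymm ?_ ?_),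
    ⟨p.1, p.2, hpC, fun x hx => hx.2, hpu⟩, hb, hpb⟩
  · rw [← Nat.lt_succ_iff, Nat.succ_eq_add_one, ← hC.finrank_eq]
    exact finrank_vectorSpan_lt_of_forall_eq (sep_subset _ _) (f := (p.1 : X →ₗ[ℝ] ℝ))
      (fun x hx => hx.2) hu hpu.ne'
  · by_contra! hlt
    exact hy p hp hlt ⟨b, ⟨hb, hpb⟩, hby⟩

theorem exists_last_mem_fiber {n : ℕ} (hC : IsPolyhedron n C) {f : Fin k → StrongDual ℝ X}
    (hu : u ≠ 0) (hker : vectorSpan ℝ C ⊓ LinearMap.ker (coords f : X →ₗ[ℝ] (Fin k → ℝ)) ≤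
      Submodule.span ℝ {u}) {y : Fin k → ℝ} (hy : y ∈ coords f '' C) :
    ∃ b ∈ C, coords f b = y ∧ ∀ z ∈ C, coords f z = y → ∃ t ≤ (0 : ℝ), b + t • u = z := by
  obtain ⟨lam, hlam⟩ := SeparatingDual.exists_eq_one (R := ℝ) hu
  have hfiber : IsCompact (C ∩ coords f ⁻¹' {y}) :=
    hC.isCompact.inter_right (isClosed_singleton.preimage (coords f).continuous)
  obtain ⟨b, ⟨hb, hby⟩, hmax⟩ := hfiber.exists_isMaxOn hy lam.continuous.continuousOn
  refine ⟨b, hb, hby, fun z hz hzy => ?_⟩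
  have hzb : coords f (z - b) = 0 := by rw [map_sub, hzy, show coords f b = y from hby, sub_self]
  obtain ⟨t, ht⟩ := Submodule.mem_span_singleton.1
    (hker ⟨vsub_mem_vectorSpan ℝ hz hb, hzb⟩)
  have hle : lam z ≤ lam b := hmax ⟨hz, hzy⟩
  have hlz := congrArg lam ht
  rw [vsub_eq_sub, map_sub, map_smul, hlam, smul_eq_mul, mul_one] at hlz
  exact ⟨t, by linarith, by rw [ht, vsub_eq_sub, add_sub_cancel]⟩

theorem ae_existsUnique_facet_pointsOut (hC : IsPolyhedron (k + 1) C)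
    {f : Fin k → StrongDual ℝ X} (hu : u ≠ 0)
    (hker : vectorSpan ℝ C ⊓ LinearMap.ker (coords f : X →ₗ[ℝ] (Fin k → ℝ)) =
      Submodule.span ℝ {u}) :
    ∀ᵐ y, y ∈ coords f '' C → ∃! F, IsFacet k C F ∧ PointsOut C F u ∧ y ∈ coords f '' F := by
  obtain ⟨huC, hfu⟩ : u ∈ vectorSpan ℝ C ⊓ LinearMap.ker (coords f : X →ₗ[ℝ] (Fin k → ℝ)) :=
    hker ▸ Submodule.mem_span_singleton_self u
  have hfu : coords f u = 0 := hfu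
  have hcount : {F | IsFacet k C F}.Countable := (IsFacet.finite hC).countable
  have hgeneric : ∀ᵐ y, ∀ F ∈ {F | IsFacet k C F}, ∀ F' ∈ {F | IsFacet k C F}, F ≠ F' →
      y ∉ coords f '' (F ∩ F') :=
    (ae_ball_iff hcount).2 fun F hF => (ae_ball_iff hcount).2 fun F' hF' =>
      Filter.eventually_imp_distrib_left.2 fun hne => measure_eq_zero_iff_ae_notMem.1
        (IsFacet.volume_image_coords_inter_eq_zero hC hF hF' hne f)
  filter_upwards [hgeneric, hC.ae_exists_facet_pointsOut f huC] with y hdisj hexit hyC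
  obtain ⟨b, hb, hby, hlast⟩ := hC.exists_last_mem_fiber hu hker.le hyC
  obtain ⟨E, hE, hEu, hbE⟩ := hexit b hb hby fun ε hε hmem => by
    obtain ⟨t, ht, heq⟩ := hlast _ hmem (by rw [map_add, map_smul, hfu, smul_zero, add_zero, hby])
    exact (ht.trans_lt hε).ne (smul_left_injective ℝ hu (add_left_cancel heq))
  refine ⟨E, ⟨hE, hEu, b, hbE, hby⟩, ?_⟩
  rintro F ⟨hF, hFu, z, hz, hzy⟩
  obtain ⟨t, ht, rfl⟩ := hlast z (hF.subset hz) hzy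
  by_contra hne
  exact hdisj F hF E hE hne ⟨b, ⟨hFu.mem_of_add_smul_mem hb ht hz, hbE⟩, hby⟩

end IsPolyhedron

end PointsOut

section FacetSum

variable {X G : Type*} [NormedAddCommGroup X] [NormedSpace ℝ X] [NormedAddCommGroup G] {k : ℕ}
  {C F : Set X} {f : Fin k → StrongDual ℝ X} {u : X}

open OrientedPolyhedron

theorem exists_inf_ker_eq_span_singleton {V E : Type*} [AddCommGroup V] [Module ℝ V]
    [AddCommGroup E] [Module ℝ E] {W : Submodule ℝ V} [FiniteDimensional ℝ W] {L : V →ₗ[ℝ] E}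
    (hW : Module.finrank ℝ W = Module.finrank ℝ E + 1) (hL : W.map L = ⊤) :
    ∃ u ≠ 0, W ⊓ LinearMap.ker L = Submodule.span ℝ {u} := by
  have hdim : Module.finrank ℝ ↥(W ⊓ LinearMap.ker L) = 1 := by
    have hrank := (L.domRestrict W).finrank_range_add_finrank_ker
    rw [LinearMap.range_domRestrict, hL, finrank_top, hW, add_right_inj,
      LinearMap.ker_domRestrict] at hrank
    rw [← hrank, ← Submodule.map_comap_subtype]
    exact Submodule.finrank_map_subtype_eq W _
  obtain ⟨u, hu, hspan⟩ := finrank_eq_one_iff'.1 hdim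
  refine ⟨u, fun h => hu (Subtype.ext h), le_antisymm (fun w hw => ?_) ?_⟩
  · obtain ⟨t, ht⟩ := hspan ⟨w, hw⟩
    exact Submodule.mem_span_singleton.2 ⟨t, congrArg Subtype.val ht⟩
  · exact (Submodule.span_singleton_le_iff_mem _ _).2 u.2

theorem coordForm_cons (l : StrongDual ℝ X) (hl : l u = 1) (hf : coords f u = 0) (v : Fin k → X) :
    coordForm (Fin.cons l f : Fin (k + 1) → StrongDual ℝ X) (Matrix.vecCons u v) =
      coordForm f v := by
  change Matrix.det (Matrix.of fun i j => (Fin.cons l f : Fin (k + 1) → StrongDual ℝ X) j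
    (Matrix.vecCons u v i)) = Matrix.det (Matrix.of fun i j => f j (v i))
  have hfu : ∀ j, f j u = 0 := congrFun hf
  rw [Matrix.det_succ_row_zero, Fin.sum_univ_succ]
  simp [hl, hfu, Matrix.submatrix]

theorem curryLeft_eq_mul_of_sub_smul_mem {W : Submodule ℝ X} [FiniteDimensional ℝ W]
    (hW : Module.finrank ℝ W = k) (ω : X [⋀^Fin (k + 1)]→ₗ[ℝ] ℝ) {w : X} {a : ℝ}
    (h : u - a • w ∈ W) {v : Fin k → X} (hv : ∀ i, v i ∈ W) :
    ω.curryLeft u v = a * ω.curryLeft w v := by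
  have hzero : ω.curryLeft (u - a • w) v = 0 := form_eq_zero hW ω (Fin.cases h hv)
  rwa [map_sub, map_smul, AlternatingMap.sub_apply, AlternatingMap.smul_apply, smul_eq_mul,
    sub_eq_zero] at hzero

open Classical in
theorem orientSign_inducedOrientation (hC : IsPolyhedron (k + 1) C) (hF : IsFacet k C F)
    (hu : u ∈ vectorSpan ℝ C) {ω : X [⋀^Fin (k + 1)]→ₗ[ℝ] ℝ}
    (hω : ∃ v, (∀ i, v i ∈ vectorSpan ℝ C) ∧ ω v ≠ 0) {κ : ℝ}
    (hκ : ∀ v, (∀ i, v i ∈ vectorSpan ℝ C) → coordForm f v = κ * ω.curryLeft u v) :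
    orientSign f (vectorSpan ℝ F)
      (inducedOrientation {v | (∀ i, v i ∈ vectorSpan ℝ C) ∧ 0 < ω v} C F) =
        SignType.sign κ * ((if PointsOut C F u then 1 else 0) -
          if PointsOut C F (-u) then 1 else 0) := by
  have := hF.2.finiteDimensional
  obtain ⟨x, hx, y, hy⟩ := hF.exists_mem_diff hC
  obtain ⟨a, ha⟩ := hF.exists_sub_smul_mem hC hx hy hu
  have hneg : -u - (-a) • (x - y) ∈ vectorSpan ℝ F := by
    rw [neg_smul, ← neg_sub', neg_mem_iff]
    exact ha
  rw [inducedOrientation_eq hC hF ω hx hy,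
    orientSign_eq_sign (κ := κ * a) (curryLeft_ne_zero hC hF hω hx hy) fun v hv => ?_,
    hF.pointsOut_iff hC hx hy ha, hF.pointsOut_iff hC hx hy hneg, sign_mul, SignType.coe_mul]
  · congr 1
    rcases lt_trichotomy a 0 with h | rfl | h
    · simp [h, h.not_gt]
    · simp
    · simp [h, h.not_gt]
  · rw [hκ v fun i => vectorSpan_mono ℝ hF.subset (hv i),
      curryLeft_eq_mul_of_sub_smul_mem hF.2.finrank_eq ω ha hv, mul_assoc]

open Classical in
theorem exists_orientSign_inducedOrientation_eq (hC : IsPolyhedron (k + 1) C)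
    {o : Set (Fin (k + 1) → X)} (ho : IsOrientation (vectorSpan ℝ C) o) (hu : u ∈ vectorSpan ℝ C)
    (hu0 : u ≠ 0) (hfu : coords f u = 0) :
    ∃ σ : ℤ, ∀ F, IsFacet k C F → orientSign f (vectorSpan ℝ F) (inducedOrientation o C F) =
      σ * ((if PointsOut C F u then 1 else 0) - if PointsOut C F (-u) then 1 else 0) := by
  have := hC.finiteDimensional
  obtain ⟨l, hl⟩ := SeparatingDual.exists_eq_one (R := ℝ) hu0
  obtain ⟨ω, hω, rfl⟩ := ho
  obtain ⟨κ, hκ⟩ := exists_form_eq_mul hC.finrank_eq hω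
    (coordForm (Fin.cons l f : Fin (k + 1) → StrongDual ℝ X))
  refine ⟨SignType.sign κ, fun F hF => orientSign_inducedOrientation hC hF hu hω fun v hv => ?_⟩
  rw [← coordForm_cons l hl hfu v]
  exact hκ _ (Fin.cases hu hv)

/-- The formal sum of the facets of the polyhedra in a formal sum, which represents the
boundary. -/
def facetSum : (OrientedPolyhedron X (k + 1) →₀ G) →+ (OrientedPolyhedron X k →₀ G) :=
  Finsupp.liftAddHom fun S => ∑ F ∈ S.facets_finite.toFinset, Finsupp.singleAddHom F

theorem facetSum_single (S : OrientedPolyhedron X (k + 1)) (g : G) :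
    facetSum (Finsupp.single S g) = ∑ F ∈ S.facets_finite.toFinset, Finsupp.single F g := by
  rw [facetSum, Finsupp.liftAddHom_apply_single, AddMonoidHom.finsetSum_apply]
  rfl

theorem liftChain_simple {A : Type*} [AddCommGroup A] (φ : OrientedPolyhedron X k → G →+ A)
    (hopp : ∀ P P', P.IsOpposite P' → ∀ g, φ P g + φ P' g = 0)
    (hsub : ∀ P P₁ P₂, P.IsSubdivision P₁ P₂ → ∀ g, φ P g = φ P₁ g + φ P₂ g)
    (S : OrientedPolyhedron X k) (g : G) : liftChain φ hopp hsub (simple S g) = φ S g :=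
  Finsupp.liftAddHom_apply_single φ S g

theorem toChain_single (S : OrientedPolyhedron X k) (g : G) :
    toChain (Finsupp.single S g) = simple S g := rfl

theorem boundary_simple (S : OrientedPolyhedron X (k + 1)) (g : G) :
    boundary (simple S g) = simpleBoundary S g := liftChain_simple _ _ _ S g

theorem toChain_facetSum (c : OrientedPolyhedron X (k + 1) →₀ G) :
    (toChain (facetSum c) : PolyChain X G k) = boundary (toChain c) := by
  induction c using Finsupp.induction_linear with
  | zero => simp only [map_zero]
  | add c d hc hd => simp only [map_add, hc, hd]
  | single S g =>
    rw [facetSum_single, toChain_single, boundary_simple, simpleBoundary, map_sum,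
      AddMonoidHom.finsetSum_apply]
    rfl

theorem sum_facets_ite_eq_one {S : OrientedPolyhedron X (k + 1)} {p : Set X → Prop}
    [DecidablePred p] (h : ∃! F, IsFacet k S.carrier F ∧ p F) :
    ∑ F ∈ S.facets_finite.toFinset, (if p F.carrier then 1 else 0 : ℤ) = 1 := by
  obtain ⟨F, ⟨hF, hpF⟩, huniq⟩ := h
  obtain ⟨F, hFS, rfl⟩ := S.carrier_image_facets.superset hF
  rw [Finset.sum_eq_single_of_mem F (S.facets_finite.mem_toFinset.2 hFS), if_pos hpF]
  intro F' hF' hne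
  have hF'S := S.facets_finite.mem_toFinset.1 hF'
  exact if_neg fun h => hne (S.carrier_injOn_facets hF'S hFS (huniq _ ⟨hF'S.1, h⟩))

theorem degreeAt_facetSum_single_of_notMem {S : OrientedPolyhedron X (k + 1)} {y : Fin k → ℝ}
    (hy : y ∉ coords f '' S.carrier) (g : G) :
    degreeAt f y (facetSum (Finsupp.single S g)) = 0 := by
  rw [facetSum_single, map_sum]
  refine Finset.sum_eq_zero fun F hF => degreeAt_single_of_notMem (fun h => hy ?_) g
  exact image_mono (S.facets_finite.mem_toFinset.1 hF).1.subset h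

/- A generic fibre of the coordinate map is a line, which enters the polyhedron through exactly one
facet and leaves it through exactly one facet; these two count with opposite signs. -/
theorem ae_degreeAt_facetSum_single (f : Fin k → StrongDual ℝ X)
    (S : OrientedPolyhedron X (k + 1)) (g : G) :
    ∀ᵐ y, degreeAt f y (facetSum (Finsupp.single S g)) = 0 := by
  classical
  have hS := S.isPolyhedron
  have := hS.finiteDimensional
  by_cases htop : (vectorSpan ℝ S.carrier).map (coords f : X →ₗ[ℝ] (Fin k → ℝ)) = ⊤
  · obtain ⟨u, hu0, hker⟩ :=
      exists_inf_ker_eq_span_singleton (by simpa using hS.finrank_eq) htop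
    obtain ⟨hu, hfu⟩ := hker.ge (Submodule.mem_span_singleton_self u)
    obtain ⟨σ, hσ⟩ := exists_orientSign_inducedOrientation_eq hS S.isOrientation hu hu0 hfu
    filter_upwards [hS.ae_existsUnique_facet_pointsOut hu0 hker,
      hS.ae_existsUnique_facet_pointsOut (neg_ne_zero.2 hu0)
        (by rw [hker, ← Submodule.span_neg, Set.neg_singleton])] with y hexit henter
    by_cases hyS : y ∈ coords f '' S.carrier
    · have hdegree : ∀ F ∈ S.facets_finite.toFinset, degreeAt f y (Finsupp.single F g) =
          (σ * ((if PointsOut S.carrier F.carrier u ∧ y ∈ coords f '' F.carrier then 1 else 0) -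
            if PointsOut S.carrier F.carrier (-u) ∧ y ∈ coords f '' F.carrier then 1 else 0)) •
              g := by
        intro F hF
        have hFS := S.facets_finite.mem_toFinset.1 hF
        rw [degreeAt_single, hFS.2, hσ _ hFS.1]
        by_cases hyF : y ∈ coords f '' F.carrier <;> simp [hyF]
      have hcount {v : X}
          (hv : ∃! F, IsFacet k S.carrier F ∧ PointsOut S.carrier F v ∧ y ∈ coords f '' F) :=
        sum_facets_ite_eq_one (p := fun F => PointsOut S.carrier F v ∧ y ∈ coords f '' F) hv
      rw [facetSum_single, map_sum, Finset.sum_congr rfl hdegree, ← Finset.sum_smul,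
        ← Finset.mul_sum, Finset.sum_sub_distrib, hcount (hexit hyS), hcount (henter hyS),
        sub_self, mul_zero, zero_smul]
    · exact degreeAt_facetSum_single_of_notMem hyS g
  · have hnull := addHaar_image_eq_zero_of_map_vectorSpan_ne_top volume htop
    filter_upwards [measure_eq_zero_iff_ae_notMem.1 hnull] with y hy
    exact degreeAt_facetSum_single_of_notMem hy g

theorem ae_degreeAt_facetSum (f : Fin k → StrongDual ℝ X)
    (c : OrientedPolyhedron X (k + 1) →₀ G) : ∀ᵐ y, degreeAt f y (facetSum c) = 0 := by
  induction c using Finsupp.induction_linear with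
  | zero => simp
  | add c d hc hd =>
    filter_upwards [hc, hd] with y hcy hdy
    rw [map_add, map_add, hcy, hdy, add_zero]
  | single S g => exact ae_degreeAt_facetSum_single f S g

end FacetSum

/-! ### Reduction to disjoint sums -/

section Refinement

variable {X G : Type*} [NormedAddCommGroup X] [NormedSpace ℝ X] [NormedAddCommGroup G] {k : ℕ}
  {C D : Set X} {W : Submodule ℝ X} {H t : Finset (StrongDual ℝ X × ℝ)} {p : StrongDual ℝ X × ℝ}

open OrientedPolyhedron

theorem weight_single (S : OrientedPolyhedron X k) (g : G) :
    weight (Finsupp.single S g) = ‖g‖ₑ * area k S.carrier := by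
  rw [weight, Finsupp.sum_single_index (by simp)]

theorem weight_zero : weight (0 : OrientedPolyhedron X k →₀ G) = 0 :=
  Finsupp.sum_zero_index

theorem weight_add_le (c d : OrientedPolyhedron X k →₀ G) :
    weight (c + d) ≤ weight c + weight d := by
  classical
  have hsum : ∀ e : OrientedPolyhedron X k →₀ G, e.support ⊆ c.support ∪ d.support →
      weight e = ∑ S ∈ c.support ∪ d.support, ‖e S‖ₑ * area k S.carrier := fun e he =>
    Finsupp.sum_of_support_subset e he _ (by simp)
  rw [hsum _ Finsupp.support_add, hsum c Finset.subset_union_left,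
    hsum d Finset.subset_union_right, ← Finset.sum_add_distrib]
  refine Finset.sum_le_sum fun S _ => ?_
  rw [← add_mul]
  exact mul_le_mul_left (enorm_add_le _ _) _

theorem weight_sum_le {ι : Type*} (s : Finset ι) (c : ι → OrientedPolyhedron X k →₀ G) :
    weight (∑ i ∈ s, c i) ≤ ∑ i ∈ s, weight (c i) :=
  Finset.le_sum_of_subadditive (M := OrientedPolyhedron X k →₀ G) weight weight_zero.le
    weight_add_le s c

theorem weight_neg (c : OrientedPolyhedron X k →₀ G) : weight (-c) = weight c := by
  simp [weight, Finsupp.sum]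

theorem weight_ne_top (c : OrientedPolyhedron X k →₀ G) : weight c ≠ ⊤ :=
  ENNReal.sum_ne_top.2 fun S _ => ENNReal.mul_ne_top enorm_ne_top
    (area_ne_top S.isPolyhedron.bounded)

/-- `d` represents the same polyhedral chain as `c` and is not heavier. -/
structure IsReduction (d c : OrientedPolyhedron X k →₀ G) : Prop where
  toChain_eq : toChain d = toChain c
  weight_le : weight d ≤ weight c

theorem IsReduction.trans {c d e : OrientedPolyhedron X k →₀ G} (hed : IsReduction e d)
    (hdc : IsReduction d c) : IsReduction e c :=
  ⟨hed.toChain_eq.trans hdc.toChain_eq, hed.weight_le.trans hdc.weight_le⟩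

theorem exists_isReduction_of_forall_single {c : OrientedPolyhedron X k →₀ G}
    {q : OrientedPolyhedron X k → Prop}
    (h : ∀ S ∈ c.support, ∃ d, IsReduction d (Finsupp.single S (c S)) ∧ ∀ T ∈ d.support, q T) :
    ∃ d, IsReduction d c ∧ ∀ T ∈ d.support, q T := by
  classical
  choose! d hd hq using h
  refine ⟨∑ S ∈ c.support, d S, ⟨?_, ?_⟩, fun T hT => ?_⟩
  · conv_rhs => rw [← Finsupp.sum_single c, Finsupp.sum, map_sum]
    rw [map_sum]
    exact Finset.sum_congr rfl fun S hS => (hd S hS).toChain_eq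
  · refine (weight_sum_le _ _).trans (Finset.sum_le_sum fun S hS => ?_)
    exact (hd S hS).weight_le.trans_eq (weight_single S _)
  · obtain ⟨S, hS, hTS⟩ := Finset.mem_biUnion.1 (Finsupp.support_finsetSum hT)
    exact hq S hS T hTS

theorem exists_finset_mem_iff_forall_eq_zero (V W : Submodule ℝ X) [FiniteDimensional ℝ W] :
    ∃ t : Finset (StrongDual ℝ X), ∀ w ∈ W, w ∈ V ↔ ∀ f ∈ t, f w = 0 := by
  classical
  let N := V.comap W.subtype
  let b := Module.finBasis ℝ (W ⧸ N)
  have hext : ∀ i, ∃ f : StrongDual ℝ X, ∀ w : W, f w = b.coord i (N.mkQ w) := fun i =>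
    (exists_extension_norm_eq W (b.coord i ∘ₗ N.mkQ).toContinuousLinearMap).imp fun _ hf => hf.1
  choose f hf using hext
  refine ⟨Finset.univ.image f, fun w hw => ?_⟩
  have hcoord : N.mkQ ⟨w, hw⟩ = 0 ↔ ∀ i, f i w = 0 := by
    rw [← b.forall_coord_eq_zero_iff]
    exact forall_congr' fun i => by rw [← hf i ⟨w, hw⟩]
  simpa [N] using hcoord

theorem IsPolyhedron.exists_halfSpaces (hC : IsPolyhedron k C) [FiniteDimensional ℝ W]
    (hCW : C ⊆ W) :
    ∃ s : Finset (StrongDual ℝ X × ℝ), C = {x | x ∈ W ∧ ∀ p ∈ s, p.1 x ≤ p.2} := by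
  classical
  obtain ⟨s, hs⟩ := hC.halfSpaces
  obtain ⟨x₀, hx₀⟩ := hC.nonempty
  obtain ⟨t, ht⟩ := exists_finset_mem_iff_forall_eq_zero (vectorSpan ℝ C) W
  have hspan : ∀ x ∈ W, x ∈ affineSpan ℝ C ↔ ∀ f ∈ t, f x = f x₀ := by
    intro x hx
    rw [← AffineSubspace.vsub_right_mem_direction_iff_mem (subset_affineSpan ℝ C hx₀),
      direction_affineSpan, vsub_eq_sub, ht _ (W.sub_mem hx (hCW hx₀))]
    simp only [map_sub, sub_eq_zero]
  refine ⟨s ∪ (t.image (fun f => (f, f x₀)) ∪ t.image fun f => (-f, -f x₀)), ?_⟩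
  ext x
  simp only [mem_ofPred_eq, Finset.mem_union, or_imp, forall_and, Finset.forall_mem_image,
    neg_apply, neg_le_neg_iff]
  refine ⟨fun hx => ?_, fun ⟨hxW, hxs, hle, hge⟩ => hs.superset
    ⟨(hspan x hxW).2 fun f hf => le_antisymm (hle hf) (hge hf), hxs⟩⟩
  have hfx := (hspan x (hCW hx)).1 (subset_affineSpan ℝ C hx)
  exact ⟨hCW hx, (hs.subset hx).2, fun f hf => (hfx f hf).le, fun f hf => (hfx f hf).ge⟩

theorem IsPolyhedron.exists_finiteDimensional_superset (hC : IsPolyhedron k C) :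
    ∃ W : Submodule ℝ X, FiniteDimensional ℝ W ∧ C ⊆ W := by
  obtain ⟨x₀, hx₀⟩ := hC.nonempty
  have := hC.finiteDimensional
  refine ⟨vectorSpan ℝ C ⊔ ℝ ∙ x₀, inferInstance, fun x hx => ?_⟩
  have hmem := Submodule.add_mem_sup (vsub_mem_vectorSpan ℝ hx hx₀)
    (Submodule.mem_span_singleton_self (R := ℝ) x₀)
  simpa using hmem

/-- `C` is the set of the points of `W` that lie in all half-spaces `{p.1 ≤ p.2}` of a subfamily
of `H`. A common `W` and `H` for the polyhedra of a formal sum make the polyhedra comparable. -/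
def IsCutOut (W : Submodule ℝ X) (H : Finset (StrongDual ℝ X × ℝ)) (C : Set X) : Prop :=
  ∃ s ⊆ H, C = {x | x ∈ W ∧ ∀ p ∈ s, p.1 x ≤ p.2}

/-- `C` lies on one side of the hyperplane `{p.1 = p.2}`, so that cutting along it leaves `C`
whole. -/
def IsOnOneSide (p : StrongDual ℝ X × ℝ) (C : Set X) : Prop :=
  (∀ x ∈ C, p.1 x ≤ p.2) ∨ ∀ x ∈ C, p.2 ≤ p.1 x

theorem IsOnOneSide.mono (h : IsOnOneSide p C) (hDC : D ⊆ C) : IsOnOneSide p D :=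
  h.imp (fun h x hx => h x (hDC hx)) fun h x hx => h x (hDC hx)

theorem IsCutOut.sep (h : IsCutOut W H C) (hp : p ∈ H) :
    IsCutOut W H {x ∈ C | p.1 x ≤ p.2} := by
  classical
  obtain ⟨s, hs, rfl⟩ := h
  refine ⟨insert p s, Finset.insert_subset hp hs, ?_⟩
  ext x
  simp only [mem_ofPred_eq, Finset.mem_insert, forall_eq_or_imp]
  tauto

theorem IsCutOut.subset_of_mem_intrinsicInterior (hC : IsCutOut W H C) (hD : IsCutOut W H D)
    (hside : ∀ p ∈ H, IsOnOneSide p D) {x : X} (hxC : x ∈ C) (hxD : x ∈ intrinsicInterior ℝ D) :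
    D ⊆ C := by
  obtain ⟨s, hs, rfl⟩ := hC
  have hDW : ∀ z ∈ D, z ∈ W := by
    obtain ⟨s', -, rfl⟩ := hD
    exact fun z hz => hz.1
  refine fun z hz => ⟨hDW z hz, fun p hp => ?_⟩
  rcases hside p (hs hp) with hle | hge
  · exact hle z hz
  · obtain ⟨ε, hε, hmem⟩ := exists_extend_mem hxD hz
    have hbeyond := hge _ hmem
    have hx := hxC.2 p hp
    simp only [map_add, map_smul, map_sub, smul_eq_mul] at hbeyond
    nlinarith

theorem OrientedPolyhedron.exists_isSubdivision (S : OrientedPolyhedron X k)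
    {f : StrongDual ℝ X} {r : ℝ} (hlt : ∃ a ∈ S.carrier, f a < r)
    (hgt : ∃ b ∈ S.carrier, r < f b) :
    ∃ S₁ S₂, S.IsSubdivision S₁ S₂ ∧ S₁.carrier = {x ∈ S.carrier | f x ≤ r} ∧
      S₂.carrier = {x ∈ S.carrier | r ≤ f x} := by
  let S₁ := S.below f r hlt
  let S₂ := S.below (-f) (-r) (by simpa using hgt)
  have hS₁ : S₁.carrier = {x ∈ S.carrier | f x ≤ r} := rfl
  have hS₂ : S₂.carrier = {x ∈ S.carrier | r ≤ f x} := by simp [S₂, below]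
  refine ⟨S₁, S₂, ⟨?_, ?_, rfl, rfl⟩, hS₁, hS₂⟩
  · rw [hS₁, hS₂, ← sep_or]
    simp [le_total]
  · obtain ⟨a, ha, har⟩ := hlt
    rw [hS₁, hS₂]
    exact disjoint_intrinsicInterior_cut ha har

theorem exists_isReduction_single_isOnOneSide (hp : p ∈ H) (hp' : -p ∈ H)
    {S : OrientedPolyhedron X k} (hS : IsCutOut W H S.carrier)
    (ht : ∀ q ∈ t, IsOnOneSide q S.carrier) (g : G) :
    ∃ d, IsReduction d (Finsupp.single S g) ∧ ∀ T ∈ d.support,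
      IsCutOut W H T.carrier ∧ IsOnOneSide p T.carrier ∧ ∀ q ∈ t, IsOnOneSide q T.carrier := by
  classical
  by_cases hside : IsOnOneSide p S.carrier
  · refine ⟨Finsupp.single S g, ⟨rfl, le_rfl⟩, fun T hT => ?_⟩
    rw [Finset.mem_singleton.1 (Finsupp.support_single_subset hT)]
    exact ⟨hS, hside, ht⟩
  simp only [IsOnOneSide, not_or, not_forall, not_le, exists_prop] at hside
  obtain ⟨hgt, hlt⟩ := hside
  obtain ⟨S₁, S₂, hsub, hS₁, hS₂⟩ := S.exists_isSubdivision hlt hgt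
  refine ⟨Finsupp.single S₁ g + Finsupp.single S₂ g, ⟨?_, ?_⟩, fun T hT => ?_⟩
  · rw [map_add]
    exact (simple_subdivision hsub g).symm
  · refine (weight_add_le _ _).trans_eq ?_
    obtain ⟨b, hb, hbp⟩ := hgt
    obtain ⟨a, ha, hap⟩ := hlt
    rw [weight_single, weight_single, weight_single, ← mul_add, hS₁, hS₂,
      S.isPolyhedron.area_cut ha hap hb hbp]
  · have ht' : ∀ T : OrientedPolyhedron X k, T.carrier ⊆ S.carrier →
        ∀ q ∈ t, IsOnOneSide q T.carrier := fun T hTS q hq => (ht q hq).mono hTS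
    rcases Finset.mem_union.1 (Finsupp.support_add hT) with hT | hT <;>
      rw [Finset.mem_singleton.1 (Finsupp.support_single_subset hT)]
    · exact ⟨hS₁ ▸ hS.sep hp, Or.inl fun x hx => (hS₁.subset hx).2,
        ht' _ (hS₁.subset.trans (sep_subset _ _))⟩
    · refine ⟨?_, Or.inr fun x hx => (hS₂.subset hx).2, ht' _ (hS₂.subset.trans (sep_subset _ _))⟩
      simpa [hS₂] using hS.sep hp'

theorem exists_isReduction_isOnOneSide (hH : ∀ p ∈ H, -p ∈ H) {c : OrientedPolyhedron X k →₀ G}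
    (hc : ∀ S ∈ c.support, IsCutOut W H S.carrier) (ht : t ⊆ H) :
    ∃ d, IsReduction d c ∧
      ∀ T ∈ d.support, IsCutOut W H T.carrier ∧ ∀ q ∈ t, IsOnOneSide q T.carrier := by
  classical
  induction t using Finset.induction_on with
  | empty => exact ⟨c, ⟨rfl, le_rfl⟩, fun T hT => ⟨hc T hT, by simp⟩⟩
  | insert p t _ ih =>
    obtain ⟨hp, ht⟩ := Finset.insert_subset_iff.1 ht
    obtain ⟨d, hdc, hd⟩ := ih ht
    obtain ⟨e, hed, he⟩ := exists_isReduction_of_forall_single fun S hS =>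
      exists_isReduction_single_isOnOneSide hp (hH p hp) (hd S hS).1 (hd S hS).2 (d S)
    refine ⟨e, hed.trans hdc, fun T hT => ⟨(he T hT).1, ?_⟩⟩
    exact (Finset.forall_mem_insert _ _ _).2 (he T hT).2

theorem exists_isReduction_single_of_carrier_eq {S T : OrientedPolyhedron X k}
    (h : T.carrier = S.carrier) (g : G) :
    ∃ g', IsReduction (Finsupp.single T g') (Finsupp.single S g) := by
  by_cases ho : S.orientation = T.orientation
  · exact ⟨g, by rw [OrientedPolyhedron.ext h ho.symm]; exact ⟨rfl, le_rfl⟩⟩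
  · refine ⟨-g, ?_, ?_⟩
    · have hopp := simple_opposite (P := S) (P' := T) ⟨h.symm, ho⟩ g
      exact (map_neg (simple T) g).trans (eq_neg_of_add_eq_zero_left hopp).symm
    · rw [weight_single, weight_single, h, enorm_neg]

/- Polyhedra with the same carrier are merged by replacing each of them by one representative of
its carrier. -/
theorem exists_isDisjointSum_of_disjoint {c : OrientedPolyhedron X k →₀ G}
    (hc : ∀ S ∈ c.support, ∀ T ∈ c.support, S.carrier ≠ T.carrier →
      Disjoint (intrinsicInterior ℝ S.carrier) (intrinsicInterior ℝ T.carrier)) :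
    ∃ d, IsDisjointSum d ∧ IsReduction d c := by
  let rep (S : OrientedPolyhedron X k) : OrientedPolyhedron X k :=
    rangeSplitting OrientedPolyhedron.carrier ⟨S.carrier, S, rfl⟩
  have hrep : ∀ S, (rep S).carrier = S.carrier := fun S => apply_rangeSplitting _ _
  have hrep_congr : ∀ {S T : OrientedPolyhedron X k}, S.carrier = T.carrier → rep S = rep T :=
    fun h => by simp only [rep, h]
  obtain ⟨d, hdc, hd⟩ := exists_isReduction_of_forall_single (c := c)
    (q := fun T => ∃ S ∈ c.support, T = rep S) fun S hS => by
      obtain ⟨g, hg⟩ := exists_isReduction_single_of_carrier_eq (hrep S) (c S)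
      refine ⟨_, hg, fun T hT => ⟨S, hS, ?_⟩⟩
      exact Finset.mem_singleton.1 (Finsupp.support_single_subset hT)
  refine ⟨d, fun P hP Q hQ hne => ?_, hdc⟩
  obtain ⟨S, hS, rfl⟩ := hd P hP
  obtain ⟨T, hT, rfl⟩ := hd Q hQ
  rw [hrep, hrep]
  exact hc S hS T hT fun h => hne (hrep_congr h)

theorem exists_isCutOut (c : OrientedPolyhedron X k →₀ G) :
    ∃ (W : Submodule ℝ X) (H : Finset (StrongDual ℝ X × ℝ)), (∀ p ∈ H, -p ∈ H) ∧
      ∀ S ∈ c.support, IsCutOut W H S.carrier := by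
  classical
  choose U hU hSU using fun S : OrientedPolyhedron X k =>
    S.isPolyhedron.exists_finiteDimensional_superset
  have hW : FiniteDimensional ℝ ↥(c.support.sup U) := Submodule.finiteDimensional_finset_sup _ _
  have hcut : ∀ S ∈ c.support, ∃ s : Finset (StrongDual ℝ X × ℝ),
      S.carrier = {x | x ∈ c.support.sup U ∧ ∀ p ∈ s, p.1 x ≤ p.2} := fun S hS =>
    S.isPolyhedron.exists_halfSpaces ((hSU S).trans (Finset.le_sup (f := U) hS))
  choose! s hs using hcut
  refine ⟨c.support.sup U, c.support.biUnion s ∪ (c.support.biUnion s).image Neg.neg,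
    fun p hp => ?_, fun S hS => ⟨s S, ?_, hs S hS⟩⟩
  · rcases Finset.mem_union.1 hp with hp | hp
    · exact Finset.mem_union_right _ (Finset.mem_image_of_mem _ hp)
    · obtain ⟨q, hq, rfl⟩ := Finset.mem_image.1 hp
      exact Finset.mem_union_left _ (by rwa [neg_neg])
  · exact (Finset.subset_biUnion_of_mem s hS).trans Finset.subset_union_left

/- After cutting along all the hyperplanes that bound the polyhedra of `c`, two pieces with a
common interior point satisfy the same inequalities, so they coincide. -/
theorem exists_isDisjointSum_isReduction (c : OrientedPolyhedron X k →₀ G) :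
    ∃ d, IsDisjointSum d ∧ IsReduction d c := by
  obtain ⟨W, H, hH, hc⟩ := exists_isCutOut c
  obtain ⟨d, hdc, hd⟩ := exists_isReduction_isOnOneSide hH hc subset_rfl
  have hsubset : ∀ S ∈ d.support, ∀ T ∈ d.support, ∀ x ∈ intrinsicInterior ℝ S.carrier,
      x ∈ intrinsicInterior ℝ T.carrier → T.carrier ⊆ S.carrier := fun S hS T hT x hxS hxT =>
    (hd S hS).1.subset_of_mem_intrinsicInterior (hd T hT).1 (hd T hT).2
      (intrinsicInterior_subset hxS) hxT
  obtain ⟨e, he, hed⟩ := exists_isDisjointSum_of_disjoint (c := d) fun S hS T hT hne =>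
    disjoint_left.2 fun x hxS hxT =>
      hne ((hsubset T hT S hS x hxT hxS).antisymm (hsubset S hS T hT x hxS hxT))
  exact ⟨e, he, hed.trans hdc⟩

end Refinement

/-! ### Slices and mass -/

section Slices

variable {X G : Type*} [NormedAddCommGroup X] [NormedSpace ℝ X] [NormedAddCommGroup G] {k : ℕ}
  {f : StrongDual ℝ X} {r : ℝ}

open OrientedPolyhedron

theorem restrict_simple (f : StrongDual ℝ X) (r : ℝ) (S : OrientedPolyhedron X k) (g : G) :
    restrict f r (simple S g) = simpleRestrict f r S g := liftChain_simple _ _ _ S g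

theorem restrict_simple_of_forall_le {S : OrientedPolyhedron X k} (h : ∀ x ∈ S.carrier, r ≤ f x)
    (g : G) : restrict f r (simple S g) = 0 := by
  rw [restrict_simple, simpleRestrict, dif_neg (by simpa using h), AddMonoidHom.zero_apply]

theorem restrict_simple_of_exists_lt {S : OrientedPolyhedron X k} (h : ∃ a ∈ S.carrier, f a < r)
    (g : G) : restrict f r (simple S g) = simple (S.below f r h) g := by
  rw [restrict_simple, simpleRestrict, dif_pos h]

theorem restrict_simple_of_forall_lt {S : OrientedPolyhedron X k} (h : ∀ x ∈ S.carrier, f x < r)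
    (g : G) : restrict f r (simple S g) = simple S g := by
  obtain ⟨a, ha⟩ := S.isPolyhedron.nonempty
  rw [restrict_simple_of_exists_lt ⟨a, ha, h a ha⟩]
  congr 2
  exact OrientedPolyhedron.ext (sep_eq_self_iff_mem_true.2 fun x hx => (h x hx).le) rfl

open Classical in
theorem restrict_simpleOf (f : StrongDual ℝ X) (r : ℝ) (S : OrientedPolyhedron X k) (g : G) :
    restrict f r (simpleOf S.carrier S.orientation g) =
      (if ∃ x ∈ S.carrier, f x < r then simpleOf {x ∈ S.carrier | f x ≤ r} S.orientation
        else 0 : G →+ PolyChain X G k) g := by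
  rw [simpleOf_eq]
  split_ifs with h
  · rw [restrict_simple_of_exists_lt h, ← simpleOf_eq]
    rfl
  · rw [restrict_simple_of_forall_le (by simpa using h), AddMonoidHom.zero_apply]

theorem boundary_simple_eq_sum (S : OrientedPolyhedron X (k + 1)) (g : G) :
    boundary (simple S g) = ∑ F ∈ S.facets_finite.toFinset, (simple F g : PolyChain X G k) := by
  rw [boundary_simple, simpleBoundary, AddMonoidHom.finsetSum_apply]

theorem slice_simple_of_forall_le {S : OrientedPolyhedron X (k + 1)}
    (h : ∀ x ∈ S.carrier, r ≤ f x) (g : G) : slice f r (simple S g) = 0 := by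
  rw [slice, restrict_simple_of_forall_le h, map_zero, boundary_simple_eq_sum, map_sum, zero_sub,
    neg_eq_zero]
  refine Finset.sum_eq_zero fun F hF => restrict_simple_of_forall_le (fun x hx => h x ?_) g
  exact (S.facets_finite.mem_toFinset.1 hF).1.subset hx

theorem slice_simple_of_forall_lt {S : OrientedPolyhedron X (k + 1)}
    (h : ∀ x ∈ S.carrier, f x < r) (g : G) : slice f r (simple S g) = 0 := by
  rw [slice, restrict_simple_of_forall_lt h, boundary_simple_eq_sum, map_sum, sub_eq_zero]
  refine Finset.sum_congr rfl fun F hF => (restrict_simple_of_forall_lt (fun x hx => h x ?_) g).symm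
  exact (S.facets_finite.mem_toFinset.1 hF).1.subset hx

theorem exists_slice_simple {S : OrientedPolyhedron X (k + 1)} {a b : X} (ha : a ∈ S.carrier)
    (har : f a < r) (hb : b ∈ S.carrier) (hbr : r < f b) (g : G) :
    ∃ T : OrientedPolyhedron X k, T.carrier = {x ∈ S.carrier | f x = r} ∧
      slice f r (simple S g) = simple T g := by
  have hS := S.isPolyhedron
  have hlt : ∃ a ∈ S.carrier, f a < r := ⟨a, ha, har⟩
  obtain ⟨T, hT, hTS⟩ := (S.below f r hlt).carrier_image_facets.superset
    ((isFacet_cut_iff hS ha har hb hbr _).2 (Or.inl rfl))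
  refine ⟨T, hTS, ?_⟩
  rw [slice, restrict_simple_of_exists_lt hlt, boundary_simple,
    simpleBoundary_cut S (S.below f r hlt) ha har hb hbr rfl rfl, ← hTS, ← hT.2, simpleOf_eq,
    boundary_simple, simpleBoundary_eq S]
  simp only [AddMonoidHom.add_apply, AddMonoidHom.finsetSum_apply, map_sum]
  rw [add_sub_assoc, add_eq_left, sub_eq_zero]
  refine Finset.sum_congr rfl fun F hF => ?_
  obtain ⟨F, hFS, rfl⟩ :=
    S.carrier_image_facets.superset ((IsFacet.finite hS).mem_toFinset.1 hF)
  rw [← hFS.2, restrict_simpleOf]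

theorem ae_slice_simple (f : StrongDual ℝ X) (S : OrientedPolyhedron X (k + 1)) (g : G) :
    ∀ᵐ r : ℝ, ({x ∈ S.carrier | f x = r} = ∅ ∧ slice f r (simple S g) = 0) ∨
      ∃ T : OrientedPolyhedron X k, T.carrier = {x ∈ S.carrier | f x = r} ∧
        slice f r (simple S g) = simple T g := by
  have hmin : ({r | r ∈ f '' S.carrier ∧ ∀ x ∈ S.carrier, r ≤ f x} : Set ℝ).Subsingleton := by
    rintro _ ⟨⟨x, hx, rfl⟩, hxmin⟩ _ ⟨⟨y, hy, rfl⟩, hymin⟩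
    exact le_antisymm (hxmin y hy) (hymin x hx)
  have hmax : ({r | r ∈ f '' S.carrier ∧ ∀ x ∈ S.carrier, f x ≤ r} : Set ℝ).Subsingleton := by
    rintro _ ⟨⟨x, hx, rfl⟩, hxmax⟩ _ ⟨⟨y, hy, rfl⟩, hymax⟩
    exact le_antisymm (hymax x hx) (hxmax y hy)
  filter_upwards [measure_eq_zero_iff_ae_notMem.1 (hmin.measure_zero volume),
    measure_eq_zero_iff_ae_notMem.1 (hmax.measure_zero volume)] with r hrmin hrmax
  have hempty (h : r ∉ f '' S.carrier) : {x ∈ S.carrier | f x = r} = ∅ :=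
    eq_empty_of_forall_notMem fun x hx => h ⟨x, hx⟩
  by_cases hlt : ∃ a ∈ S.carrier, f a < r
  · by_cases hgt : ∃ b ∈ S.carrier, r < f b
    · obtain ⟨a, ha, har⟩ := hlt
      obtain ⟨b, hb, hbr⟩ := hgt
      exact Or.inr (exists_slice_simple ha har hb hbr g)
    · push Not at hgt
      have hr : r ∉ f '' S.carrier := fun hr => hrmax ⟨hr, hgt⟩
      exact Or.inl ⟨hempty hr, slice_simple_of_forall_lt (fun x hx =>
        (hgt x hx).lt_of_ne fun hxr => hr ⟨x, hx, hxr⟩) g⟩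
  · push Not at hlt
    exact Or.inl ⟨hempty fun hr => hrmin ⟨hr, hlt⟩, slice_simple_of_forall_le hlt g⟩

theorem slice_sum {ι : Type*} (f : StrongDual ℝ X) (r : ℝ) (s : Finset ι)
    (P : ι → PolyChain X G (k + 1)) : slice f r (∑ i ∈ s, P i) = ∑ i ∈ s, slice f r (P i) := by
  simp only [slice, map_sum, Finset.sum_sub_distrib]

end Slices

section Mass

variable {X G : Type*} [NormedAddCommGroup X] [NormedSpace ℝ X] [NormedAddCommGroup G] {k : ℕ}

open OrientedPolyhedron

theorem toChain_eq_sum (c : OrientedPolyhedron X k →₀ G) :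
    (toChain c : PolyChain X G k) = ∑ S ∈ c.support, simple S (c S) := by
  conv_lhs => rw [← Finsupp.sum_single c, Finsupp.sum, map_sum]
  rfl

theorem enorm_orientSign_smul {f : Fin k → StrongDual ℝ X} {V : Submodule ℝ X}
    (hV : V.map (coords f : X →ₗ[ℝ] (Fin k → ℝ)) = ⊤) (o : Set (Fin k → X)) (g : G) :
    ‖orientSign f V o • g‖ₑ = ‖g‖ₑ := by
  have hbasis : ∀ i : Fin k, ∃ v ∈ V, coords f v = Pi.single i 1 := fun i =>
    hV.ge (Submodule.mem_top (x := Pi.single i 1))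
  choose v hvV hv using hbasis
  have hform : coordForm f v = 1 := by
    rw [← Matrix.det_one (n := Fin k)]
    change Matrix.det (Matrix.of fun i => coords f (v i)) = _
    congr 1
    ext i j
    simp [hv, Matrix.one_apply, Pi.single_apply, eq_comm]
  unfold orientSign
  split_ifs with hpos hneg
  · simp
  · simp
  · exact absurd ⟨v, hvV, by simp [hform]⟩ hneg

theorem lintegral_enorm_degreeAt_single (f : Fin k → StrongDual ℝ X) (S : OrientedPolyhedron X k)
    (g : G) : ∫⁻ y, ‖degreeAt f y (Finsupp.single S g)‖ₑ =
      ‖g‖ₑ * volume (coords f '' S.carrier) := by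
  classical
  by_cases hf : (vectorSpan ℝ S.carrier).map (coords f : X →ₗ[ℝ] (Fin k → ℝ)) = ⊤
  · rw [← lintegral_indicator_const (S.isPolyhedron.measurableSet_image_coords f)]
    refine lintegral_congr fun y => ?_
    rw [degreeAt_single, indicator_apply]
    split_ifs
    · exact enorm_orientSign_smul hf _ g
    · exact enorm_zero
  · have := S.isPolyhedron.finiteDimensional
    have hnull : volume (coords f '' S.carrier) = 0 :=
      addHaar_image_eq_zero_of_map_vectorSpan_ne_top volume hf
    rw [hnull, mul_zero]
    refine lintegral_eq_zero_of_ae_eq_zero ?_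
    filter_upwards [measure_eq_zero_iff_ae_notMem.1 hnull] with y hy
    simp [degreeAt_single_of_notMem hy]

/- Almost everywhere, the degree of `c` is the degree of `g[S]`. -/
theorem enorm_mul_area_le_weight {S : OrientedPolyhedron X k} {g : G}
    {c : OrientedPolyhedron X k →₀ G} (hc : toChain c = simple S g) :
    ‖g‖ₑ * area k S.carrier ≤ weight c := by
  simp_rw [area, ENNReal.mul_iSup]
  refine iSup₂_le fun f hf => ?_
  calc ‖g‖ₑ * volume (coords f '' S.carrier)
      = ∫⁻ y, ‖degreeAt f y (Finsupp.single S g)‖ₑ := (lintegral_enorm_degreeAt_single f S g).symm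
    _ = ∫⁻ y, ‖degreeAt f y c‖ₑ := lintegral_congr_ae <|
        (ae_degreeAt_eq_of_toChain_eq f (hc.trans (toChain_single S g).symm)).mono fun y hy => by
          simp only [hy]
    _ ≤ weight c := lintegral_enorm_degreeAt_le hf c

/-- The infimum of the weights of the formal sums that represent a chain. It is another expression
for the mass, in which the formal sums need not be disjoint. -/
def leastWeight (P : PolyChain X G k) : ℝ≥0∞ :=
  ⨅ (c : OrientedPolyhedron X k →₀ G) (_ : toChain c = P), weight c

theorem leastWeight_toChain_le (c : OrientedPolyhedron X k →₀ G) :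
    leastWeight (toChain c) ≤ weight c :=
  iInf₂_le (f := fun (d : OrientedPolyhedron X k →₀ G)
    (_ : (toChain d : PolyChain X G k) = toChain c) => weight d) c rfl

theorem leastWeight_zero : leastWeight (0 : PolyChain X G k) = 0 := by
  rw [← nonpos_iff_eq_zero, ← map_zero toChain]
  exact (leastWeight_toChain_le 0).trans_eq weight_zero

theorem leastWeight_simple (S : OrientedPolyhedron X k) (g : G) :
    leastWeight (simple S g) = ‖g‖ₑ * area k S.carrier := by
  refine le_antisymm ?_ (le_iInf₂ fun c hc => enorm_mul_area_le_weight hc)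
  rw [← weight_single]
  exact leastWeight_toChain_le _

theorem leastWeight_eq_iInf_isDisjointSum (P : PolyChain X G k) :
    leastWeight P =
      ⨅ (c : OrientedPolyhedron X k →₀ G) (_ : IsDisjointSum c ∧ toChain c = P), weight c := by
  refine le_antisymm (le_iInf₂ fun c hc => iInf₂_le c hc.2) (le_iInf₂ fun c hc => ?_)
  obtain ⟨d, hd, hdc⟩ := exists_isDisjointSum_isReduction c
  exact iInf₂_le_of_le d ⟨hd, hdc.toChain_eq.trans hc⟩ hdc.weight_le

theorem ae_leastWeight_slice_simple (f : StrongDual ℝ X) (S : OrientedPolyhedron X (k + 1))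
    (g : G) :
    ∀ᵐ r : ℝ, leastWeight (slice f r (simple S g)) = ‖g‖ₑ * area k {x ∈ S.carrier | f x = r} := by
  filter_upwards [ae_slice_simple f S g] with r hr
  obtain ⟨hempty, hslice⟩ | ⟨T, hT, hslice⟩ := hr
  · rw [hslice, hempty, leastWeight_zero, area_empty, mul_zero]
  · rw [hslice, leastWeight_simple, hT]

theorem mass_eq_leastWeight (P : PolyChain X G k) : mass k P = leastWeight P := by
  rw [leastWeight_eq_iInf_isDisjointSum]
  induction k with
  | zero =>
    refine iInf_congr fun c => iInf_congr fun _ => Finset.sum_congr rfl fun S _ => ?_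
    simp only [area_zero S.isPolyhedron.nonempty, mul_one]
  | succ k ih =>
    refine iInf_congr fun c => iInf_congr fun _ => Finset.sum_congr rfl fun S _ => ?_
    simp only [S.isPolyhedron.area_succ, ENNReal.mul_iSup]
    refine iSup_congr fun f => iSup_congr fun _ => ?_
    simp only [ih, ← leastWeight_eq_iInf_isDisjointSum]
    rw [lintegral_congr_ae (ae_leastWeight_slice_simple f S (c S)),
      lintegral_const_mul'' _ (S.isPolyhedron.aemeasurable_area_section f)]

theorem mass_toChain_le (c : OrientedPolyhedron X k →₀ G) : mass k (toChain c) ≤ weight c :=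
  (mass_eq_leastWeight _).trans_le (leastWeight_toChain_le c)

theorem mass_simple (S : OrientedPolyhedron X k) (g : G) :
    mass k (simple S g) = ‖g‖ₑ * area k S.carrier :=
  (mass_eq_leastWeight _).trans (leastWeight_simple S g)

theorem mass_zero : mass k (0 : PolyChain X G k) = 0 :=
  (mass_eq_leastWeight _).trans leastWeight_zero

theorem exists_weight_lt {P : PolyChain X G k} {ε : ℝ≥0∞} (h : mass k P < ε) :
    ∃ c : OrientedPolyhedron X k →₀ G, toChain c = P ∧ weight c < ε := by
  simpa only [mass_eq_leastWeight, leastWeight, iInf_lt_iff, exists_prop] using h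

theorem mass_add_le (P Q : PolyChain X G k) : mass k (P + Q) ≤ mass k P + mass k Q := by
  simp only [mass_eq_leastWeight P, mass_eq_leastWeight Q]
  refine ENNReal.le_iInf₂_add_iInf₂ fun c hc d hd => ?_
  rw [← hc, ← hd, ← map_add]
  exact (mass_toChain_le _).trans (weight_add_le c d)

theorem mass_sum_le {ι : Type*} (s : Finset ι) (P : ι → PolyChain X G k) :
    mass k (∑ i ∈ s, P i) ≤ ∑ i ∈ s, mass k (P i) :=
  Finset.le_sum_of_subadditive (M := PolyChain X G k) (mass k) mass_zero.le mass_add_le s P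

theorem mass_neg (P : PolyChain X G k) : mass k (-P) = mass k P := by
  have hle : ∀ P : PolyChain X G k, mass k (-P) ≤ mass k P := fun P => by
    rw [mass_eq_leastWeight P]
    refine le_iInf₂ fun c hc => ?_
    rw [← hc, ← map_neg, ← weight_neg c]
    exact mass_toChain_le _
  exact le_antisymm (hle P) (by simpa using hle (-P))

theorem mass_ne_top (P : PolyChain X G k) : mass k P ≠ ⊤ := by
  obtain ⟨c, rfl⟩ := QuotientAddGroup.mk'_surjective _ P
  exact ne_top_of_le_ne_top (weight_ne_top c) (mass_toChain_le c)

theorem mass_restrict_le (f : StrongDual ℝ X) (r : ℝ) (P : PolyChain X G k) :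
    mass k (restrict f r P) ≤ mass k P := by
  rw [mass_eq_leastWeight P]
  refine le_iInf₂ fun c hc => ?_
  rw [← hc, toChain_eq_sum, map_sum]
  refine (mass_sum_le _ _).trans (Finset.sum_le_sum fun S _ => ?_)
  rw [restrict_simple, simpleRestrict]
  split_ifs with h
  · rw [mass_simple]
    exact mul_le_mul_right (area_mono (sep_subset _ _)) _
  · rw [AddMonoidHom.zero_apply, mass_zero]
    exact zero_le

/- Measurability of the mass of the slices is not clear, hence the majorant `ψ`. -/
theorem exists_mass_slice_le {f : StrongDual ℝ X} (hf : ‖f‖ = 1)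
    (c : OrientedPolyhedron X (k + 1) →₀ G) : ∃ ψ : ℝ → ℝ≥0∞, AEMeasurable ψ ∧
      ∫⁻ r, ψ r ≤ weight c ∧ ∀ᵐ r, mass k (slice f r (toChain c)) ≤ ψ r := by
  have hmeas (S : OrientedPolyhedron X (k + 1)) := S.isPolyhedron.aemeasurable_area_section f
  refine ⟨fun r => ∑ S ∈ c.support, ‖c S‖ₑ * area k {x ∈ S.carrier | f x = r}, ?_, ?_, ?_⟩
  · exact Finset.aemeasurable_fun_sum _ fun S _ => (hmeas S).const_mul _
  · rw [lintegral_finsetSum' _ fun S _ => (hmeas S).const_mul _]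
    refine Finset.sum_le_sum fun S _ => ?_
    simp only [lintegral_const_mul'' _ (hmeas S), S.isPolyhedron.area_succ]
    exact mul_le_mul_right (le_iSup₂ (f := fun (f : StrongDual ℝ X) (_ : ‖f‖ = 1) =>
      ∫⁻ r : ℝ, area k {x ∈ S.carrier | f x = r}) f hf) _
  · have hsimple : ∀ᵐ r, ∀ S ∈ (c.support : Set (OrientedPolyhedron X (k + 1))),
        mass k (slice f r (simple S (c S))) = ‖c S‖ₑ * area k {x ∈ S.carrier | f x = r} := by
      simp only [mass_eq_leastWeight]
      exact (ae_ball_iff c.support.countable_toSet).2 fun S _ =>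
        ae_leastWeight_slice_simple f S (c S)
    filter_upwards [hsimple] with r hr
    rw [toChain_eq_sum, slice_sum]
    exact (mass_sum_le _ _).trans (Finset.sum_le_sum fun S hS => (hr S hS).le)

end Mass

/-! ### The flat norm -/

section Intersection

variable {X : Type*} [NormedAddCommGroup X] [NormedSpace ℝ X] {k : ℕ}

theorem IsPolyhedron.inter {C D : Set X} (hC : IsPolyhedron k C) (hD : IsPolyhedron k D)
    (hne : (C ∩ D).Nonempty) (hk : k ≤ Module.finrank ℝ (vectorSpan ℝ (C ∩ D))) :
    IsPolyhedron k (C ∩ D) := by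
  classical
  have := hC.finiteDimensional
  have hle := vectorSpan_mono ℝ (inter_subset_left : C ∩ D ⊆ C)
  obtain ⟨s, hs⟩ := hC.halfSpaces
  obtain ⟨t, ht⟩ := hD.halfSpaces
  refine ⟨hne, hC.bounded.subset inter_subset_left, Submodule.finiteDimensional_of_le hle,
    le_antisymm (hC.finrank_eq ▸ Submodule.finrank_mono hle) hk, s ∪ t, Subset.antisymm ?_ ?_⟩
  · refine fun x hx => ⟨subset_affineSpan ℝ _ hx, fun p hp => ?_⟩
    rcases Finset.mem_union.1 hp with hps | hpt
    · exact (hs.subset hx.1).2 p hps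
    · exact (ht.subset hx.2).2 p hpt
  · rintro x ⟨hx, hp⟩
    exact ⟨hs.superset ⟨affineSpan_mono ℝ inter_subset_left hx,
        fun p hps => hp p (Finset.mem_union_left _ hps)⟩,
      ht.superset ⟨affineSpan_mono ℝ inter_subset_right hx,
        fun p hpt => hp p (Finset.mem_union_right _ hpt)⟩⟩

theorem IsPolyhedron.finrank_vectorSpan_inter_lt {C D : Set X} (hC : IsPolyhedron k C)
    (hD : IsPolyhedron k D) (hne : (C ∩ D).Nonempty)
    (hd : Disjoint (intrinsicInterior ℝ C) (intrinsicInterior ℝ D)) :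
    Module.finrank ℝ (vectorSpan ℝ (C ∩ D)) < k := by
  by_contra! hk
  have hCD := hC.inter hD hne hk
  have := hCD.finiteDimensional
  obtain ⟨x, hx⟩ := intrinsicInterior_nonempty_of_convex hCD.convex hne
  exact disjoint_left.1 hd
    (intrinsicInterior_mono_of_affineSpan_eq inter_subset_left
      (hC.affineSpan_eq hCD inter_subset_left) hx)
    (intrinsicInterior_mono_of_affineSpan_eq inter_subset_right
      (hD.affineSpan_eq hCD inter_subset_right) hx)

theorem IsDisjointSum.exists_mem_forall_notMem {G : Type*} [NormedAddCommGroup G]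
    {c : OrientedPolyhedron X k →₀ G} (hc : IsDisjointSum c) {S : OrientedPolyhedron X k}
    (hS : S ∈ c.support) : ∃ x ∈ S.carrier, ∀ T ∈ c.support, T ≠ S → x ∉ T.carrier := by
  have := S.isPolyhedron.finiteDimensional
  obtain ⟨f, -, hf⟩ := exists_coords_injOn S.isPolyhedron.finrank_eq
  by_contra! hcover
  have hnull : ∀ T ∈ c.support, T ≠ S → volume (coords f '' (S.carrier ∩ T.carrier)) = 0 := by
    intro T hT hTS
    rcases (S.carrier ∩ T.carrier).eq_empty_or_nonempty with hempty | hne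
    · rw [hempty, image_empty, measure_empty]
    · exact S.isPolyhedron.volume_image_coords_eq_zero_of_subset inter_subset_left
        (S.isPolyhedron.finrank_vectorSpan_inter_lt T.isPolyhedron hne (hc hS hT hTS.symm)) f
  have hsub : coords f '' S.carrier ⊆
      ⋃ T ∈ c.support, ⋃ _ : T ≠ S, coords f '' (S.carrier ∩ T.carrier) := by
    rintro _ ⟨x, hx, rfl⟩
    obtain ⟨T, hT, hTS, hxT⟩ := hcover x hx
    simp only [mem_iUnion]
    exact ⟨T, hT, hTS, x, ⟨hx, hxT⟩, rfl⟩
  refine (S.isPolyhedron.volume_image_coords_pos hf).ne' (measure_mono_null hsub ?_)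
  refine (measure_biUnion_null_iff (Finset.countable_toSet _)).2 fun T hT => ?_
  exact measure_iUnion_null (hnull T hT)

end Intersection

section FlatNorm

variable {X G : Type*} [NormedAddCommGroup X] [NormedSpace ℝ X] [NormedAddCommGroup G] {k : ℕ}

open OrientedPolyhedron

theorem flatNorm_le (P : PolyChain X G k) (Q : PolyChain X G (k + 1)) :
    flatNorm P ≤ mass (k + 1) Q + mass k (boundary Q - P) :=
  iInf_le _ Q

theorem flatNorm_le_mass (P : PolyChain X G k) : flatNorm P ≤ mass k P := by
  have h := flatNorm_le P 0
  rwa [mass_zero, map_zero, zero_sub, mass_neg, zero_add] at h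

theorem flatNorm_ne_top (P : PolyChain X G k) : flatNorm P ≠ ⊤ :=
  ne_top_of_le_ne_top (mass_ne_top P) (flatNorm_le_mass P)

theorem flatNorm_zero : flatNorm (0 : PolyChain X G k) = 0 :=
  le_antisymm ((flatNorm_le_mass 0).trans mass_zero.le) zero_le

theorem flatNorm_neg (P : PolyChain X G k) : flatNorm (-P) = flatNorm P := by
  have hle (P : PolyChain X G k) : flatNorm (-P) ≤ flatNorm P := by
    refine le_iInf fun Q => (flatNorm_le (-P) (-Q)).trans_eq ?_
    rw [mass_neg, map_neg, ← neg_sub', mass_neg]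
  exact le_antisymm (hle P) (by simpa only [neg_neg] using hle (-P))

theorem flatNorm_add_le (P Q : PolyChain X G k) :
    flatNorm (P + Q) ≤ flatNorm P + flatNorm Q := by
  refine ENNReal.le_iInf_add_iInf fun R T => (flatNorm_le (P + Q) (R + T)).trans ?_
  rw [map_add, add_sub_add_comm, add_add_add_comm]
  exact add_le_add (mass_add_le _ _) (mass_add_le _ _)

theorem lintegral_enorm_degreeAt_le_flatNorm {f : Fin k → StrongDual ℝ X} (hf : ∀ i, ‖f i‖ = 1)
    (c : OrientedPolyhedron X k →₀ G) : ∫⁻ y, ‖degreeAt f y c‖ₑ ≤ flatNorm (toChain c) := by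
  refine le_iInf fun Q => le_add_of_le_right ?_
  obtain ⟨d, rfl⟩ : ∃ d, toChain d = Q := QuotientAddGroup.mk'_surjective _ Q
  rw [mass_eq_leastWeight]
  refine le_iInf₂ fun b hb => ?_
  rw [← toChain_facetSum, ← map_sub] at hb
  calc ∫⁻ y, ‖degreeAt f y c‖ₑ
      = ∫⁻ y, ‖degreeAt f y b‖ₑ := by
        refine lintegral_congr_ae ?_
        filter_upwards [ae_degreeAt_eq_of_toChain_eq f hb, ae_degreeAt_facetSum f d] with y hby hdy
        rw [hby, map_sub, hdy, zero_sub, enorm_neg]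
    _ ≤ weight b := lintegral_enorm_degreeAt_le hf b

theorem eq_zero_of_flatNorm_simple_eq_zero {S : OrientedPolyhedron X k} {g : G}
    (h : flatNorm (simple S g) = 0) : g = 0 := by
  have := S.isPolyhedron.finiteDimensional
  obtain ⟨f, hf, hinj⟩ := exists_coords_injOn S.isPolyhedron.finrank_eq
  have hdeg := lintegral_enorm_degreeAt_le_flatNorm hf (Finsupp.single S g)
  rw [toChain_single, h, lintegral_enorm_degreeAt_single, nonpos_iff_eq_zero, mul_eq_zero] at hdeg
  exact enorm_eq_zero.1 (hdeg.resolve_right (S.isPolyhedron.volume_image_coords_pos hinj).ne')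

theorem flatNorm_restrict_le (f : StrongDual ℝ X) (r : ℝ) (P : PolyChain X G k)
    (Q : PolyChain X G (k + 1)) : flatNorm (restrict f r P) ≤
      mass (k + 1) Q + (mass k (slice f r Q) + mass k (boundary Q - P)) := by
  have hboundary : boundary (restrict f r Q) - restrict f r P =
      slice f r Q + restrict f r (boundary Q - P) := by
    rw [slice, map_sub]
    abel
  calc flatNorm (restrict f r P)
      ≤ mass (k + 1) (restrict f r Q) + mass k (boundary (restrict f r Q) - restrict f r P) :=
        flatNorm_le _ _
    _ ≤ mass (k + 1) Q + (mass k (slice f r Q) + mass k (boundary Q - P)) := by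
        rw [hboundary]
        gcongr
        · exact mass_restrict_le f r Q
        · exact (mass_add_le _ _).trans (add_le_add_right (mass_restrict_le f r _) _)

theorem exists_weight_lt_of_flatNorm_lt {P : PolyChain X G k} {ε : ℝ≥0∞} (h : flatNorm P < ε) :
    ∃ c : OrientedPolyhedron X (k + 1) →₀ G,
      weight c < ε ∧ mass k (boundary (toChain c) - P) < ε := by
  obtain ⟨Q, hQ⟩ := iInf_lt_iff.1 h
  obtain ⟨c, rfl, hc⟩ := exists_weight_lt (lt_of_le_of_lt le_self_add hQ)
  exact ⟨c, hc, lt_of_le_of_lt le_add_self hQ⟩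

/- Fillings of weight at most `2⁻ⁿ` have slices of summable mass at almost every level. -/
theorem ae_flatNorm_restrict_eq_zero {P : PolyChain X G k} (hP : flatNorm P = 0)
    {f : StrongDual ℝ X} (hf : ‖f‖ = 1) : ∀ᵐ r : ℝ, flatNorm (restrict f r P) = 0 := by
  let ε (n : ℕ) : ℝ≥0∞ := 2⁻¹ ^ n
  have hε_sum : ∑' n, ε n ≠ ⊤ := by
    simp only [ε, ENNReal.tsum_geometric, ENNReal.one_sub_inv_two, inv_inv, ne_eq,
      ENNReal.ofNat_ne_top, not_false_eq_true]
  have hε_pos (n : ℕ) : flatNorm P < ε n :=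
    hP ▸ ENNReal.pow_pos (ENNReal.inv_pos.2 ENNReal.ofNat_ne_top) n
  choose d hd_weight hd_mass using fun n => exists_weight_lt_of_flatNorm_lt (hε_pos n)
  choose ψ hψ_meas hψ_le hψ using fun n => exists_mass_slice_le hf (d n)
  have hψ_sum : ∀ᵐ r, ∑' n, ψ n r < ⊤ := by
    refine ae_lt_top' (AEMeasurable.tsum hψ_meas) ?_
    rw [lintegral_tsum hψ_meas]
    exact ne_top_of_le_ne_top hε_sum
      (ENNReal.tsum_le_tsum fun n => (hψ_le n).trans (hd_weight n).le)
  filter_upwards [hψ_sum, ae_all_iff.2 hψ] with r hψr_sum hψr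
  have hlim : Filter.Tendsto (fun n => ε n + (ψ n r + ε n)) Filter.atTop (nhds 0) := by
    have hε_lim := ENNReal.tendsto_atTop_zero_of_tsum_ne_top hε_sum
    have hψ_lim := ENNReal.tendsto_atTop_zero_of_tsum_ne_top hψr_sum.ne
    simpa only [add_zero] using hε_lim.add (hψ_lim.add hε_lim)
  refine le_antisymm (ge_of_tendsto' hlim fun n => ?_) zero_le
  calc flatNorm (restrict f r P)
      ≤ mass (k + 1) (toChain (d n)) +
          (mass k (slice f r (toChain (d n))) + mass k (boundary (toChain (d n)) - P)) :=
        flatNorm_restrict_le f r P _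
    _ ≤ ε n + (ψ n r + ε n) := by
        gcongr
        · exact (mass_toChain_le _).trans (hd_weight n).le
        · exact hψr n
        · exact (hd_mass n).le

theorem exists_norm_eq_one_forall_lt {C : Set X} (hconv : Convex ℝ C) (hclosed : IsClosed C)
    (hne : C.Nonempty) {x : X} (hx : x ∉ C) :
    ∃ (f : StrongDual ℝ X) (u : ℝ), ‖f‖ = 1 ∧ f x < u ∧ ∀ b ∈ C, u < f b := by
  obtain ⟨f, u, hxu, hub⟩ := geometric_hahn_banach_point_closed hconv hclosed hx
  obtain ⟨b, hb⟩ := hne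
  have hf : 0 < ‖f‖ := by
    refine norm_pos_iff.2 fun hf0 => (hxu.trans (hub b hb)).ne ?_
    rw [hf0, zero_apply, zero_apply]
  refine ⟨‖f‖⁻¹ • f, ‖f‖⁻¹ * u, ?_, mul_lt_mul_of_pos_left hxu (inv_pos.2 hf),
    fun b hb => mul_lt_mul_of_pos_left (hub b hb) (inv_pos.2 hf)⟩
  rw [norm_smul, norm_inv, norm_norm, inv_mul_cancel₀ hf.ne']

theorem exists_restrict_simple_eq (f : StrongDual ℝ X) (r : ℝ) (T : OrientedPolyhedron X k)
    (g : G) : ∃ (T' : OrientedPolyhedron X k) (g' : G), T'.carrier ⊆ T.carrier ∧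
      (restrict f r (simple T g) : PolyChain X G k) = simple T' g' := by
  by_cases h : ∃ a ∈ T.carrier, f a < r
  · exact ⟨T.below f r h, g, sep_subset _ _, restrict_simple_of_exists_lt h g⟩
  · push Not at h
    exact ⟨T, 0, subset_rfl, by rw [restrict_simple_of_forall_le h, map_zero]⟩

/- A half-space that contains `x` and misses one of the other polyhedra removes that polyhedron from
the chain. -/
theorem eq_zero_of_flatNorm_add_sum_eq_zero {ι : Type*} {s : Finset ι}
    {S : OrientedPolyhedron X k} {g : G} {x : X} (hxS : x ∈ S.carrier)
    {T : ι → OrientedPolyhedron X k} {c : ι → G} (hxT : ∀ i ∈ s, x ∉ (T i).carrier)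
    (h : flatNorm (simple S g + ∑ i ∈ s, simple (T i) (c i)) = 0) : g = 0 := by
  classical
  induction s using Finset.induction_on generalizing S T c with
  | empty => exact eq_zero_of_flatNorm_simple_eq_zero (by simpa using h)
  | insert j s hj ih =>
    have hTj := (T j).isPolyhedron
    obtain ⟨f, u, hf, hxu, hub⟩ := exists_norm_eq_one_forall_lt hTj.convex hTj.isClosed
      hTj.nonempty (hxT j (Finset.mem_insert_self j s))
    obtain ⟨r, hr, hxr, hru⟩ : ∃ r, flatNorm (restrict f r
        (simple S g + ∑ i ∈ insert j s, simple (T i) (c i))) = 0 ∧ f x < r ∧ r < u :=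
      (Measure.dense_of_ae (ae_flatNorm_restrict_eq_zero h hf)).exists_between hxu
    have hxr_exists : ∃ a ∈ S.carrier, f a < r := ⟨x, hxS, hxr⟩
    choose T' c' hT' hc' using fun i => exists_restrict_simple_eq f r (T i) (c i)
    have hrestrict : restrict f r (simple S g + ∑ i ∈ insert j s, simple (T i) (c i)) =
        simple (S.below f r hxr_exists) g + ∑ i ∈ s, simple (T' i) (c' i) := by
      rw [map_add, map_sum, Finset.sum_insert hj, restrict_simple_of_exists_lt hxr_exists,
        restrict_simple_of_forall_le fun y hy => (hru.trans (hub y hy)).le, zero_add]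
      simp only [hc']
    exact ih (S := S.below f r hxr_exists) ⟨hxS, hxr.le⟩
      (fun i hi hx => hxT i (Finset.mem_insert_of_mem hi) (hT' i hx)) (hrestrict ▸ hr)

theorem eq_zero_of_flatNorm_eq_zero {P : PolyChain X G k} (h : flatNorm P = 0) : P = 0 := by
  classical
  obtain ⟨c₀, rfl⟩ : ∃ c, toChain c = P := QuotientAddGroup.mk'_surjective _ P
  obtain ⟨c, hdisj, hc⟩ := exists_isDisjointSum_isReduction c₀
  rw [← hc.toChain_eq] at h ⊢
  suffices c = 0 by rw [this, map_zero]
  by_contra hne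
  obtain ⟨S, hS⟩ := Finsupp.support_nonempty_iff.2 hne
  obtain ⟨x, hxS, hxT⟩ := hdisj.exists_mem_forall_notMem hS
  rw [toChain_eq_sum, ← Finset.add_sum_erase _ _ hS] at h
  refine Finsupp.mem_support_iff.1 hS (eq_zero_of_flatNorm_add_sum_eq_zero hxS (T := id) ?_ h)
  exact fun T hT => hxT T (Finset.mem_of_mem_erase hT) (Finset.ne_of_mem_erase hT)

end FlatNorm

end FlatChain

end

theorem mainTheorem3_general {X : Type*} [NormedAddCommGroup X] [NormedSpace ℝ X]
    {G : Type*} [NormedAddCommGroup G] (k : ℕ) :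
    (∀ P : FlatChain.PolyChain X G k, FlatChain.flatNorm P ≠ ⊤) ∧
    FlatChain.flatNorm (0 : FlatChain.PolyChain X G k) = 0 ∧
    (∀ P : FlatChain.PolyChain X G k, FlatChain.flatNorm (-P) = FlatChain.flatNorm P) ∧
    (∀ P Q : FlatChain.PolyChain X G k,
      FlatChain.flatNorm (P + Q) ≤ FlatChain.flatNorm P + FlatChain.flatNorm Q) ∧
    (∀ P : FlatChain.PolyChain X G k, FlatChain.flatNorm P = 0 → P = 0) :=
  ⟨FlatChain.flatNorm_ne_top, FlatChain.flatNorm_zero, FlatChain.flatNorm_neg,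
    FlatChain.flatNorm_add_le, fun _ => FlatChain.eq_zero_of_flatNorm_eq_zero⟩

/-- The flat norm is a norm on the group of polyhedral `k`-chains: it is finite, vanishes at `0`,
is symmetric and subadditive, and vanishes at no other chain. -/
theorem mainTheorem3 {X : Type*} [NormedAddCommGroup X] [NormedSpace ℝ X] [CompleteSpace X]
    {G : Type*} [NormedAddCommGroup G] [CompleteSpace G] (k : ℕ) :
    (∀ P : FlatChain.PolyChain X G k, FlatChain.flatNorm P ≠ ⊤) ∧
    FlatChain.flatNorm (0 : FlatChain.PolyChain X G k) = 0 ∧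
    (∀ P : FlatChain.PolyChain X G k, FlatChain.flatNorm (-P) = FlatChain.flatNorm P) ∧
    (∀ P Q : FlatChain.PolyChain X G k,
      FlatChain.flatNorm (P + Q) ≤ FlatChain.flatNorm P + FlatChain.flatNorm Q) ∧
    (∀ P : FlatChain.PolyChain X G k, FlatChain.flatNorm P = 0 → P = 0) :=
  mainTheorem3_general k
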